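/- Let $\mathbf{k}$ be a field, $Z$ a well-ordered set and $\Omega=\{D,P\}$. Let $\mathcal S(Z)$ be the free semigroup on $Z$ and $\mathfrak S(Z)$ the free semigroup on $Z$ with two unary operators $D=\lfloor\ \rfloor_D$, $P=\lfloor\ \rfloor_P$ (bracketed words; a word is a nonempty product of atoms, each a letter or a bracket $\lfloor w\rfloor_\omega$, and its breadth is the number of atoms). Then $\mathbf{k}\mathfrak S(Z)$ is the free nonunital $\Omega$-algebra on $Z$. A $\star$-word $q\in\mathfrak S^\star(Z)$ is a word over $Z\cup\{\star\}$ containing $\star$ exactly once; $q|_u$ is obtained by replacing $\star$ by $u$, and $q|_s$ is defined linearly for $s\in\mathbf{k}\mathfrak S(Z)$. The order $\le_{\mathrm{PD}}$ on $\mathfrak S(Z)$ compares successively: the number $\deg_D$ of $D$-brackets; the number $\deg_P$ of $P$-brackets; the number $\deg_Z$ of letters; $\deg_{GD}$, the sum over the $D$-brackets of the number of letters to the right of the bracket; $\deg_{GP}$, the sum over the $P$-brackets of the number of letters outside the bracket; and finally the degree-lexicographic order on the atoms, where letters are smaller than $D$-brackets, which are smaller than $P$-brackets, and brackets of the same kind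 are compared recursively through their contents. It is a monomial order: a well-order with $u<v\Rightarrow q|_u<q|_v$. For a monomial order, $\bar f$ denotes the leading monomial of $f\neq0$. A set $\mathcal G$ is a GS basis if for all monicized nonzero $f,g\in\mathcal G$ every intersection composition $fu-vg$ (where $p=\bar fu=v\bar g$, $\max(|\bar f|,|\bar g|)<|p|<|\bar f|+|\bar g|$) and every inclusion composition $f-q|_g$ (where $p=\bar f=q|_{\bar g}$) is a linear combination of elements $q_i|_{s_i}$ with $s_i\in\mathcal G$ and $q_i|_{\bar s_i}<p$. The same definition is used in $\mathbf{k}\mathcal S(Z)$ with the degree-lexicographic order $\le_{\mathrm{dlex}}$. A GS basis of an ideal ($\Omega$-ideal) is a GS basis generating it as an ideal ($\Omega$-ideal). Let $\mathrm{OdRB}$ be the system $$\phi_1^0(x,y)=P(x)P(y)-P(xP(y))-P(P(x)y),\qquad \phi_2^0(x,y)=D(x)y+xD(y)-D(xy),$$ $$\phi_3^0(x)=D(P(x))-x,\qquad \phi_4^0(x,y)=P(x)D(y)-D(P(x)y)+xy,$$ and let $S_{\mathrm{OdRB}}(Z)$ be the set of all values of these identities at words of $\mathfrak S(Z)$. Then: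 (1) For $u,v\in\mathfrak S(Z)$ the leading monomials of $\phi_1^0(u,v),\phi_2^0(u,v),\phi_3^0(u),\phi_4^0(u,v)$ with respect to $\le_{\mathrm{PD}}$ are $P(u)P(v)$, $D(u)v$, $D(P(u))$, $P(u)D(v)$. (2) $\mathrm{OdRB}$ is $\Omega$-GS in $\mathbf{k}\mathfrak S(Z)$ with respect to $\le_{\mathrm{PD}}$; that is, $S_{\mathrm{OdRB}}(Z)$ is a GS basis. (3) A nonunital $\Omega$-algebra satisfies $\mathrm{OdRB}$ if and only if it is a differential Rota–Baxter algebra of weight $0$, i.e. $D(ab)=D(a)b+aD(b)$, $P(a)P(b)=P(aP(b))+P(P(a)b)$ and $D\circ P=\mathrm{id}$. For every nonunital algebra $A=\mathbf{k}\mathcal S(Z)/I_A$, the quotient $\mathbf{k}\mathfrak S(Z)/\langle S_{\mathrm{OdRB}}(Z)\cup I_A\rangle$ by the $\Omega$-ideal generated by $S_{\mathrm{OdRB}}(Z)\cup I_A$, with the natural map from $A$, is the free nonunital $0$-differential Rota–Baxter algebra over $A$. (4) If $G$ is a GS basis of $I_A$ with respect to $\le_{\mathrm{dlex}}$, then $S_{\mathrm{OdRB}}(Z)\cup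 G$ is a GS basis of $\langle S_{\mathrm{OdRB}}(Z)\cup I_A\rangle$ in $\mathbf{k}\mathfrak S(Z)$ with respect to $\le_{\mathrm{PD}}$. (5) In the situation of (4), the set $\mathrm{Irr}(S_{\mathrm{OdRB}}(Z)\cup G)$, which is the complement in $\mathfrak S(Z)$ of $$\{q|_{\bar s},\ q|_{P(u)P(v)},\ q|_{D(u)v},\ q|_{D(P(u))},\ q|_{P(u)D(v)} : 0\neq s\in G,\ q\in\mathfrak S^\star(Z),\ u,v\in\mathfrak S(Z)\},$$ is a linear basis of the free nonunital $0$-differential Rota–Baxter algebra over $A$. -/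

import Mathlib

universe u v w w'

noncomputable section

namespace DRB

/-! ### The free operated semigroup with two operators -/

/-- The index set `Ω = {D, P}` of the operators. -/
inductive Op : Type
  | D
  | P

/-- The order on operator symbols: `D`-brackets are smaller than `P`-brackets. -/
def Op.lt (a b : Op) : Prop := a = Op.D ∧ b = Op.P

/-- The free `Ω`-semigroup `𝔖(Z)`: bracketed words over `Z`. Every element is, in exactly one way,
a nonempty product of atoms, an atom being a letter `z` or a bracketed word `⌊w⌋_ω`. The four
constructors are `z`, `⌊w⌋_ω`, `z · w` and `⌊w⌋_ω · w'`. -/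
inductive OpWord (Z : Type u) : Type u
  | of (z : Z) : OpWord Z
  | br (ω : Op) (w : OpWord Z) : OpWord Z
  | ofCons (z : Z) (w : OpWord Z) : OpWord Z
  | brCons (ω : Op) (w w' : OpWord Z) : OpWord Z

namespace OpWord

variable {Z : Type u}

/-- Concatenation. -/
protected def mul : OpWord Z → OpWord Z → OpWord Z
  | of z, v => ofCons z v
  | br ω w, v => brCons ω w v
  | ofCons z w, v => ofCons z (OpWord.mul w v)
  | brCons ω w w', v => brCons ω w (OpWord.mul w' v)

instance : Mul (OpWord Z) := ⟨OpWord.mul⟩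

protected theorem mul_assoc' (a b c : OpWord Z) : a * b * c = a * (b * c) := by
  induction a with
  | of z => rfl
  | br ω w => rfl
  | ofCons z w ih => exact congrArg (ofCons z) ih
  | brCons ω w w' _ ih => exact congrArg (brCons ω w) ih

instance : Semigroup (OpWord Z) := ⟨OpWord.mul_assoc'⟩

/-- The value of a word in a set `S` with a product and operators when the letters take the
values `r`. -/
def lift {S : Type v} [Mul S] (op : Op → S → S) (r : Z → S) : OpWord Z → S
  | of z => r z
  | br ω w => op ω (lift op r w)
  | ofCons z w => r z * lift op r w
  | brCons ω w w' => op ω (lift op r w) * lift op r w'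

/-- The letters of `Z` occurring in a word, from left to right. -/
def letters : OpWord Z → List Z
  | of z => [z]
  | br _ w => letters w
  | ofCons z w => z :: letters w
  | brCons _ w w' => letters w ++ letters w'

/-- The breadth: the number of atoms of a word. -/
def breadth : OpWord Z → ℕ
  | of _ => 1
  | br _ _ => 1
  | ofCons _ w => breadth w + 1
  | brCons _ _ w' => breadth w' + 1

/-- The number of letters of `Z` in a word, with repetitions. -/
def degZ (w : OpWord Z) : ℕ := w.letters.length

/-- The number of occurrences of the bracket `⌊ ⌋_D`. -/
def degD : OpWord Z → ℕ
  | of _ => 0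
  | br Op.D w => degD w + 1
  | br Op.P w => degD w
  | ofCons _ w => degD w
  | brCons Op.D w w' => degD w + 1 + degD w'
  | brCons Op.P w w' => degD w + degD w'

/-- The number of occurrences of the bracket `⌊ ⌋_P`. -/
def degP : OpWord Z → ℕ
  | of _ => 0
  | br Op.D w => degP w
  | br Op.P w => degP w + 1
  | ofCons _ w => degP w
  | brCons Op.D w w' => degP w + degP w'
  | brCons Op.P w w' => degP w + 1 + degP w'

/-- The sum, over all right half brackets `⌋_D` of `w`, of the number of letters to the right of
that half bracket, when `w` itself is followed by `r` further letters. -/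
def degGDAux : ℕ → OpWord Z → ℕ
  | _, of _ => 0
  | r, br Op.D w => r + degGDAux r w
  | r, br Op.P w => degGDAux r w
  | r, ofCons _ w => degGDAux r w
  | r, brCons Op.D w w' => (r + degZ w') + degGDAux (r + degZ w') w + degGDAux r w'
  | r, brCons Op.P w w' => degGDAux (r + degZ w') w + degGDAux r w'

/-- The GD-degree. -/
def degGD (w : OpWord Z) : ℕ := degGDAux 0 w

/-- The sum, over all brackets `⌊ ⌋_P` of `w`, of the number of letters outside that bracket,
when `w` itself is surrounded by `r` further letters. -/
def degGPAux : ℕ → OpWord Z → ℕ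
  | _, of _ => 0
  | r, br Op.D w => degGPAux r w
  | r, br Op.P w => r + degGPAux r w
  | r, ofCons _ w => degGPAux (r + 1) w
  | r, brCons Op.D w w' => degGPAux (r + degZ w') w + degGPAux (r + degZ w) w'
  | r, brCons Op.P w w' =>
      (r + degZ w') + degGPAux (r + degZ w') w + degGPAux (r + degZ w) w'

/-- The GP-degree. -/
def degGP (w : OpWord Z) : ℕ := degGPAux 0 w

/-- The strict lexicographic comparison of two words of equal breadth, atom by atom from the
left. Letters are smaller than `D`-brackets, `D`-brackets are smaller than `P`-brackets, and two
brackets of the same kind are compared through their contents, first by breadth and then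
lexicographically. -/
def LexLT [LT Z] : OpWord Z → OpWord Z → Prop
  | of a, of b => a < b
  | of _, br _ _ => True
  | br ω u, br ω' v => Op.lt ω ω' ∨ (ω = ω' ∧
      (breadth u < breadth v ∨ (breadth u = breadth v ∧ LexLT u v)))
  | ofCons a u, ofCons b v => a < b ∨ (a = b ∧ LexLT u v)
  | ofCons _ _, brCons _ _ _ => True
  | brCons ω u u', brCons ω' v v' => Op.lt ω ω' ∨ (ω = ω' ∧
      ((breadth u < breadth v ∨ (breadth u = breadth v ∧ LexLT u v)) ∨ (u = v ∧ LexLT u' v')))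
  | _, _ => False

/-- The strict order `<_Dlex`: degree-lexicographic with respect to the atoms. -/
def DlexLT [LT Z] (u v : OpWord Z) : Prop :=
  breadth u < breadth v ∨ (breadth u = breadth v ∧ LexLT u v)

/-- The strict order `<_PD`: compare successively `deg_D`, `deg_P`, `deg_Z`, `deg_GD`, `deg_GP`,
and finally use `<_Dlex`. -/
def PDLT [LT Z] (u v : OpWord Z) : Prop :=
  degD u < degD v ∨ (degD u = degD v ∧
  (degP u < degP v ∨ (degP u = degP v ∧
  (degZ u < degZ v ∨ (degZ u = degZ v ∧
  (degGD u < degGD v ∨ (degGD u = degGD v ∧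
  (degGP u < degGP v ∨ (degGP u = degGP v ∧ DlexLT u v)))))))))

/-- `q|_u` for a word `q` over `Z ∪ {⋆}`, where `⋆ = none`. -/
def starSubst (q : OpWord (Option Z)) (u : OpWord Z) : OpWord Z :=
  lift br (fun z => z.elim u of) q

/-- The substitution maps `u ↦ q|_u` for `q ∈ 𝔖⋆(Z)`, that is, for the words `q` over `Z ∪ {⋆}`
in which `⋆` occurs exactly once. -/
def contexts (Z : Type u) : Set (OpWord Z → OpWord Z) :=
  {c | ∃ q : OpWord (Option Z), q.letters.countP Option.isNone = 1 ∧ c = starSubst q}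

end OpWord

/-! ### The free semigroup -/

/-- The degree-lexicographic order on the free semigroup `𝒮(Z)`. -/
def SemigroupDlexLT {Z : Type u} [LT Z] (a b : FreeSemigroup Z) : Prop :=
  a.length < b.length ∨
    (a.length = b.length ∧ List.Lex (· < ·) (a.head :: a.tail) (b.head :: b.tail))

/-- The substitution maps `u ↦ q|_u` for `q ∈ 𝒮⋆(Z)`, that is, for the words `q ∈ 𝒮(Z ∪ {⋆})` in
which `⋆` occurs exactly once. -/
def semigroupContexts (Z : Type u) : Set (FreeSemigroup Z → FreeSemigroup Z) :=
  {c | ∃ q : FreeSemigroup (Option Z), (q.head :: q.tail).countP Option.isNone = 1 ∧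
    c = fun a => FreeSemigroup.lift (fun z => z.elim a FreeSemigroup.of) q}

/-- The inclusion `𝒮(Z) → 𝔖(Z)`. -/
def inclWord (Z : Type u) : FreeSemigroup Z →ₙ* OpWord Z := FreeSemigroup.lift OpWord.of

/-! ### Gröbner–Shirshov bases

The notions below are used both for `𝔖(Z)` and for `𝒮(Z)`: `M` is the semigroup of monomials,
`lt` a strict order on it, `C` the set of all maps `u ↦ q|_u` with `q` a `⋆`-word, and `len` the
breadth. For `s` in the semigroup algebra, `q|_s` is the linear extension `mapDomain c s`. -/

section GS

variable {k : Type v} [Field k] {M : Type u} [Semigroup M]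

/-- `lt` is (the strict part of) a monomial order. -/
def IsMonomialOrder (lt : M → M → Prop) (C : Set (M → M)) : Prop :=
  IsWellOrder M lt ∧ ∀ c ∈ C, ∀ a b, lt a b → lt (c a) (c b)

/-- `m` is the leading monomial of `f` (so `f ≠ 0`). -/
def IsLeading (lt : M → M → Prop) (f : MonoidAlgebra k M) (m : M) : Prop :=
  f.coeff m ≠ 0 ∧ ∀ m', f.coeff m' ≠ 0 → m' ≠ m → lt m' m

/-- `h` is trivial modulo `(G, p)`: `h = ∑ cᵢ qᵢ|_{sᵢ}` with `sᵢ ∈ G` and `qᵢ|_{s̄ᵢ} < p`. -/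
def IsTrivialMod (lt : M → M → Prop) (C : Set (M → M)) (G : Set (MonoidAlgebra k M)) (p : M)
    (h : MonoidAlgebra k M) : Prop :=
  h ∈ Submodule.span k {x | ∃ c ∈ C, ∃ s ∈ G, ∃ m, IsLeading lt s m ∧ lt (c m) p ∧
    x = MonoidAlgebra.mapDomain c s}

/-- `G` is a Gröbner–Shirshov basis: all intersection compositions and all inclusion compositions
of pairs of monicized (nonzero) elements `f`, `g` of `G` are trivial. -/
def IsGS (lt : M → M → Prop) (C : Set (M → M)) (len : M → ℕ) (G : Set (MonoidAlgebra k M)) :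
    Prop :=
  ∀ f ∈ G, ∀ g ∈ G, ∀ mf mg, IsLeading lt f mf → IsLeading lt g mg →
    (∀ p a b, p = mf * a → p = b * mg →
      max (len mf) (len mg) < len p → len p < len mf + len mg →
      IsTrivialMod lt C G p
        (((f.coeff mf)⁻¹ • f) * MonoidAlgebra.single a 1
          - MonoidAlgebra.single b 1 * ((g.coeff mg)⁻¹ • g))) ∧
    (∀ c ∈ C, mf = c mg →
      IsTrivialMod lt C G mf
        ((f.coeff mf)⁻¹ • f - MonoidAlgebra.mapDomain c ((g.coeff mg)⁻¹ • g)))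

/-- `Irr(G)`: the monomials that are not of the form `q|_{s̄}` with `s ∈ G`. -/
def Irr (lt : M → M → Prop) (C : Set (M → M)) (G : Set (MonoidAlgebra k M)) : Set M :=
  {x | ∃ c ∈ C, ∃ s ∈ G, ∃ m, IsLeading lt s m ∧ x = c m}ᶜ

end GS

/-! ### Operated algebras -/

/-- A family of linear operators indexed by `Ω = {D, P}` on a nonunital algebra. -/
class OmegaAlgebra (k : Type v) (A : Type w) [Field k] [NonUnitalRing A] [Module k A] where
  op : Op → A →ₗ[k] A

/-- The operator `D`. -/
abbrev opD (k : Type v) {A : Type w} [Field k] [NonUnitalRing A] [Module k A] [OmegaAlgebra k A] :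
    A →ₗ[k] A := OmegaAlgebra.op Op.D

/-- The operator `P`. -/
abbrev opP (k : Type v) {A : Type w} [Field k] [NonUnitalRing A] [Module k A] [OmegaAlgebra k A] :
    A →ₗ[k] A := OmegaAlgebra.op Op.P

/-- A nonunital differential Rota–Baxter algebra of weight `lam`. -/
structure IsDiffRB (k : Type v) [Field k] (lam : k) (R : Type w) [NonUnitalRing R] [Module k R]
    [OmegaAlgebra k R] : Prop where
  deriv : ∀ a b : R, opD k (a * b) = opD k a * b + a * opD k b + lam • (opD k a * opD k b)
  rotaBaxter : ∀ a b : R,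
    opP k a * opP k b = opP k (a * opP k b) + opP k (opP k a * b) + lam • opP k (a * b)
  section_eq : ∀ a : R, opD k (opP k a) = a

/-- The free nonunital `Ω`-algebra `k𝔖(Z)`. -/
abbrev FreeOmega (k : Type v) [Field k] (Z : Type u) : Type (max u v) := MonoidAlgebra k (OpWord Z)

instance (k : Type v) [Field k] (Z : Type u) : OmegaAlgebra k (FreeOmega k Z) where
  op ω :=
    { toFun := MonoidAlgebra.mapDomain (OpWord.br ω)
      map_add' := MonoidAlgebra.mapDomain_add _
      map_smul' := fun _ _ => MonoidAlgebra.mapDomain_smul .. }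

/-- A word as an element of `k𝔖(Z)`. -/
abbrev mono (k : Type v) [Field k] {Z : Type u} (w : OpWord Z) : FreeOmega k Z :=
  MonoidAlgebra.single w 1

/-- The inclusion `k𝒮(Z) → k𝔖(Z)`. -/
def incl (k : Type v) [Field k] (Z : Type u) :
    MonoidAlgebra k (FreeSemigroup Z) →ₙₐ[k] FreeOmega k Z :=
  MonoidAlgebra.mapDomainNonUnitalAlgHom k k (inclWord Z)

/-! ### Operated polynomial identities -/

/-- The value `φ(r)` of `φ ∈ k𝔖(X)` at a family `r` of elements of an `Ω`-algebra. -/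
def evalOPI {k : Type v} [Field k] {X : Type u} {R : Type w} [NonUnitalRing R] [Module k R]
    [OmegaAlgebra k R] (r : X → R) (φ : FreeOmega k X) : R :=
  φ.coeff.sum fun m c => c • OpWord.lift (fun ω a => OmegaAlgebra.op (k := k) ω a) r m

/-- `R` is a `Φ`-algebra. -/
def SatisfiesOPIs {k : Type v} [Field k] {X : Type u} (Φ : Set (FreeOmega k X)) (R : Type w)
    [NonUnitalRing R] [Module k R] [OmegaAlgebra k R] : Prop :=
  ∀ φ ∈ Φ, ∀ r : X → R, evalOPI r φ = 0

/-- `S_Φ(Z)`: all values of the identities `φ ∈ Φ` at words of `𝔖(Z)`. -/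
def valuesOPIs {k : Type v} [Field k] {X : Type u} (Φ : Set (FreeOmega k X)) (Z : Type w) :
    Set (FreeOmega k Z) :=
  {f | ∃ φ ∈ Φ, ∃ r : X → OpWord Z, f = evalOPI (fun x => mono k (r x)) φ}

section OPIs

variable (k : Type v) [Field k]

/-- The variables `x = X 0` and `y = X 1`. -/
abbrev X (i : Fin 2) : FreeOmega k (Fin 2) := mono k (OpWord.of i)

/-- `P(x)P(y) - P(xP(y)) - P(P(x)y)`. -/
def phi1 : FreeOmega k (Fin 2) :=
  opP k (X k 0) * opP k (X k 1) - opP k (X k 0 * opP k (X k 1)) - opP k (opP k (X k 0) * X k 1)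

/-- `D(x)y + xD(y) - D(xy)`. -/
def phi2 : FreeOmega k (Fin 2) :=
  opD k (X k 0) * X k 1 + X k 0 * opD k (X k 1) - opD k (X k 0 * X k 1)

/-- `D(P(x)) - x`. -/
def phi3 : FreeOmega k (Fin 2) :=
  opD k (opP k (X k 0)) - X k 0

/-- `P(x)D(y) - D(P(x)y) + xy`. -/
def phi4 : FreeOmega k (Fin 2) :=
  opP k (X k 0) * opD k (X k 1) - opD k (opP k (X k 0) * X k 1) + X k 0 * X k 1

/-- The system of the four identities. -/
def OdRB : Set (FreeOmega k (Fin 2)) := {phi1 k, phi2 k, phi3 k, phi4 k}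

end OPIs

/-! ### Ideals and quotients -/

section Ideals

variable (k : Type v) [Field k] {A : Type w} [NonUnitalRing A] [Module k A]

/-- Two-sided ideals of a nonunital algebra. -/
def IsAlgIdeal (I : Submodule k A) : Prop := ∀ a, ∀ x ∈ I, a * x ∈ I ∧ x * a ∈ I

/-- The two-sided ideal generated by a set. -/
def algIdealSpan (S : Set A) : Submodule k A := sInf {I | IsAlgIdeal k I ∧ S ⊆ I}

variable (A) in
/-- `Ω`-ideals: two-sided ideals closed under the operators. -/
structure OmegaIdeal [OmegaAlgebra k A] extends Submodule k A where
  isAlgIdeal : IsAlgIdeal k toSubmodule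
  op_mem : ∀ ω, ∀ x ∈ toSubmodule, OmegaAlgebra.op (k := k) ω x ∈ toSubmodule

/-- The `Ω`-ideal generated by a set. -/
def omegaSpan [OmegaAlgebra k A] (S : Set A) : OmegaIdeal k A where
  toSubmodule := sInf {I | ∃ J : OmegaIdeal k A, I = J.toSubmodule ∧ S ⊆ I}
  isAlgIdeal := by
    intro a x hx
    rw [Submodule.mem_sInf] at hx
    constructor <;> rw [Submodule.mem_sInf] <;> rintro _ ⟨J, rfl, hJ⟩
    · exact (J.isAlgIdeal a x (hx _ ⟨J, rfl, hJ⟩)).1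
    · exact (J.isAlgIdeal a x (hx _ ⟨J, rfl, hJ⟩)).2
  op_mem := by
    intro ω x hx
    rw [Submodule.mem_sInf] at hx ⊢
    rintro _ ⟨J, rfl, hJ⟩
    exact J.op_mem ω x (hx _ ⟨J, rfl, hJ⟩)

end Ideals

namespace OmegaIdeal

variable {k : Type v} [Field k] {A : Type w} [NonUnitalRing A] [Module k A] [OmegaAlgebra k A]

/-- The quotient of an `Ω`-algebra by an `Ω`-ideal. -/
def Quot (I : OmegaIdeal k A) : Type w := A ⧸ I.toSubmodule

variable (I : OmegaIdeal k A)

instance : AddCommGroup I.Quot := inferInstanceAs (AddCommGroup (A ⧸ I.toSubmodule))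

instance : Module k I.Quot := inferInstanceAs (Module k (A ⧸ I.toSubmodule))

/-- The quotient map. -/
def toQuot : A →ₗ[k] I.Quot := I.toSubmodule.mkQ

theorem toQuot_surjective : Function.Surjective I.toQuot := I.toSubmodule.mkQ_surjective

theorem toQuot_eq_iff {a b : A} : I.toQuot a = I.toQuot b ↔ a - b ∈ I.toSubmodule :=
  Submodule.Quotient.eq _

instance : Mul I.Quot where
  mul := Quotient.map₂ (· * ·) (by
    intro a a' ha b b' hb
    have ha' : a - a' ∈ I.toSubmodule := (Submodule.quotientRel_def _).1 ha
    have hb' : b - b' ∈ I.toSubmodule := (Submodule.quotientRel_def _).1 hb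
    refine (Submodule.quotientRel_def _).2 ?_
    have h : a * b - a' * b' = (a - a') * b + a' * (b - b') := by
      rw [sub_mul, mul_sub]; abel
    simp only [h]
    exact add_mem (I.isAlgIdeal b _ ha').2 (I.isAlgIdeal a' _ hb').1)

theorem toQuot_mul (a b : A) : I.toQuot (a * b) = I.toQuot a * I.toQuot b := rfl

instance : NonUnitalRing I.Quot where
  left_distrib a b c := by
    obtain ⟨a, rfl⟩ := I.toQuot_surjective a
    obtain ⟨b, rfl⟩ := I.toQuot_surjective b
    obtain ⟨c, rfl⟩ := I.toQuot_surjective c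
    simp only [← map_add, ← toQuot_mul, mul_add]
  right_distrib a b c := by
    obtain ⟨a, rfl⟩ := I.toQuot_surjective a
    obtain ⟨b, rfl⟩ := I.toQuot_surjective b
    obtain ⟨c, rfl⟩ := I.toQuot_surjective c
    simp only [← map_add, ← toQuot_mul, add_mul]
  zero_mul a := by
    obtain ⟨a, rfl⟩ := I.toQuot_surjective a
    rw [← map_zero I.toQuot, ← toQuot_mul, zero_mul]
  mul_zero a := by
    obtain ⟨a, rfl⟩ := I.toQuot_surjective a
    rw [← map_zero I.toQuot, ← toQuot_mul, mul_zero]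
  mul_assoc a b c := by
    obtain ⟨a, rfl⟩ := I.toQuot_surjective a
    obtain ⟨b, rfl⟩ := I.toQuot_surjective b
    obtain ⟨c, rfl⟩ := I.toQuot_surjective c
    simp only [← toQuot_mul, mul_assoc]

instance [IsScalarTower k A A] : IsScalarTower k I.Quot I.Quot where
  smul_assoc c a b := by
    obtain ⟨a, rfl⟩ := I.toQuot_surjective a
    obtain ⟨b, rfl⟩ := I.toQuot_surjective b
    simp only [smul_eq_mul, ← map_smul, ← toQuot_mul, smul_mul_assoc]

instance [SMulCommClass k A A] : SMulCommClass k I.Quot I.Quot where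
  smul_comm c a b := by
    obtain ⟨a, rfl⟩ := I.toQuot_surjective a
    obtain ⟨b, rfl⟩ := I.toQuot_surjective b
    simp only [smul_eq_mul, ← map_smul, ← toQuot_mul, mul_smul_comm]

instance : OmegaAlgebra k I.Quot where
  op ω := I.toSubmodule.mapQ I.toSubmodule (OmegaAlgebra.op ω) fun x hx => I.op_mem ω x hx

theorem toQuot_op (ω : Op) (a : A) :
    I.toQuot (OmegaAlgebra.op (k := k) ω a) = OmegaAlgebra.op (k := k) ω (I.toQuot a) := rfl

end OmegaIdeal

/-- `ι : A → B` exhibits the `Ω`-algebra `B` as the free nonunital differential Rota–Baxter algebra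
of weight `lam` over the nonunital algebra `A` (tested on algebras in the universe `r`). -/
def IsFreeDiffRBOver.{r, u₁, u₂, v'} {k : Type v'} [Field k] (lam : k) {A : Type u₁}
    [NonUnitalRing A] [Module k A] {B : Type u₂} [NonUnitalRing B] [Module k B] [OmegaAlgebra k B]
    (ι : A →ₙₐ[k] B) : Prop :=
  IsDiffRB k lam B ∧
    ∀ (R : Type r) [NonUnitalRing R] [Module k R] [IsScalarTower k R R] [SMulCommClass k R R]
      [OmegaAlgebra k R], IsDiffRB k lam R → ∀ f : A →ₙₐ[k] R,
        ∃! F : B →ₙₐ[k] R,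
          (∀ ω b, F (OmegaAlgebra.op (k := k) ω b) = OmegaAlgebra.op (k := k) ω (F b)) ∧
          ∀ a, F (ι a) = f a

/-- `⟨S_OdRB(Z) ∪ I_A⟩` in `k𝔖(Z)`, where `A = k𝒮(Z)/I_A` is given by a surjection
`π : k𝒮(Z) → A` with kernel `I_A`. -/
def relIdeal {k : Type v} [Field k] {Z : Type u} {A : Type w} [NonUnitalRing A] [Module k A]
    (π : MonoidAlgebra k (FreeSemigroup Z) →ₙₐ[k] A) : OmegaIdeal k (FreeOmega k Z) :=
  omegaSpan k (valuesOPIs (OdRB k) Z ∪ incl k Z '' {f | π f = 0})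

end DRB

end

/-! The theorem is a confluence statement. Each identity is oriented as a rewriting rule from its
leading word to smaller words. `<_PD` is compatible with products and brackets, because the cross
terms that a product adds to `deg_GD` and `deg_GP` depend only on degrees compared earlier
(`pdLT_mul_left`, `pdLT_mul_right`). It is well-founded, because it embeds in a lexicographic
product of copies of ℕ and the shortlex order on finite lists of tokens (`pdLT_wf`).

Two occurrences of leading words in one word are nested, properly overlapping or disjoint
(`placement`, which rests on Levi's lemma). Disjoint occurrences are always harmless
(`disjoint_mem_trivialMod`); the other two kinds are the inclusion and intersection compositions, so
a GS basis has only resolvable ambiguities (`locallyConfluent_of_isGS`). A top-term cancellation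
argument then shows that every nonzero element of the ideal contains a reducible word, and
irreducible words form a basis of the quotient (`exists_reducible`, `exists_basis_irr`).

It remains to resolve the compositions of `S_OdRB(Z) ∪ G`. If a leading word sits inside an argument
of an identity, linearity of the identity in that argument settles the matter (`family_sub_mem`).
Six genuine compositions of identities remain, each settled by an explicit formula (`comp_rel1_rel1`
to `comp_rel4_rel3`). One of them, at `D(P(u))v`, leaves exactly the fourth identity: this identity
follows from the second and third and is present only to complete the system. Leading words from `G`
contain no bracket, so they meet the identities only inside arguments or across the right end of
`D(u)v`; among themselves they compose as in `k𝒮(Z)` (`incl_mem_trivialMod`).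

Freeness is independent of the order. The identities are multilinear, so their vanishing at words
gives them on the whole quotient (`isDiffRB_quot`), and the universal property comes from evaluating
words at the images of the letters (`exists_isFreeDiffRBOver`). -/

namespace DRB

namespace OpWord

variable {Z : Type u}

/-! ### Degrees of products -/

theorem of_mul (z : Z) (v : OpWord Z) : of z * v = ofCons z v := rfl
theorem br_mul (ω : Op) (w v : OpWord Z) : br ω w * v = brCons ω w v := rfl
theorem ofCons_mul (z : Z) (w v : OpWord Z) : ofCons z w * v = ofCons z (w * v) := rfl
theorem brCons_mul (ω : Op) (w w' v : OpWord Z) : brCons ω w w' * v = brCons ω w (w' * v) := rfl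

theorem breadth_pos (u : OpWord Z) : 0 < breadth u := by
  cases u <;> simp [breadth]

theorem breadth_mul (u v : OpWord Z) : breadth (u * v) = breadth u + breadth v := by
  induction u with
  | of z => simp [of_mul, breadth, add_comm]
  | br ω w => simp [br_mul, breadth, add_comm]
  | ofCons z w ih => simp [ofCons_mul, breadth, ih]; omega
  | brCons ω w w' _ ih => simp [brCons_mul, breadth, ih]; omega

theorem letters_mul (u v : OpWord Z) : letters (u * v) = letters u ++ letters v := by
  induction u with
  | of z => simp [of_mul, letters]
  | br ω w => simp [br_mul, letters]
  | ofCons z w ih => simp [ofCons_mul, letters, ih]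
  | brCons ω w w' _ ih => simp [brCons_mul, letters, ih]

theorem degZ_mul (u v : OpWord Z) : degZ (u * v) = degZ u + degZ v := by
  simp [degZ, letters_mul]

theorem degZ_of (z : Z) : degZ (of z) = 1 := rfl

theorem degZ_br (ω : Op) (u : OpWord Z) : degZ (br ω u) = degZ u := rfl

theorem degZ_pos (u : OpWord Z) : 0 < degZ u := by
  induction u with
  | of z => simp [degZ_of]
  | br ω w ih => simpa [degZ_br]
  | ofCons z w ih => rw [← of_mul, degZ_mul]; omega
  | brCons ω w w' _ ih => rw [← br_mul, degZ_mul]; omega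

theorem degD_mul (u v : OpWord Z) : degD (u * v) = degD u + degD v := by
  induction u with
  | of z => simp [of_mul, degD]
  | br ω w => cases ω <;> simp [br_mul, degD]
  | ofCons z w ih => simp [ofCons_mul, degD, ih]
  | brCons ω w w' _ ih => cases ω <;> simp [brCons_mul, degD, ih] <;> omega

theorem degP_mul (u v : OpWord Z) : degP (u * v) = degP u + degP v := by
  induction u with
  | of z => simp [of_mul, degP]
  | br ω w => cases ω <;> simp [br_mul, degP]
  | ofCons z w ih => simp [ofCons_mul, degP, ih]
  | brCons ω w w' _ ih => cases ω <;> simp [brCons_mul, degP, ih] <;> omega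

theorem degGDAux_mul (r : ℕ) (u v : OpWord Z) :
    degGDAux r (u * v) = degGDAux (r + degZ v) u + degGDAux r v := by
  induction u with
  | of z => simp [of_mul, degGDAux]
  | br ω w => cases ω <;> simp [br_mul, degGDAux]
  | ofCons z w ih => simp [ofCons_mul, degGDAux, ih]
  | brCons ω w w' _ ih =>
    cases ω <;> simp [brCons_mul, degGDAux, ih, degZ_mul, add_assoc, add_comm (degZ v)]

theorem degGPAux_mul (r : ℕ) (u v : OpWord Z) :
    degGPAux r (u * v) = degGPAux (r + degZ v) u + degGPAux (r + degZ u) v := by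
  induction u generalizing r with
  | of z => simp [of_mul, degGPAux, degZ_of]
  | br ω w => cases ω <;> simp [br_mul, degGPAux, degZ_br]
  | ofCons z w ih =>
    rw [ofCons_mul, ← of_mul z w, degZ_mul, degZ_of, of_mul]
    simp only [degGPAux, ih]
    congr 2 <;> omega
  | brCons ω w w' _ ih =>
    rw [brCons_mul, ← br_mul ω w w', degZ_mul, degZ_br, br_mul]
    cases ω <;> simp only [degGPAux, ih, degZ_mul] <;>
      simp only [add_assoc, add_left_comm, add_comm]

/-- Each of the `degD u` right half brackets sees all `r` following letters, so the offset enters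
linearly. -/
theorem degGDAux_eq (r : ℕ) (u : OpWord Z) : degGDAux r u = degGD u + r * degD u := by
  rw [degGD]
  -- A second offset is carried along because the recursion enters brackets with a changed number of
  -- following letters.
  suffices ∀ r s, degGDAux (r + s) u = degGDAux s u + r * degD u by simpa using this r 0
  clear r
  intro r s
  induction u generalizing s with
  | of z => simp [degGDAux, degD]
  | br ω w ih => cases ω <;> simp only [degGDAux, degD, ih] <;> ring
  | ofCons z w ih => simp only [degGDAux, degD, ih]
  | brCons ω w w' ih ih' => cases ω <;> (simp only [degGDAux, degD, ih, ih', add_assoc]; ring)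

theorem degGPAux_eq (r : ℕ) (u : OpWord Z) : degGPAux r u = degGP u + r * degP u := by
  rw [degGP]
  suffices ∀ r s, degGPAux (r + s) u = degGPAux s u + r * degP u by simpa using this r 0
  clear r
  intro r s
  induction u generalizing s with
  | of z => simp [degGPAux, degP]
  | br ω w ih => cases ω <;> simp only [degGPAux, degP, ih] <;> ring
  | ofCons z w ih => simp only [degGPAux, degP, ih, add_assoc]
  | brCons ω w w' ih ih' => cases ω <;> (simp only [degGPAux, degP, ih, ih', add_assoc]; ring)

/-- The cross term involves only `degZ` and `degD`, which `<_PD` compares before the GD-degree. This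
makes the order compatible with products. -/
theorem degGD_mul (u v : OpWord Z) :
    degGD (u * v) = degGD u + degZ v * degD u + degGD v := by
  rw [degGD, degGDAux_mul, degGDAux_eq, zero_add, degGD, degGD]

theorem degGP_mul (u v : OpWord Z) :
    degGP (u * v) = degGP u + degZ v * degP u + (degGP v + degZ u * degP v) := by
  rw [degGP, degGPAux_mul, degGPAux_eq, degGPAux_eq _ v, zero_add, zero_add]

theorem degGD_br (ω : Op) (u : OpWord Z) : degGD (br ω u) = degGD u := by
  cases ω <;> simp [degGD, degGDAux]

theorem degGP_br (ω : Op) (u : OpWord Z) : degGP (br ω u) = degGP u := by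
  cases ω <;> simp [degGP, degGPAux]

theorem degD_brD (u : OpWord Z) : degD (br Op.D u) = degD u + 1 := rfl
theorem degD_brP (u : OpWord Z) : degD (br Op.P u) = degD u := rfl
theorem degP_brD (u : OpWord Z) : degP (br Op.D u) = degP u := rfl
theorem degP_brP (u : OpWord Z) : degP (br Op.P u) = degP u + 1 := rfl

/-! ### `<_PD` is a well-order -/

/-- The tokens of the Polish notation of a word: breadths, letters and operators. -/
abbrev Token (Z : Type u) : Type u := ℕ ⊕ (Z ⊕ Op)

/-- The Polish notation of a word, where each bracket is followed by the breadth of its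
contents. -/
def code : OpWord Z → List (Token Z)
  | of z => [.inr (.inl z)]
  | br ω w => .inr (.inr ω) :: .inl (breadth w) :: code w
  | ofCons z w => .inr (.inl z) :: code w
  | brCons ω w w' => .inr (.inr ω) :: .inl (breadth w) :: (code w ++ code w')

/-- A bracket contributes two tokens and a letter one. Hence words that tie in the first three
degrees have codes of equal length, and for them shortlex comparison of codes is plain lexicographic
comparison. -/
theorem length_code (u : OpWord Z) : (code u).length = 2 * degD u + 2 * degP u + degZ u := by
  induction u with
  | of z => rfl
  | br ω w ih => cases ω <;> simp only [code, List.length_cons, ih, degD, degP, degZ_br] <;> omega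
  | ofCons z w ih =>
    rw [← of_mul, degZ_mul, of_mul]
    simp only [code, List.length_cons, ih, degD, degP, degZ_of]; omega
  | brCons ω w w' ih ih' =>
    rw [← br_mul, degZ_mul, br_mul]
    cases ω <;> simp only [code, List.length_cons, List.length_append, ih, ih', degD, degP,
      degZ_br] <;> omega

section Order

variable [LinearOrder Z]

theorem lexLT_trichotomous (u v : OpWord Z) (h : breadth u = breadth v) :
    LexLT u v ∨ u = v ∨ LexLT v u := by
  have op (a b : Op) : Op.lt a b ∨ a = b ∨ Op.lt b a := by
    cases a <;> cases b <;> simp [Op.lt]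
  induction u generalizing v with
  | of a =>
    cases v with
    | of b => simpa [LexLT] using lt_trichotomy a b
    | br ω w => simp [LexLT]
    | ofCons b w => have := breadth_pos w; simp [breadth] at h; omega
    | brCons ω w w' => have := breadth_pos w'; simp [breadth] at h; omega
  | br ω w ih =>
    cases v with
    | of b => simp [LexLT]
    | br ω' w' =>
      rcases op ω ω' with h1 | rfl | h1
      · simp [LexLT, h1]
      · rcases lt_trichotomy (breadth w) (breadth w') with h2 | h2 | h2
        · simp [LexLT, h2]
        · have := ih w' h2
          simp only [LexLT, br.injEq, true_and, h2, lt_irrefl, false_or]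
          tauto
        · simp [LexLT, h2]
      · simp [LexLT, h1]
    | ofCons b w => have := breadth_pos w; simp [breadth] at h; omega
    | brCons ω w w' => have := breadth_pos w'; simp [breadth] at h; omega
  | ofCons a u ih =>
    have := breadth_pos u
    cases v with
    | of b => simp [breadth] at h; omega
    | br ω w => simp [breadth] at h; omega
    | ofCons b w =>
      simp only [breadth, add_left_inj] at h
      have := ih w h
      have := lt_trichotomy a b
      simp only [LexLT, ofCons.injEq]
      grind
    | brCons ω w w' => simp [LexLT]
  | brCons ω u u' ih ih' =>
    have := breadth_pos u'
    cases v with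
    | of b => simp [breadth] at h; omega
    | br ω w => simp [breadth] at h; omega
    | ofCons b w => simp [LexLT]
    | brCons ω' w w' =>
      simp only [breadth, add_left_inj] at h
      have h' := ih' w' h
      have h1 := op ω ω'
      have h2 := lt_trichotomy (breadth u) (breadth w)
      have h3 := ih w
      simp only [LexLT, brCons.injEq]
      grind

/-- The order on tokens. -/
abbrev Token.lt : Token Z → Token Z → Prop := Sum.Lex (· < ·) (Sum.Lex (· < ·) Op.lt)

/-- The comparison is decided strictly inside the two codes, so the tails `s` and `t` are arbitrary.
This generality lets the induction enter a bracket whose code is followed by the code of the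
remaining word. The breadth token in front of the contents reproduces the breadth-first comparison
of contents. -/
theorem lex_code (u v : OpWord Z) (h : LexLT u v) (s t : List (Token Z)) :
    List.Lex Token.lt (code u ++ s) (code v ++ t) := by
  induction u generalizing v s t with
  | of a =>
    cases v with
    | of b => exact .rel (.inr (.inl h))
    | br ω w => exact .rel (.inr (.sep _ _))
    | ofCons b w => exact h.elim
    | brCons ω w w' => exact h.elim
  | br ω w ih =>
    cases v with
    | of b => exact h.elim
    | br ω' w' =>
      rcases h with h | ⟨rfl, h | ⟨h, h'⟩⟩
      · exact .rel (.inr (.inr h))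
      · exact .cons (.rel (.inl h))
      · simp only [code, h]
        exact .cons (.cons (ih _ h' _ _))
    | ofCons b w => exact h.elim
    | brCons ω w w' => exact h.elim
  | ofCons a u ih =>
    cases v with
    | of b => exact h.elim
    | br ω w => exact h.elim
    | ofCons b w =>
      rcases h with h | ⟨rfl, h⟩
      · exact .rel (.inr (.inl h))
      · exact .cons (ih _ h _ _)
    | brCons ω w w' => exact .rel (.inr (.sep _ _))
  | brCons ω u u' ih ih' =>
    cases v with
    | of b => exact h.elim
    | br ω w => exact h.elim
    | ofCons b w => exact h.elim
    | brCons ω' w w' =>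
      rcases h with h | ⟨rfl, (h | ⟨h, h'⟩) | ⟨rfl, h⟩⟩
      · exact .rel (.inr (.inr h))
      · exact .cons (.rel (.inl h))
      · simp only [code, h, List.cons_append, List.append_assoc]
        exact .cons (.cons (ih _ h' _ _))
      · simp only [code, List.cons_append, List.append_assoc]
        exact .cons (.cons (List.Lex.append_left _ (ih' _ h _ _) _))

/-- Lexicographic order on lists is not well-founded, but shortlex is; the preceding degrees fix the
length of the code, so nothing is lost by passing to shortlex. -/
theorem pdLT_wf [WellFoundedLT Z] : WellFounded (PDLT (Z := Z)) := by
  have hop : WellFounded Op.lt := by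
    refine Subrelation.wf (r := InvImage (· < ·) fun a : Op => Op.rec 0 1 a) ?_
      (InvImage.wf _ (wellFounded_lt (α := ℕ)))
    rintro _ _ ⟨rfl, rfl⟩
    exact Nat.zero_lt_one
  have htok : WellFounded (Token.lt (Z := Z)) :=
    Sum.lex_wf wellFounded_lt (Sum.lex_wf wellFounded_lt hop)
  have hn : WellFounded ((· < ·) : ℕ → ℕ → Prop) := wellFounded_lt
  refine Subrelation.wf (r := InvImage
    (Prod.Lex (· < ·) (Prod.Lex (· < ·) (Prod.Lex (· < ·) (Prod.Lex (· < ·) (Prod.Lex (· < ·)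
      (List.Shortlex (Token.lt (Z := Z)))))))) fun w : OpWord Z =>
      -- The extra leading token is the breadth of the whole word, which `DlexLT` compares first.
      (degD w, degP w, degZ w, degGD w, degGP w, Sum.inl (breadth w) :: code w)) ?_
    (InvImage.wf _ (hn.prod_lex (hn.prod_lex (hn.prod_lex (hn.prod_lex (hn.prod_lex
      (List.Shortlex.wf htok)))))))
  intro u v h
  simp only [InvImage, Prod.lex_def]
  rcases h with h | ⟨h1, h | ⟨h2, h | ⟨h3, h | ⟨h4, h | ⟨h5, h⟩⟩⟩⟩⟩
  · simp [h]
  · simp [h1, h]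
  · simp [h1, h2, h]
  · simp [h1, h2, h3, h]
  · simp [h1, h2, h3, h4, h]
  · refine .inr ⟨h1, .inr ⟨h2, .inr ⟨h3, .inr ⟨h4, .inr ⟨h5, ?_⟩⟩⟩⟩⟩
    refine .of_lex ?_ ?_
    · simp [length_code, h1, h2, h3]
    · rcases h with h | ⟨h, h'⟩
      · exact .rel (.inl h)
      · rw [h]
        simpa using List.Lex.cons (a := Sum.inl (breadth v)) (lex_code _ _ h' [] [])

theorem dlexLT_trichotomous (u v : OpWord Z) : DlexLT u v ∨ u = v ∨ DlexLT v u := by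
  have h1 := lt_trichotomy (breadth u) (breadth v)
  have h2 := lexLT_trichotomous u v
  unfold DlexLT
  tauto

instance [WellFoundedLT Z] : IsWellOrder (OpWord Z) PDLT where
  wf := pdLT_wf
  trichotomous u v h h' := by
    have h1 := lt_trichotomy (degD u) (degD v)
    have h2 := lt_trichotomy (degP u) (degP v)
    have h3 := lt_trichotomy (degZ u) (degZ v)
    have h4 := lt_trichotomy (degGD u) (degGD v)
    have h5 := lt_trichotomy (degGP u) (degGP v)
    have h6 := dlexLT_trichotomous u v
    unfold PDLT at h h'
    grind

/-! ### Compatibility with the operations -/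

theorem lexLT_mul_left (a : OpWord Z) {u v : OpWord Z} (h : LexLT u v) : LexLT (a * u) (a * v) := by
  induction a with
  | of z => exact .inr ⟨rfl, h⟩
  | br ω w => exact .inr ⟨rfl, .inr ⟨rfl, h⟩⟩
  | ofCons z w ih => exact .inr ⟨rfl, ih⟩
  | brCons ω w w' _ ih => exact .inr ⟨rfl, .inr ⟨rfl, ih⟩⟩

theorem lexLT_mul_right (b : OpWord Z) {u v : OpWord Z} (h : LexLT u v) :
    LexLT (u * b) (v * b) := by
  induction u generalizing v with
  | of a =>
    cases v with
    | of b => exact .inl h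
    | br ω w => trivial
    | ofCons b w => exact h.elim
    | brCons ω w w' => exact h.elim
  | br ω w ih =>
    cases v with
    | of b => exact h.elim
    | br ω' w' => exact h.imp id fun h => ⟨h.1, .inl h.2⟩
    | ofCons b w => exact h.elim
    | brCons ω w w' => exact h.elim
  | ofCons a u ih =>
    cases v with
    | of b => exact h.elim
    | br ω w => exact h.elim
    | ofCons b w => exact h.imp id fun h => ⟨h.1, ih h.2⟩
    | brCons ω w w' => trivial
  | brCons ω u u' ih ih' =>
    cases v with
    | of b => exact h.elim
    | br ω w => exact h.elim
    | ofCons b w => exact h.elim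
    | brCons ω' w w' => exact h.imp id fun h => ⟨h.1, h.2.imp id fun h => ⟨h.1, ih' h.2⟩⟩

theorem dlexLT_mul_left (a : OpWord Z) {u v : OpWord Z} (h : DlexLT u v) :
    DlexLT (a * u) (a * v) := by
  rcases h with h | ⟨h, h'⟩
  · exact .inl (by simpa [breadth_mul])
  · exact .inr ⟨by simpa [breadth_mul], lexLT_mul_left a h'⟩

theorem dlexLT_mul_right (b : OpWord Z) {u v : OpWord Z} (h : DlexLT u v) :
    DlexLT (u * b) (v * b) := by
  rcases h with h | ⟨h, h'⟩
  · exact .inl (by simpa [breadth_mul])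
  · exact .inr ⟨by simpa [breadth_mul], lexLT_mul_right b h'⟩

theorem dlexLT_br (ω : Op) {u v : OpWord Z} (h : DlexLT u v) : DlexLT (br ω u) (br ω v) :=
  .inr ⟨rfl, .inr ⟨rfl, h⟩⟩

/-- At each level of the comparison the earlier degrees already agree, so the contributions of `a`,
cross terms included, are the same on both sides. -/
theorem pdLT_mul_left (a : OpWord Z) {u v : OpWord Z} (h : PDLT u v) : PDLT (a * u) (a * v) := by
  simp only [PDLT, degD_mul, degP_mul, degZ_mul, degGD_mul, degGP_mul, add_lt_add_iff_left,
    add_right_inj]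
  rcases h with h | ⟨h1, h | ⟨h2, h | ⟨h3, h | ⟨h4, h | ⟨h5, h⟩⟩⟩⟩⟩
  · exact .inl h
  · simp [h1, h]
  · simp [h1, h2, h]
  · simp [h1, h2, h3, h]
  · simp [h1, h2, h3, h4, h]
  · simp [h1, h2, h3, h4, h5, dlexLT_mul_left a h]

theorem pdLT_mul_right (b : OpWord Z) {u v : OpWord Z} (h : PDLT u v) : PDLT (u * b) (v * b) := by
  simp only [PDLT, degD_mul, degP_mul, degZ_mul, degGD_mul, degGP_mul, add_lt_add_iff_right,
    add_left_inj]
  rcases h with h | ⟨h1, h | ⟨h2, h | ⟨h3, h | ⟨h4, h | ⟨h5, h⟩⟩⟩⟩⟩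
  · exact .inl h
  · simp [h1, h]
  · simp [h1, h2, h]
  · simp [h1, h2, h3, h]
  · simp [h1, h2, h3, h4, h]
  · simp [h1, h2, h3, h4, h5, dlexLT_mul_right b h]

theorem pdLT_br (ω : Op) {u v : OpWord Z} (h : PDLT u v) : PDLT (br ω u) (br ω v) := by
  have hd := dlexLT_br ω (u := u) (v := v)
  cases ω <;> simp only [PDLT, degD_brD, degD_brP, degP_brD, degP_brP, degZ_br, degGD_br, degGP_br,
      add_lt_add_iff_right, add_left_inj] <;> unfold PDLT at h <;> tauto

end Order

end OpWord

end DRB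

namespace DRB

namespace OpWord

variable {Z : Type u}

/-! ### Words as nonempty products of atoms -/

theorem atomInduction {p : OpWord Z → Prop} (atom : ∀ x, breadth x = 1 → p x)
    (mul : ∀ x u, breadth x = 1 → p u → p (x * u)) (u : OpWord Z) : p u := by
  induction u with
  | of z => exact atom _ rfl
  | br ω w => exact atom _ rfl
  | ofCons z w ih => exact mul (of z) w rfl ih
  | brCons ω w w' _ ih => exact mul (br ω w) w' rfl ih

/-- The constructors of `OpWord` encode unique factorization into atoms. Working in `WithOne` treats
empty and nonempty cofactors together. -/
theorem atom_mul_cancel {x y : OpWord Z} (hx : breadth x = 1) (hy : breadth y = 1)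
    {b d : WithOne (OpWord Z)} (h : (x : WithOne (OpWord Z)) * b = y * d) : x = y ∧ b = d := by
  have key (u : OpWord Z) (hu : breadth u = 1) : (∃ z, u = of z) ∨ ∃ ω w, u = br ω w := by
    cases u with
    | of z => exact .inl ⟨z, rfl⟩
    | br ω w => exact .inr ⟨ω, w, rfl⟩
    | ofCons z w => have := breadth_pos w; simp [breadth] at hu; omega
    | brCons ω w w' => have := breadth_pos w'; simp [breadth] at hu; omega
  rcases key x hx with ⟨z, rfl⟩ | ⟨ω, w, rfl⟩ <;> rcases key y hy with ⟨z, rfl⟩ | ⟨ω, w, rfl⟩ <;>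
    cases b <;> cases d <;>
    simp only [mul_one, ← WithOne.coe_mul, WithOne.coe_inj, of_mul, br_mul, ofCons.injEq,
      brCons.injEq, of.injEq, br.injEq, reduceCtorEq] at h ⊢ <;> tauto

theorem coe_mul_ne_one (x : OpWord Z) (b : WithOne (OpWord Z)) :
    (x : WithOne (OpWord Z)) * b ≠ 1 := by
  cases b <;> simp [← WithOne.coe_mul]

/-- Levi's lemma. -/
theorem levi {a b c d : WithOne (OpWord Z)} (h : a * b = c * d) :
    ∃ t, (a = c * t ∧ d = t * b) ∨ (c = a * t ∧ b = t * d) := by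
  cases a with
  | one => exact ⟨c, .inr ⟨by simp, by simpa using h⟩⟩
  | coe u =>
    induction u using atomInduction generalizing c with
    | atom x hx =>
      cases c with
      | one => exact ⟨x, .inl ⟨by simp, by simpa using h.symm⟩⟩
      | coe v =>
        induction v using atomInduction with
        | atom y hy =>
          obtain ⟨rfl, rfl⟩ := atom_mul_cancel hx hy h
          exact ⟨1, .inl ⟨by simp, by simp⟩⟩
        | mul y w hy _ =>
          rw [WithOne.coe_mul, mul_assoc] at h
          obtain ⟨rfl, rfl⟩ := atom_mul_cancel hx hy h
          exact ⟨w, .inr ⟨by simp, rfl⟩⟩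
    | mul x u hx ih =>
      rw [WithOne.coe_mul, mul_assoc] at h
      cases c with
      | one => exact ⟨x * u, .inl ⟨by simp, by simpa [mul_assoc] using h.symm⟩⟩
      | coe v =>
        induction v using atomInduction with
        | atom y hy =>
          obtain ⟨rfl, rfl⟩ := atom_mul_cancel hx hy h
          exact ⟨u, .inl ⟨by simp, rfl⟩⟩
        | mul y w hy _ =>
          rw [WithOne.coe_mul, mul_assoc] at h
          obtain ⟨rfl, h'⟩ := atom_mul_cancel hx hy h
          obtain ⟨t, ⟨h1, h2⟩ | ⟨h1, h2⟩⟩ := ih h'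
          · exact ⟨t, .inl ⟨by simp [h1, mul_assoc], h2⟩⟩
          · exact ⟨t, .inr ⟨by simp [h1, mul_assoc], h2⟩⟩

theorem atom_eq_mul {x : OpWord Z} (hx : breadth x = 1) {s t : WithOne (OpWord Z)}
    (h : (x : WithOne (OpWord Z)) = s * t) : (s = 1 ∧ t = x) ∨ (s = x ∧ t = 1) := by
  cases s with
  | one => simp [h]
  | coe s =>
    cases t with
    | one => simp [h]
    | coe t =>
      rw [← WithOne.coe_mul, WithOne.coe_inj] at h
      have := breadth_pos s
      have := breadth_pos t
      rw [h, breadth_mul] at hx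
      omega

/-! ### Contexts -/

/-- `a u b` for possibly empty words `a` and `b`. -/
def sand (a b : WithOne (OpWord Z)) (u : OpWord Z) : OpWord Z :=
  WithOne.recOneCoe (WithOne.recOneCoe u (fun b => u * b) b)
    (fun a => WithOne.recOneCoe (a * u) (fun b => a * u * b) b) a

theorem coe_sand (a b : WithOne (OpWord Z)) (u : OpWord Z) :
    (sand a b u : WithOne (OpWord Z)) = a * u * b := by
  cases a <;> cases b <;> simp [sand]

/-- The substitution maps `u ↦ q|_u`, described recursively: `q` is either `a ⋆ b` or
`a ⌊q'⌋_ω b`. -/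
inductive IsContext : (OpWord Z → OpWord Z) → Prop
  | hole (a b : WithOne (OpWord Z)) : IsContext (sand a b)
  | nest (a b : WithOne (OpWord Z)) (ω : Op) {c : OpWord Z → OpWord Z} (hc : IsContext c) :
      IsContext fun u => sand a b (br ω (c u))

namespace IsContext

theorem congr {c c' : OpWord Z → OpWord Z} (hc : IsContext c) (h : ∀ u, c' u = c u) :
    IsContext c' := by
  rwa [funext h]

theorem id : IsContext fun u : OpWord Z => u :=
  (hole 1 1).congr fun _ => rfl

theorem sand {c : OpWord Z → OpWord Z} (hc : IsContext c) (a b : WithOne (OpWord Z)) :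
    IsContext fun u => sand a b (c u) := by
  cases hc with
  | hole a' b' =>
    refine (hole (a * a') (b' * b)).congr fun u => WithOne.coe_inj.1 ?_
    simp [coe_sand, mul_assoc]
  | nest a' b' ω hc =>
    refine (nest (a * a') (b' * b) ω hc).congr fun u => WithOne.coe_inj.1 ?_
    simp [coe_sand, mul_assoc]

theorem mul_left {c : OpWord Z → OpWord Z} (hc : IsContext c) (a : OpWord Z) :
    IsContext fun u => a * c u :=
  (hc.sand a 1).congr fun _ => rfl

theorem mul_right {c : OpWord Z → OpWord Z} (hc : IsContext c) (b : OpWord Z) :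
    IsContext fun u => c u * b :=
  (hc.sand 1 b).congr fun _ => rfl

theorem br {c : OpWord Z → OpWord Z} (hc : IsContext c) (ω : Op) :
    IsContext fun u => br ω (c u) :=
  (nest 1 1 ω hc).congr fun _ => rfl

theorem comp {d c : OpWord Z → OpWord Z} (hd : IsContext d) (hc : IsContext c) :
    IsContext fun u => d (c u) := by
  induction hd with
  | hole a b => exact hc.sand a b
  | nest a b ω _ ih => exact (ih.br ω).sand a b

/-- Contexts are generated from the bare hole by one-sided multiplications and brackets, so a
property stable under these three operations needs no case analysis on empty sides. -/
theorem induct {motive : (OpWord Z → OpWord Z) → Prop} (id : motive fun u => u)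
    (mul_left : ∀ c a, motive c → motive fun u => a * c u)
    (mul_right : ∀ c b, motive c → motive fun u => c u * b)
    (br : ∀ c ω, motive c → motive fun u => .br ω (c u)) {c : OpWord Z → OpWord Z}
    (hc : IsContext c) : motive c := by
  have hsand (a b : WithOne (OpWord Z)) (c : OpWord Z → OpWord Z) (hc : motive c) :
      motive fun u => OpWord.sand a b (c u) := by
    cases a <;> cases b
    · exact hc
    · exact mul_right _ _ hc
    · exact mul_left _ _ hc
    · exact mul_right _ _ (mul_left _ _ hc)
  induction hc with
  | hole a b => exact hsand a b _ id
  | nest a b ω _ ih => exact hsand a b _ (br _ ω ih)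

end IsContext

theorem lift_mul {S : Type v} [Semigroup S] (op : Op → S → S) (r : Z → S) (u v : OpWord Z) :
    lift op r (u * v) = lift op r u * lift op r v := by
  induction u with
  | of z => rfl
  | br ω w => rfl
  | ofCons z w ih => simp [ofCons_mul, lift, ih, mul_assoc]
  | brCons ω w w' _ ih => simp [brCons_mul, lift, ih, mul_assoc]

theorem starSubst_mul (q q' : OpWord (Option Z)) (u : OpWord Z) :
    starSubst (q * q') u = starSubst q u * starSubst q' u := lift_mul ..

/-- A word, seen as a word over `Z ∪ {⋆}`. -/
def someWord (w : OpWord Z) : OpWord (Option Z) := lift br (fun z => of (some z)) w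

theorem starSubst_someWord (w u : OpWord Z) : starSubst (someWord w) u = w := by
  induction w with
  | of z => rfl
  | br ω w ih => exact congrArg (br ω) ih
  | ofCons z w ih => exact congrArg (of z * ·) ih
  | brCons ω w w' ih ih' => exact congrArg₂ (br ω · * ·) ih ih'

theorem count_someWord (w : OpWord Z) : (someWord w).letters.countP Option.isNone = 0 := by
  induction w with
  | of z => rfl
  | br ω w ih => exact ih
  | ofCons z w ih => exact ih
  | brCons ω w w' ih ih' =>
    change (br ω (someWord w) * someWord w').letters.countP _ = 0
    rw [letters_mul, List.countP_append, ih', add_zero]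
    exact ih

/-- In a product containing `⋆` once, one factor has no star; that factor becomes a fixed word. -/
theorem starSubst_of_count_eq_zero (q : OpWord (Option Z))
    (hq : q.letters.countP Option.isNone = 0) : ∃ w, ∀ u, starSubst q u = w := by
  induction q with
  | of z =>
    cases z with
    | none => simp [letters] at hq
    | some z => exact ⟨of z, fun _ => rfl⟩
  | br ω q ih =>
    obtain ⟨w, hw⟩ := ih hq
    exact ⟨br ω w, fun u => congrArg (br ω) (hw u)⟩
  | ofCons z q ih =>
    cases z with
    | none => simp [letters] at hq
    | some z =>
      obtain ⟨w, hw⟩ := ih (by simpa [letters] using hq)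
      exact ⟨of z * w, fun u => congrArg (of z * ·) (hw u)⟩
  | brCons ω q q' ih ih' =>
    rw [letters, List.countP_append, add_eq_zero] at hq
    obtain ⟨w, hw⟩ := ih hq.1
    obtain ⟨w', hw'⟩ := ih' hq.2
    exact ⟨br ω w * w', fun u => congrArg₂ (br ω · * ·) (hw u) (hw' u)⟩

theorem isContext_starSubst (q : OpWord (Option Z)) (hq : q.letters.countP Option.isNone = 1) :
    IsContext (starSubst q) := by
  induction q with
  | of z =>
    cases z with
    | none => exact .id
    | some z => simp [letters] at hq
  | br ω q ih => exact (ih hq).br ω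
  | ofCons z q ih =>
    cases z with
    | none =>
      obtain ⟨w, hw⟩ := starSubst_of_count_eq_zero q (by simpa [letters] using hq)
      exact (IsContext.id.mul_right w).congr fun u => congrArg (u * ·) (hw u)
    | some z => exact (ih (by simpa [letters] using hq)).mul_left (of z)
  | brCons ω q q' ih ih' =>
    rw [letters, List.countP_append] at hq
    obtain ⟨h1, h2⟩ | ⟨h1, h2⟩ : q.letters.countP Option.isNone = 1 ∧
        q'.letters.countP Option.isNone = 0 ∨ q.letters.countP Option.isNone = 0 ∧
        q'.letters.countP Option.isNone = 1 := by omega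
    · obtain ⟨w, hw⟩ := starSubst_of_count_eq_zero q' h2
      exact (((ih h1).br ω).mul_right w).congr fun u =>
        congrArg (br ω (starSubst q u) * ·) (hw u)
    · obtain ⟨w, hw⟩ := starSubst_of_count_eq_zero q h1
      exact ((ih' h2).mul_left (br ω w)).congr fun u =>
        congrArg (br ω · * starSubst q' u) (hw u)

theorem contexts_eq (Z : Type u) : contexts Z = {c | IsContext c} := by
  ext c
  constructor
  · rintro ⟨q, hq, rfl⟩
    exact isContext_starSubst q hq
  · intro hc
    refine IsContext.induct (motive := (· ∈ contexts Z)) ⟨of none, rfl, rfl⟩ ?_ ?_ ?_ hc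
    · rintro c a ⟨q, hq, rfl⟩
      exact ⟨someWord a * q, by rw [letters_mul, List.countP_append, count_someWord, hq],
        by funext u; rw [starSubst_mul, starSubst_someWord]⟩
    · rintro c b ⟨q, hq, rfl⟩
      exact ⟨q * someWord b, by rw [letters_mul, List.countP_append, count_someWord, hq],
        by funext u; rw [starSubst_mul, starSubst_someWord]⟩
    · rintro c ω ⟨q, hq, rfl⟩
      exact ⟨.br ω q, hq, rfl⟩

theorem mem_contexts {c : OpWord Z → OpWord Z} : c ∈ contexts Z ↔ IsContext c := by
  rw [contexts_eq]; rfl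

theorem isMonomialOrder_pdLT [LinearOrder Z] [WellFoundedLT Z] :
    IsMonomialOrder (PDLT (Z := Z)) (contexts Z) := by
  refine ⟨inferInstance, fun c hc => ?_⟩
  exact IsContext.induct (motive := fun c => ∀ a b, PDLT a b → PDLT (c a) (c b))
    (fun _ _ h => h) (fun c a ih _ _ h => pdLT_mul_left a (ih _ _ h))
    (fun c b ih _ _ h => pdLT_mul_right b (ih _ _ h)) (fun c ω ih _ _ h => pdLT_br ω (ih _ _ h))
    (mem_contexts.1 hc)

/-! ### Relative position of two subwords -/

/-- The possible positions of the subwords `m₁` and `m₂` of `c₁ m₁ = c₂ m₂`. -/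
inductive Placement : (OpWord Z → OpWord Z) → OpWord Z → (OpWord Z → OpWord Z) → OpWord Z → Prop
  | nested {c₁ c₂ c : OpWord Z → OpWord Z} {m₁ m₂ : OpWord Z} (hc : IsContext c)
      (hm : m₁ = c m₂) (h : ∀ u, c₂ u = c₁ (c u)) : Placement c₁ m₁ c₂ m₂
  | overlap {c₁ c₂ d : OpWord Z → OpWord Z} {t r s : OpWord Z} (hd : IsContext d)
      (h₁ : ∀ u, c₁ u = d (u * s)) (h₂ : ∀ u, c₂ u = d (t * u)) :
      Placement c₁ (t * r) c₂ (r * s)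
  | disjoint {c₁ c₂ : OpWord Z → OpWord Z} {C : OpWord Z → OpWord Z → OpWord Z}
      {m₁ m₂ : OpWord Z} (hl : ∀ y, IsContext fun x => C x y) (hr : ∀ x, IsContext fun y => C x y)
      (h₁ : ∀ u, c₁ u = C u m₂) (h₂ : ∀ u, c₂ u = C m₁ u) : Placement c₁ m₁ c₂ m₂
  | symm {c₁ c₂ : OpWord Z → OpWord Z} {m₁ m₂ : OpWord Z} (h : Placement c₂ m₂ c₁ m₁) :
      Placement c₁ m₁ c₂ m₂

theorem Placement.comp {d c₁ c₂ : OpWord Z → OpWord Z} {m₁ m₂ : OpWord Z} (hd : IsContext d)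
    (h : Placement c₁ m₁ c₂ m₂) : Placement (fun u => d (c₁ u)) m₁ (fun u => d (c₂ u)) m₂ := by
  induction h with
  | nested hc hm h => exact .nested hc hm fun u => by rw [h]
  | overlap hd' h₁ h₂ =>
    exact .overlap (hd.comp hd') (fun u => by rw [h₁]) fun u => by rw [h₂]
  | disjoint hl hr h₁ h₂ =>
    exact .disjoint (fun y => hd.comp (hl y)) (fun x => hd.comp (hr x)) (fun u => by rw [h₁])
      fun u => by rw [h₂]
  | symm _ ih => exact .symm ih

/-- Two subwords of the form `c₁ m₁ = a (f m₁) s (g m₂) d`. -/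
theorem Placement.disjoint_sand {f g c₁ c₂ : OpWord Z → OpWord Z} {m₁ m₂ : OpWord Z}
    (hf : IsContext f) (hg : IsContext g) (a s d : WithOne (OpWord Z))
    (h₁ : ∀ u, (c₁ u : WithOne (OpWord Z)) = a * f u * s * g m₂ * d)
    (h₂ : ∀ u, (c₂ u : WithOne (OpWord Z)) = a * f m₁ * s * g u * d) :
    Placement c₁ m₁ c₂ m₂ := by
  refine .disjoint (C := fun x y => sand a (s * g y * d) (f x)) (fun y => hf.sand _ _)
    (fun x => (hg.sand (a * f x * s) d).congr fun y => WithOne.coe_inj.1 ?_)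
    (fun u => WithOne.coe_inj.1 ?_) fun u => WithOne.coe_inj.1 ?_ <;>
    simp [coe_sand, mul_assoc, h₁, h₂]

/-- Levi's lemma compares the starting points of the two subwords, then the end of the first with
the start of the second, and finally the two ends. Empty pieces are what separate nesting or
adjacency from a proper overlap. -/
theorem Placement.sand_sand {a b c d : WithOne (OpWord Z)} {m₁ m₂ : OpWord Z}
    (h : sand a b m₁ = sand c d m₂) : Placement (sand a b) m₁ (sand c d) m₂ := by
  -- By symmetry `m₁` may be assumed to start no later than `m₂`.
  have main {a b c d : WithOne (OpWord Z)} {m₁ m₂ : OpWord Z} {t : WithOne (OpWord Z)}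
      (hc : c = a * t) (h : m₁ * b = t * (m₂ * d)) : Placement (sand a b) m₁ (sand c d) m₂ := by
    subst hc
    obtain ⟨s, ⟨h1, h2⟩ | ⟨h1, rfl⟩⟩ := levi h
    · obtain ⟨r, ⟨h3, rfl⟩ | ⟨h3, rfl⟩⟩ := levi h2
      · cases t with
        | one =>
          rw [one_mul] at h1
          exact .symm (.nested (.hole 1 r) (WithOne.coe_inj.1 (by simp [coe_sand, h1, h3]))
            -- Below, `t` and `s` are the parts of `m₁` before and inside `m₂`, and `r` is the rest
            -- of `m₂`. An empty `s` means adjacency, hence disjointness; an empty `r` means that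
            -- `m₂` is a suffix of `m₁`.
            fun u => WithOne.coe_inj.1 (by simp [coe_sand, mul_assoc]))
        | coe t =>
          cases s with
          | one =>
            rw [mul_one, WithOne.coe_inj] at h1
            rw [one_mul] at h3
            exact .disjoint_sand .id .id a 1 d (fun u => by simp [coe_sand, mul_assoc, h3])
              fun u => by simp [coe_sand, h1]
          | coe s =>
            cases r with
            | one =>
              rw [mul_one, WithOne.coe_inj] at h3
              subst h3
              exact .nested (.hole t 1) (WithOne.coe_inj.1 (by simp [coe_sand, h1]))
                fun u => WithOne.coe_inj.1 (by simp [coe_sand, mul_assoc])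
            | coe r =>
              rw [← WithOne.coe_mul, WithOne.coe_inj] at h1 h3
              subst h1 h3
              exact .overlap (.hole a d)
                (fun u => WithOne.coe_inj.1 (by simp [coe_sand, mul_assoc]))
                fun u => WithOne.coe_inj.1 (by simp [coe_sand, mul_assoc])
      · exact .nested (.hole t r) (WithOne.coe_inj.1 (by simp [coe_sand, h1, h3, mul_assoc]))
          fun u => WithOne.coe_inj.1 (by simp [coe_sand, mul_assoc])
    · exact .disjoint_sand .id .id a s d (fun u => by simp [coe_sand, mul_assoc])
        fun u => by simp [coe_sand, mul_assoc, h1]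
  rw [← WithOne.coe_inj, coe_sand, coe_sand, mul_assoc, mul_assoc] at h
  obtain ⟨t, ⟨h1, h2⟩ | ⟨h1, h2⟩⟩ := levi h
  · exact .symm (main h1 h2)
  · exact main h1 h2

/-- A bracket is a single atom, so it lies entirely inside `m₁` or entirely outside it; a proper
overlap cannot occur. -/
theorem Placement.sand_nest {a b c d : WithOne (OpWord Z)} {m₁ m₂ : OpWord Z} {ω : Op}
    {e : OpWord Z → OpWord Z} (he : IsContext e) (h : sand a b m₁ = sand c d (br ω (e m₂))) :
    Placement (sand a b) m₁ (fun u => sand c d (br ω (e u))) m₂ := by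
  have hat : breadth (br ω (e m₂)) = 1 := rfl
  have hbr := he.br ω
  have main {a b c d : WithOne (OpWord Z)} {t : WithOne (OpWord Z)}
      (hc : c = a * t) (h : (m₁ : WithOne (OpWord Z)) * b = t * (br ω (e m₂) * d)) :
      Placement (OpWord.sand a b) m₁ (fun u => OpWord.sand c d (.br ω (e u))) m₂ := by
    subst hc
    obtain ⟨s, ⟨h1, h2⟩ | ⟨h1, rfl⟩⟩ := levi h
    · obtain ⟨r, ⟨h3, rfl⟩ | ⟨h3, rfl⟩⟩ := levi h2
      · obtain ⟨rfl, rfl⟩ | ⟨rfl, rfl⟩ := atom_eq_mul hat h3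
        · rw [mul_one] at h1
          exact .disjoint_sand .id hbr a 1 d (fun u => by simp [coe_sand, mul_assoc])
            fun u => by simp [coe_sand, h1]
        · exact .nested (hbr.sand t 1) (WithOne.coe_inj.1 (by simp [coe_sand, h1]))
            fun u => WithOne.coe_inj.1 (by simp [coe_sand, mul_assoc])
      · exact .nested (hbr.sand t r) (WithOne.coe_inj.1 (by simp [coe_sand, h1, h3, mul_assoc]))
          fun u => WithOne.coe_inj.1 (by simp [coe_sand, mul_assoc])
    · exact .disjoint_sand .id hbr a s d (fun u => by simp [coe_sand, mul_assoc])
        fun u => by simp [coe_sand, mul_assoc, h1]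
  rw [← WithOne.coe_inj, coe_sand, coe_sand, mul_assoc, mul_assoc] at h
  obtain ⟨t, ⟨rfl, h2⟩ | ⟨h1, h2⟩⟩ := levi h
  · obtain ⟨s, ⟨h3, h4⟩ | ⟨h3, rfl⟩⟩ := levi h2
    · obtain ⟨rfl, rfl⟩ | ⟨rfl, rfl⟩ := atom_eq_mul hat h3
      · exact main (t := 1) (by simp) (by simpa using h4)
      · rw [one_mul] at h4
        exact .symm (.disjoint_sand hbr .id c 1 b
          (fun u => by simp [coe_sand, mul_assoc, h4]) fun u => by simp [coe_sand])
    · exact .symm (.disjoint_sand hbr .id c s b (fun u => by simp [coe_sand, mul_assoc])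
        fun u => by simp [coe_sand, mul_assoc, h3])
  · exact main h1 h2

/-- The two outer brackets are either the same atom, and the question moves to their contents, or
different atoms, and the subwords are disjoint. -/
theorem Placement.nest_nest {a b c d : WithOne (OpWord Z)} {m₁ m₂ : OpWord Z} {ω ω' : Op}
    {e f : OpWord Z → OpWord Z} (he : IsContext e) (hf : IsContext f)
    (ih : e m₁ = f m₂ → Placement e m₁ f m₂)
    (h : sand a b (br ω (e m₁)) = sand c d (br ω' (f m₂))) :
    Placement (fun u => sand a b (br ω (e u))) m₁ (fun u => sand c d (br ω' (f u))) m₂ := by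
  have main {a b c d : WithOne (OpWord Z)} {t : WithOne (OpWord Z)} {ω ω' : Op}
      {e f : OpWord Z → OpWord Z} (he : IsContext e) (hf : IsContext f) {m₁ m₂ : OpWord Z}
      (ih : e m₁ = f m₂ → Placement e m₁ f m₂) (hc : c = a * t)
      (h : (br ω (e m₁) : WithOne (OpWord Z)) * b = t * (br ω' (f m₂) * d)) :
      Placement (fun u => OpWord.sand a b (.br ω (e u))) m₁
        (fun u => OpWord.sand c d (.br ω' (f u))) m₂ := by
    subst hc
    obtain ⟨s, ⟨h1, h2⟩ | ⟨h1, rfl⟩⟩ := levi h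
    · obtain ⟨rfl, rfl⟩ | ⟨rfl, rfl⟩ := atom_eq_mul rfl h1
      · obtain ⟨h3, rfl⟩ := atom_mul_cancel rfl rfl h2
        simp only [br.injEq] at h3
        obtain ⟨rfl, h3⟩ := h3
        rw [mul_one]
        exact (ih h3.symm).comp (d := fun u => OpWord.sand a d (.br ω' u))
          ((IsContext.id.br ω').sand a d)
      · exact .disjoint_sand (he.br ω) (hf.br ω') a 1 d
          (fun u => by simp [coe_sand, mul_assoc, h2]) fun u => by simp [coe_sand]
    · exact .disjoint_sand (he.br ω) (hf.br ω') a s d (fun u => by simp [coe_sand, mul_assoc])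
        fun u => by simp [coe_sand, mul_assoc, h1]
  rw [← WithOne.coe_inj, coe_sand, coe_sand, mul_assoc, mul_assoc] at h
  obtain ⟨t, ⟨h1, h2⟩ | ⟨h1, h2⟩⟩ := levi h
  · exact .symm (main hf he (fun h => (ih h.symm).symm) h1 h2)
  · exact main he hf ih h1 h2

theorem placement {c₁ c₂ : OpWord Z → OpWord Z} (h₁ : IsContext c₁) (h₂ : IsContext c₂)
    {m₁ m₂ : OpWord Z} (h : c₁ m₁ = c₂ m₂) : Placement c₁ m₁ c₂ m₂ := by
  induction h₁ generalizing c₂ with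
  | hole a b =>
    cases h₂ with
    | hole c d => exact .sand_sand h
    | nest c d ω he => exact .sand_nest he h
  | nest a b ω he ih =>
    cases h₂ with
    | hole c d => exact .symm (.sand_nest he h.symm)
    | nest c d ω hf => exact .nest_nest he hf (ih hf) h

end OpWord

end DRB

noncomputable section

namespace DRB

/-! ### Gröbner–Shirshov theory over abstract monomials and contexts -/

section Generic

variable {k : Type v} [Field k] {M : Type u} {lt : M → M → Prop} {C : Set (M → M)}
  {G : Set (MonoidAlgebra k M)}

/-! ### Linear extension -/

/-- The linear extension to `k[M]` of a map defined on the monomials. -/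
def linExt {V : Type w} [AddCommGroup V] [Module k V] (φ : M → V) : MonoidAlgebra k M →ₗ[k] V where
  toFun f := f.coeff.sum fun m c => c • φ m
  map_add' f g := Finsupp.sum_add_index' (by simp) (by simp [add_smul])
  map_smul' c f := by
    simp [Finsupp.sum_smul_index', Finsupp.smul_sum, smul_smul]

section LinExt

variable {V : Type w} [AddCommGroup V] [Module k V]

theorem linExt_apply (φ : M → V) (f : MonoidAlgebra k M) :
    linExt φ f = f.coeff.sum fun m c => c • φ m := rfl

theorem linExt_single (φ : M → V) (m : M) (c : k) :
    linExt φ (MonoidAlgebra.single m c) = c • φ m := by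
  simp [linExt_apply]

theorem linExt_eq {φ : M → V} {L : MonoidAlgebra k M →ₗ[k] V}
    (h : ∀ m, L (MonoidAlgebra.single m 1) = φ m) (f : MonoidAlgebra k M) : linExt φ f = L f := by
  induction f using MonoidAlgebra.induction_linear with
  | zero => simp
  | add f g hf hg => simp [hf, hg]
  | single m c =>
    rw [linExt_single, ← h, ← map_smul, MonoidAlgebra.smul_single, smul_eq_mul, mul_one]

theorem linExt_mem {φ : M → V} {N : Submodule k V} {f : MonoidAlgebra k M}
    (h : ∀ m, f.coeff m ≠ 0 → φ m ∈ N) : linExt φ f ∈ N :=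
  N.sum_mem fun m hm => N.smul_mem _ (h m (Finsupp.mem_support_iff.1 hm))

/-- Two linear maps on `k[M]` that agree on monomials are equal. -/
theorem linearMap_ext {L L' : MonoidAlgebra k M →ₗ[k] V}
    (h : ∀ m, L (MonoidAlgebra.single m 1) = L' (MonoidAlgebra.single m 1)) : L = L' :=
  LinearMap.ext fun f => by rw [← linExt_eq h f, ← linExt_eq (L := L') fun _ => rfl]

end LinExt

/-- The linear extension of a map of monomials. -/
def mapLin (k : Type v) [Field k] {M : Type u} {N : Type w} (c : M → N) :
    MonoidAlgebra k M →ₗ[k] MonoidAlgebra k N where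
  toFun := MonoidAlgebra.mapDomain c
  map_add' := MonoidAlgebra.mapDomain_add _
  map_smul' _ _ := MonoidAlgebra.mapDomain_smul ..

theorem mapLin_apply {N : Type w} (c : M → N) (f : MonoidAlgebra k M) :
    mapLin k c f = MonoidAlgebra.mapDomain c f := rfl

theorem mapLin_single {N : Type w} (c : M → N) (m : M) (a : k) :
    mapLin k c (MonoidAlgebra.single m a) = MonoidAlgebra.single (c m) a :=
  MonoidAlgebra.mapDomain_single

theorem mapLin_mapLin (c d : M → M) (f : MonoidAlgebra k M) :
    mapLin k d (mapLin k c f) = mapLin k (fun u => d (c u)) f :=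
  congrArg (· f) (linearMap_ext (L := mapLin k d ∘ₗ mapLin k c) fun m => by
    simp [mapLin_single])

theorem mapLin_mul_right [Semigroup M] (a : M) (f : MonoidAlgebra k M) :
    mapLin k (· * a) f = f * MonoidAlgebra.single a 1 := by
  induction f using MonoidAlgebra.induction_linear with
  | zero => simp
  | add f g hf hg => simp [hf, hg, add_mul]
  | single m c => simp [mapLin_single]

theorem mapLin_mul_left [Semigroup M] (a : M) (f : MonoidAlgebra k M) :
    mapLin k (a * ·) f = MonoidAlgebra.single a 1 * f := by
  induction f using MonoidAlgebra.induction_linear with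
  | zero => simp
  | add f g hf hg => simp [hf, hg, mul_add]
  | single m c => simp [mapLin_single]

/-! ### Leading monomials -/

theorem IsLeading.ne_zero {f : MonoidAlgebra k M} {m : M} (h : IsLeading lt f m) : f ≠ 0 := by
  rintro rfl
  exact h.1 rfl

theorem IsLeading.unique [IsWellOrder M lt] {f : MonoidAlgebra k M} {m m' : M}
    (h : IsLeading lt f m) (h' : IsLeading lt f m') : m = m' := by
  by_contra hne
  exact asymm_of lt (h.2 m' h'.1 (Ne.symm hne)) (h'.2 m h.1 hne)

theorem exists_isLeading [IsWellOrder M lt] {f : MonoidAlgebra k M} (hf : f ≠ 0) :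
    ∃ m, IsLeading lt f m := by
  classical
  let _ := linearOrderOfSTO lt
  have hne : f.coeff.support.Nonempty := by simpa [Finsupp.support_nonempty_iff] using hf
  refine ⟨f.coeff.support.max' hne,
    Finsupp.mem_support_iff.1 (Finset.max'_mem _ _), fun m hm hne => ?_⟩
  exact lt_of_le_of_ne (Finset.le_max' _ _ (Finsupp.mem_support_iff.2 hm)) hne

theorem injective_of_strictMono [IsWellOrder M lt] {N : Type w} {lt' : N → N → Prop}
    [Std.Irrefl lt'] {c : M → N} (hc : ∀ a b, lt a b → lt' (c a) (c b)) : Function.Injective c := by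
  intro a b hab
  rcases trichotomous_of lt a b with h | h | h
  · exact (irrefl_of lt' _ (hab ▸ hc _ _ h)).elim
  · exact h
  · exact (irrefl_of lt' _ (hab ▸ hc _ _ h)).elim

theorem IsLeading.mapDomain [IsWellOrder M lt] {N : Type w} {lt' : N → N → Prop}
    [Std.Irrefl lt'] {c : M → N} (hc : ∀ a b, lt a b → lt' (c a) (c b))
    {f : MonoidAlgebra k M} {m : M} (h : IsLeading lt f m) :
    IsLeading lt' (MonoidAlgebra.mapDomain c f) (c m) := by
  have hinj := injective_of_strictMono hc
  constructor
  · rw [MonoidAlgebra.coeff_mapDomain, Finsupp.mapDomain_apply hinj]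
    exact h.1
  · intro m' hm' hne
    by_cases hr : m' ∈ Set.range c
    · obtain ⟨x, rfl⟩ := hr
      rw [MonoidAlgebra.coeff_mapDomain, Finsupp.mapDomain_apply hinj] at hm'
      exact hc _ _ (h.2 x hm' fun e => hne (e ▸ rfl))
    · rw [MonoidAlgebra.coeff_mapDomain, Finsupp.mapDomain_of_notMem_range _ _ hr] at hm'
      exact (hm' rfl).elim

/-- The monicization of `f` whose leading monomial is `m`. -/
abbrev monic (f : MonoidAlgebra k M) (m : M) : MonoidAlgebra k M := (f.coeff m)⁻¹ • f

/-- The difference is the right-hand side of the rewriting rule of `f`: the top terms cancel,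
leaving smaller monomials only. -/
theorem lt_of_coeff_sub_monic_ne_zero {f : MonoidAlgebra k M} {m : M} (h : IsLeading lt f m) {x : M}
    (hx : (MonoidAlgebra.single m 1 - monic f m).coeff x ≠ 0) : lt x m := by
  classical
  have hx' : (Finsupp.single m (1 : k) - (f.coeff m)⁻¹ • f.coeff : M →₀ k) x ≠ 0 := hx
  simp only [Finsupp.coe_sub, Finsupp.coe_smul, Pi.sub_apply, Pi.smul_apply, smul_eq_mul,
    Finsupp.single_apply] at hx'
  by_cases e : m = x
  · subst e
    simp [inv_mul_cancel₀ h.1] at hx'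
  · refine h.2 x (fun h0 => hx' ?_) (Ne.symm e)
    simp [e, h0]

/-! ### Trivial elements -/

/-- The space of the elements that are trivial modulo `(G, p)`. -/
def trivialMod (lt : M → M → Prop) (C : Set (M → M)) (G : Set (MonoidAlgebra k M)) (p : M) :
    Submodule k (MonoidAlgebra k M) :=
  Submodule.span k {x | ∃ c ∈ C, ∃ s ∈ G, ∃ m, IsLeading lt s m ∧ lt (c m) p ∧
    x = MonoidAlgebra.mapDomain c s}

theorem mapLin_mem_trivialMod {c : M → M} (hc : c ∈ C) {s : MonoidAlgebra k M} (hs : s ∈ G)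
    {m p : M} (hm : IsLeading lt s m) (hp : lt (c m) p) : mapLin k c s ∈ trivialMod lt C G p :=
  Submodule.subset_span ⟨c, hc, s, hs, m, hm, hp, rfl⟩

theorem mapLin_monic_mem_trivialMod {c : M → M} (hc : c ∈ C) {s : MonoidAlgebra k M} (hs : s ∈ G)
    {m p : M} (hm : IsLeading lt s m) (hp : lt (c m) p) :
    mapLin k c (monic s m) ∈ trivialMod lt C G p := by
  rw [map_smul]
  exact Submodule.smul_mem _ _ (mapLin_mem_trivialMod hc hs hm hp)

theorem trivialMod_mono [IsTrans M lt] {p p' : M} (h : lt p p') :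
    trivialMod lt C G p ≤ trivialMod lt C G p' := by
  refine Submodule.span_mono ?_
  rintro x ⟨c, hc, s, hs, m, hm, hp, rfl⟩
  exact ⟨c, hc, s, hs, m, hm, trans_of lt hp h, rfl⟩

theorem map_mem_trivialMod {N : Type w} {lt' : N → N → Prop} {C' : Set (N → N)}
    {G' : Set (MonoidAlgebra k N)} {p : M} {p' : N}
    (L : MonoidAlgebra k M →ₗ[k] MonoidAlgebra k N)
    (hL : ∀ c ∈ C, ∀ s ∈ G, ∀ m, IsLeading lt s m → lt (c m) p →
      L (mapLin k c s) ∈ trivialMod lt' C' G' p') {h : MonoidAlgebra k M}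
    (hh : h ∈ trivialMod lt C G p) : L h ∈ trivialMod lt' C' G' p' := by
  have : trivialMod lt C G p ≤ (trivialMod lt' C' G' p').comap L := by
    refine Submodule.span_le.2 ?_
    rintro x ⟨c, hc, s, hs, m, hm, hp, rfl⟩
    exact hL c hc s hs m hm hp
  exact this hh

theorem mapLin_mem_trivialMod_of_mem (hM : IsMonomialOrder lt C)
    (hC : ∀ d ∈ C, ∀ c ∈ C, (fun u => d (c u)) ∈ C) {d : M → M} (hd : d ∈ C) {p : M}
    {h : MonoidAlgebra k M} (hh : h ∈ trivialMod lt C G p) :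
    mapLin k d h ∈ trivialMod lt C G (d p) := by
  refine map_mem_trivialMod _ (fun c hc s hs m hm hp => ?_) hh
  rw [mapLin_mapLin]
  exact mapLin_mem_trivialMod (hC d hd c hc) hs hm (hM.2 d hd _ _ hp)

/-- Every monomial of a generator is at most its leading monomial, hence below `p`. Thus trivial
corrections never touch the coefficient at `p`. -/
theorem coeff_eq_zero_of_mem_trivialMod (hM : IsMonomialOrder lt C) {p : M}
    {h : MonoidAlgebra k M} (hh : h ∈ trivialMod lt C G p) : h.coeff p = 0 := by
  have := hM.1
  have key : trivialMod lt C G p ≤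
      LinearMap.ker (linExt (k := k) fun m => Finsupp.single m (1 : k) p) := by
    refine Submodule.span_le.2 ?_
    rintro x ⟨c, hc, s, hs, m, hm, hp, rfl⟩
    have hl := hm.mapDomain (hM.2 c hc)
    have hx (y : M) (hy : (MonoidAlgebra.mapDomain c s).coeff y ≠ 0) : y ≠ p := by
      rintro rfl
      by_cases e : y = c m
      · exact irrefl_of lt _ (e ▸ hp)
      · exact asymm_of lt hp (hl.2 _ hy e)
    change linExt _ _ = 0
    rw [← Submodule.mem_bot k]
    exact linExt_mem fun y hy => by simp [Finsupp.single_eq_of_ne' (hx y hy)]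
  let L : MonoidAlgebra k M →ₗ[k] k :=
    { toFun := fun f => f.coeff p, map_add' := fun _ _ => rfl, map_smul' := fun _ _ => rfl }
  exact (linExt_eq (L := L) (fun m => rfl) h).symm.trans (key hh)

/-- Two disjoint subwords give trivial elements. -/
theorem disjoint_mem_trivialMod (hM : IsMonomialOrder lt C) {T : M → M → M}
    (hl : ∀ y, (fun x => T x y) ∈ C) (hr : ∀ x, (fun y => T x y) ∈ C)
    {s₁ s₂ : MonoidAlgebra k M} (hs₁ : s₁ ∈ G) (hs₂ : s₂ ∈ G) {m₁ m₂ : M}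
    (h₁ : IsLeading lt s₁ m₁) (h₂ : IsLeading lt s₂ m₂) :
    mapLin k (fun x => T x m₂) (monic s₁ m₁) - mapLin k (fun y => T m₁ y) (monic s₂ m₂) ∈
      trivialMod lt C G (T m₁ m₂) := by
  -- Both sides are the full substitution `T(s₁, s₂)` of the monic elements, expanded in either
  -- order. Below, `T(s₁, m₂)` and `T(m₁, s₂)` are each shown to agree with it up to trivial
  -- elements.
  have e : linExt (fun y => mapLin k (fun x => T x y) (monic s₁ m₁)) (monic s₂ m₂) =
      linExt (fun x => mapLin k (fun y => T x y) (monic s₂ m₂)) (monic s₁ m₁) := by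
    generalize monic s₁ m₁ = f
    generalize monic s₂ m₂ = g
    induction f using MonoidAlgebra.induction_linear with
    | zero => simp [linExt_apply]
    | add f f' hf hf' =>
      rw [map_add, ← hf, ← hf', ← LinearMap.add_apply]
      congr 1
      exact linearMap_ext fun m => by simp [linExt_single]
    | single m c =>
      rw [linExt_single]
      refine linExt_eq (L := c • mapLin k (fun y => T m y)) (fun y => ?_) g
      simp [mapLin_single]
  have e₁ := linExt_mem (N := trivialMod lt C G (T m₁ m₂))
    (φ := fun y => mapLin k (fun x => T x y) (monic s₁ m₁)) fun y hy =>
      mapLin_monic_mem_trivialMod (hl y) hs₁ h₁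
        (hM.2 _ (hr m₁) _ _ (lt_of_coeff_sub_monic_ne_zero h₂ hy))
  have e₂ := linExt_mem (N := trivialMod lt C G (T m₁ m₂))
    (φ := fun x => mapLin k (fun y => T x y) (monic s₂ m₂)) fun x hx =>
      mapLin_monic_mem_trivialMod (hr x) hs₂ h₂
        (hM.2 _ (hl m₂) _ _ (lt_of_coeff_sub_monic_ne_zero h₁ hx))
  rw [map_sub, linExt_single, one_smul] at e₁ e₂
  rw [e] at e₁
  simpa using sub_mem e₁ e₂

/-! ### The composition-diamond lemma -/

/-- All ambiguities of `G` are resolvable. -/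
def LocallyConfluent (lt : M → M → Prop) (C : Set (M → M)) (G : Set (MonoidAlgebra k M)) : Prop :=
  ∀ c₁ ∈ C, ∀ c₂ ∈ C, ∀ s₁ ∈ G, ∀ s₂ ∈ G, ∀ m₁ m₂, IsLeading lt s₁ m₁ → IsLeading lt s₂ m₂ →
    c₁ m₁ = c₂ m₂ → mapLin k c₁ (monic s₁ m₁) - mapLin k c₂ (monic s₂ m₂) ∈
      trivialMod lt C G (c₁ m₁)

/-- The span of the elements `q|_s` with `s ∈ G`. -/
def contextSpan (C : Set (M → M)) (G : Set (MonoidAlgebra k M)) :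
    Submodule k (MonoidAlgebra k M) :=
  Submodule.span k {x | ∃ c ∈ C, ∃ s ∈ G, x = mapLin k c s}

/-- In a finite combination of elements `q|_s`, let `w` be the largest word `q|_{s̄}`; everything
else is trivial at `w`. The predicate `R` records a constraint on `w`: none at the start, being
smaller than the previous level during the descent. -/
theorem exists_level (hM : IsMonomialOrder lt C) {R : M → Prop} {f : MonoidAlgebra k M}
    (hf : f ∈ Submodule.span k {x | ∃ c ∈ C, ∃ s ∈ G, ∃ m, IsLeading lt s m ∧ R (c m) ∧
      x = MonoidAlgebra.mapDomain c s}) :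
    f = 0 ∨ ∃ w, R w ∧ f ∈ Submodule.span k {x | ∃ c ∈ C, ∃ s ∈ G, ∃ m, IsLeading lt s m ∧
      c m = w ∧ x = MonoidAlgebra.mapDomain c s} ⊔ trivialMod lt C G w := by
  have := hM.1
  have hmono {w w' : M} (h : lt w w') : Submodule.span k {x | ∃ c ∈ C, ∃ s ∈ G, ∃ m,
      IsLeading lt s m ∧ c m = w ∧ x = MonoidAlgebra.mapDomain c s} ⊔ trivialMod lt C G w ≤
      trivialMod lt C G w' := by
    refine sup_le (Submodule.span_le.2 ?_) (trivialMod_mono h)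
    rintro x ⟨c, hc, s, hs, m, hm, rfl, rfl⟩
    exact mapLin_mem_trivialMod hc hs hm h
  induction hf using Submodule.span_induction with
  | mem x hx =>
    obtain ⟨c, hc, s, hs, m, hm, hR, rfl⟩ := hx
    exact .inr ⟨c m, hR, Submodule.mem_sup_left
      (Submodule.subset_span ⟨c, hc, s, hs, m, hm, rfl, rfl⟩)⟩
  | zero => exact .inl rfl
  | smul a x _ ih =>
    rcases ih with rfl | ⟨w, hw, h⟩
    · simp
    · exact .inr ⟨w, hw, Submodule.smul_mem _ _ h⟩
  | add x y _ _ ihx ihy =>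
    rcases ihx with rfl | ⟨w, hw, h⟩
    · simpa using ihy
    rcases ihy with rfl | ⟨w', hw', h'⟩
    · exact .inr ⟨w, hw, by simpa using h⟩
    rcases trichotomous_of lt w w' with e | rfl | e
    · exact .inr ⟨w', hw', add_mem (Submodule.mem_sup_right (hmono e h)) h'⟩
    · exact .inr ⟨w, hw, add_mem h h'⟩
    · exact .inr ⟨w, hw, add_mem h (Submodule.mem_sup_right (hmono e h'))⟩

/-- Confluence makes all monic terms with the same top word congruent modulo lower ones, so the
entire top level collapses to a multiple of one chosen term. -/
theorem exists_sub_smul_mem_trivialMod (hG : LocallyConfluent lt C G) {c₀ : M → M} (hc₀ : c₀ ∈ C)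
    {s₀ : MonoidAlgebra k M} (hs₀ : s₀ ∈ G) {m₀ : M} (hm₀ : IsLeading lt s₀ m₀)
    {b : MonoidAlgebra k M} (hb : b ∈ Submodule.span k {x | ∃ c ∈ C, ∃ s ∈ G, ∃ m,
      IsLeading lt s m ∧ c m = c₀ m₀ ∧ x = MonoidAlgebra.mapDomain c s}) :
    ∃ α : k, b - α • mapLin k c₀ (monic s₀ m₀) ∈ trivialMod lt C G (c₀ m₀) := by
  induction hb using Submodule.span_induction with
  | mem x hx =>
    obtain ⟨c, hc, s, hs, m, hm, he, rfl⟩ := hx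
    refine ⟨s.coeff m, ?_⟩
    have h1 : mapLin k c s = s.coeff m • mapLin k c (monic s m) := by
      rw [map_smul, smul_smul, mul_inv_cancel₀ hm.1, one_smul]
    rw [← mapLin_apply, h1, ← smul_sub, ← he]
    exact Submodule.smul_mem _ _ (hG c hc c₀ hc₀ s hs s₀ hs₀ m m₀ hm hm₀ he)
  | zero => exact ⟨0, by simp⟩
  | smul a x _ ih =>
    obtain ⟨α, h⟩ := ih
    exact ⟨a * α, by rw [mul_smul, ← smul_sub]; exact Submodule.smul_mem _ _ h⟩
  | add x y _ _ ihx ihy =>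
    obtain ⟨α, h⟩ := ihx
    obtain ⟨β, h'⟩ := ihy
    exact ⟨α + β, by rw [add_smul, add_sub_add_comm]; exact add_mem h h'⟩

/-- Well-founded descent on the top word: after the collapse to one term with scalar `α`, either `α
≠ 0` is the coefficient of the reducible word `w`, or the top level cancels and the level drops. -/
theorem exists_reducible_of_level (hM : IsMonomialOrder lt C) (hG : LocallyConfluent lt C G) (w : M)
    {f : MonoidAlgebra k M} (hf0 : f ≠ 0)
    (hf : f ∈ Submodule.span k {x | ∃ c ∈ C, ∃ s ∈ G, ∃ m, IsLeading lt s m ∧ c m = w ∧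
      x = MonoidAlgebra.mapDomain c s} ⊔ trivialMod lt C G w) :
    ∃ x ∉ Irr lt C G, f.coeff x ≠ 0 := by
  have := hM.1
  induction w using (IsWellFounded.wf : WellFounded lt).induction generalizing f with
  | _ w ih =>
  have below {f : MonoidAlgebra k M} (hf0 : f ≠ 0) (hf : f ∈ trivialMod lt C G w) :
      ∃ x ∉ Irr lt C G, f.coeff x ≠ 0 := by
    rcases exists_level (G := G) (R := fun x => lt x w) hM hf with h | ⟨w', hw', h⟩
    · exact (hf0 h).elim
    · exact ih w' hw' hf0 h
  obtain ⟨b, hb, t, ht, rfl⟩ := Submodule.mem_sup.1 hf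
  by_cases hw : ∃ c ∈ C, ∃ s ∈ G, ∃ m, IsLeading lt s m ∧ c m = w
  · obtain ⟨c₀, hc₀, s₀, hs₀, m₀, hm₀, rfl⟩ := hw
    obtain ⟨α, hα⟩ := exists_sub_smul_mem_trivialMod hG hc₀ hs₀ hm₀ hb
    by_cases hα0 : α = 0
    · rw [hα0, zero_smul, sub_zero] at hα
      exact below hf0 (add_mem hα ht)
    · refine ⟨c₀ m₀, fun h => h ⟨c₀, hc₀, s₀, hs₀, m₀, hm₀, rfl⟩, ?_⟩
      have h1 := coeff_eq_zero_of_mem_trivialMod hM (add_mem hα ht)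
      have h2 : (mapLin k c₀ (monic s₀ m₀)).coeff (c₀ m₀) = 1 := by
        rw [mapLin_apply, MonoidAlgebra.coeff_mapDomain,
          Finsupp.mapDomain_apply (injective_of_strictMono (lt' := lt) (hM.2 c₀ hc₀))]
        exact inv_mul_cancel₀ hm₀.1
      have h3 : b + t = (b - α • mapLin k c₀ (monic s₀ m₀) + t) +
          α • mapLin k c₀ (monic s₀ m₀) := by abel
      rw [h3, MonoidAlgebra.coeff_add, Finsupp.add_apply, h1, zero_add,
        MonoidAlgebra.coeff_smul_apply, h2, smul_eq_mul, mul_one]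
      exact hα0
  -- No element `q|_s` has top word `w`, so the span at level `w` is zero.
  · have hb0 : b = 0 := by
      refine (Submodule.mem_bot k).1 (Submodule.span_le.2 ?_ hb)
      rintro x ⟨c, hc, s, hs, m, hm, he, rfl⟩
      exact (hw ⟨c, hc, s, hs, m, hm, he⟩).elim
    rw [hb0, zero_add] at hf0 ⊢
    exact below hf0 ht

/-- The composition-diamond lemma: a nonzero element of the ideal has a reducible monomial. -/
theorem exists_reducible (hM : IsMonomialOrder lt C) (hG : LocallyConfluent lt C G)
    {f : MonoidAlgebra k M} (hf0 : f ≠ 0) (hf : f ∈ contextSpan C G) :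
    ∃ x ∉ Irr lt C G, f.coeff x ≠ 0 := by
  have := hM.1
  have hle : contextSpan C G ≤ Submodule.span k {x | ∃ c ∈ C, ∃ s ∈ G, ∃ m, IsLeading lt s m ∧
      True ∧ x = MonoidAlgebra.mapDomain c s} := by
    refine Submodule.span_le.2 ?_
    rintro x ⟨c, hc, s, hs, rfl⟩
    by_cases h0 : s = 0
    · simp [h0]
    · obtain ⟨m, hm⟩ := exists_isLeading (lt := lt) h0
      exact Submodule.subset_span ⟨c, hc, s, hs, m, hm, trivial, rfl⟩
  rcases exists_level hM (R := fun _ => True) (hle hf) with h | ⟨w, -, h⟩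
  · exact (hf0 h).elim
  · exact exists_reducible_of_level hM hG w hf0 h

/-- Reduction terminates: a reducible word is, modulo the ideal, a combination of smaller words.
Confluence is not needed for spanning. -/
theorem single_mem_sup_span_irr (hM : IsMonomialOrder lt C) (w : M) :
    MonoidAlgebra.single w 1 ∈ contextSpan C G ⊔
      Submodule.span k ((fun x => MonoidAlgebra.single x 1) '' Irr lt C G) := by
  have := hM.1
  induction w using (IsWellFounded.wf : WellFounded lt).induction with
  | _ w ih =>
  by_cases hw : w ∈ Irr lt C G
  · exact Submodule.mem_sup_right (Submodule.subset_span ⟨w, hw, rfl⟩)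
  · rw [Irr, Set.notMem_compl_iff] at hw
    obtain ⟨c, hc, s, hs, m, hm, rfl⟩ := hw
    have h1 : linExt (fun x => MonoidAlgebra.single (c x) (1 : k))
        (MonoidAlgebra.single m 1 - monic s m) ∈ contextSpan C G ⊔
        Submodule.span k ((fun x => MonoidAlgebra.single x 1) '' Irr lt C G) :=
      linExt_mem fun x hx => ih _ (hM.2 c hc _ _ (lt_of_coeff_sub_monic_ne_zero hm hx))
    rw [linExt_eq (L := mapLin k c) fun x => mapLin_single .., map_sub, mapLin_single,
      map_smul] at h1
    have h2 : (s.coeff m)⁻¹ • mapLin k c s ∈ contextSpan C G :=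
      Submodule.smul_mem _ _ (Submodule.subset_span ⟨c, hc, s, hs, rfl⟩)
    simpa using add_mem h1 (Submodule.mem_sup_left h2)

/-- The irreducible monomials form a basis of the quotient by the ideal generated by `G`. -/
theorem exists_basis_irr (hM : IsMonomialOrder lt C) (hG : LocallyConfluent lt C G)
    {Q : Type w} [AddCommGroup Q] [Module k Q] (q : MonoidAlgebra k M →ₗ[k] Q)
    (hq : Function.Surjective q) (hker : ∀ f, q f = 0 ↔ f ∈ contextSpan C G) :
    ∃ b : Module.Basis (Irr lt C G) k Q, ∀ x, b x = q (MonoidAlgebra.single x.1 1) := by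
  have hli : LinearIndependent k fun x : Irr lt C G => q (MonoidAlgebra.single x.1 1) := by
    rw [linearIndependent_iff]
    intro l hl
    by_contra hne
    let f : MonoidAlgebra k M := .ofCoeff (l.mapDomain Subtype.val)
    have hf0 : f ≠ 0 := fun h => hne (Finsupp.mapDomain_injective Subtype.val_injective
      (by rw [Finsupp.mapDomain_zero]; exact congrArg MonoidAlgebra.coeff h))
    have hqf : q f = 0 := by
      rw [← hl, ← linExt_eq (L := q) (fun _ => rfl), linExt_apply, Finsupp.linearCombination_apply]
      exact Finsupp.sum_mapDomain_index (by simp) (by simp [add_smul])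
    obtain ⟨x, hx, hfx⟩ := exists_reducible hM hG hf0 ((hker f).1 hqf)
    exact hfx (Finsupp.mapDomain_of_notMem_range _ _ (by simpa using hx))
  refine ⟨Module.Basis.mk hli ?_, fun x => Module.Basis.mk_apply ..⟩
  rintro y -
  obtain ⟨f, rfl⟩ := hq y
  have hN : contextSpan C G ⊔ Submodule.span k ((fun x => MonoidAlgebra.single x 1) '' Irr lt C G) ≤
      (Submodule.span k (Set.range fun x : Irr lt C G => q (MonoidAlgebra.single x.1 1))).comap
        q := by
    refine sup_le (fun g hg => ?_) (Submodule.span_le.2 ?_)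
    · rw [Submodule.mem_comap, (hker g).2 hg]
      exact zero_mem _
    · rintro _ ⟨x, hx, rfl⟩
      exact Submodule.subset_span ⟨⟨x, hx⟩, rfl⟩
  refine hN ?_
  have := linExt_mem (f := f) fun m _ => single_mem_sup_span_irr (G := G) hM m
  rwa [linExt_eq (L := LinearMap.id) (φ := fun m => MonoidAlgebra.single m 1) fun _ => rfl] at this

end Generic

/-! ### Ambiguities of bracketed words -/

namespace OpWord

/-- Nested and overlapping occurrences are compositions carried into a surrounding context, which
preserves triviality; disjoint ones are trivial without any hypothesis on compositions. -/
theorem locallyConfluent_of_isGS {k : Type v} [Field k] {Z : Type u} [LinearOrder Z]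
    [WellFoundedLT Z] {G : Set (FreeOmega k Z)}
    (hG : IsGS PDLT (contexts Z) breadth G) : LocallyConfluent PDLT (contexts Z) G := by
  have hM := isMonomialOrder_pdLT (Z := Z)
  have hC : ∀ d ∈ contexts Z, ∀ c ∈ contexts Z, (fun u => d (c u)) ∈ contexts Z :=
    fun d hd c hc => mem_contexts.2 ((mem_contexts.1 hd).comp (mem_contexts.1 hc))
  intro c₁ hc₁ c₂ hc₂ s₁ hs₁ s₂ hs₂ m₁ m₂ h₁ h₂ h
  have hp := placement (mem_contexts.1 hc₁) (mem_contexts.1 hc₂) h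
  induction hp generalizing s₁ s₂ with
  | @nested c₁ c₂ c m₁ m₂ hc hm hcc =>
    obtain rfl : c₂ = fun u => c₁ (c u) := funext hcc
    have := mapLin_mem_trivialMod_of_mem hM hC hc₁
      ((hG s₁ hs₁ s₂ hs₂ m₁ m₂ h₁ h₂).2 c (mem_contexts.2 hc) hm)
    rwa [map_sub, ← mapLin_apply, mapLin_mapLin] at this
  | @overlap c₁ c₂ d t r s hd e₁ e₂ =>
    obtain rfl : c₁ = fun u => d (u * s) := funext e₁
    obtain rfl : c₂ = fun u => d (t * u) := funext e₂
    have := breadth_pos t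
    have := breadth_pos r
    have := breadth_pos s
    have := mapLin_mem_trivialMod_of_mem hM hC (mem_contexts.2 hd)
      ((hG s₁ hs₁ s₂ hs₂ _ _ h₁ h₂).1 (t * r * s) s t rfl (mul_assoc t r s)
        (by simp only [breadth_mul]; omega) (by simp only [breadth_mul]; omega))
    rwa [← mapLin_mul_right, ← mapLin_mul_left, map_sub, mapLin_mapLin, mapLin_mapLin] at this
  | @disjoint c₁ c₂ T m₁ m₂ hl hr e₁ e₂ =>
    obtain rfl : c₁ = fun u => T u m₂ := funext e₁
    obtain rfl : c₂ = fun u => T m₁ u := funext e₂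
    exact disjoint_mem_trivialMod hM (fun y => mem_contexts.2 (hl y))
      (fun x => mem_contexts.2 (hr x)) hs₁ hs₂ h₁ h₂
  | symm _ ih =>
    rw [h, ← neg_mem_iff, neg_sub]
    exact ih hc₂ hc₁ s₂ hs₂ s₁ hs₁ h₂ h₁ h.symm

end OpWord

end DRB

end

noncomputable section

namespace DRB

/-! ### Values of the identities -/

section Values

variable {k : Type v} [Field k]

theorem op_mono {Z : Type u} (ω : Op) (w : OpWord Z) :
    OmegaAlgebra.op (k := k) ω (mono k w) = mono k (.br ω w) :=
  MonoidAlgebra.mapDomain_single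

theorem mono_mul {Z : Type u} (a b : OpWord Z) : mono k a * mono k b = mono k (a * b) := by
  simp

theorem op_apply {Z : Type u} (ω : Op) (f : FreeOmega k Z) :
    OmegaAlgebra.op (k := k) ω f = mapLin k (.br ω) f := rfl

section Eval

variable {X : Type u} {R : Type w} [NonUnitalRing R] [Module k R] [OmegaAlgebra k R]

theorem evalOPI_eq (r : X → R) (φ : FreeOmega k X) :
    evalOPI r φ = linExt (OpWord.lift (fun ω a => OmegaAlgebra.op (k := k) ω a) r) φ := rfl

theorem evalOPI_mono (r : X → R) (w : OpWord X) : evalOPI r (mono k w) =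
    OpWord.lift (fun ω a => OmegaAlgebra.op (k := k) ω a) r w := by
  rw [evalOPI_eq, linExt_single, one_smul]

theorem evalOPI_phi1 (r : Fin 2 → R) : evalOPI r (phi1 k) =
    opP k (r 0) * opP k (r 1) - opP k (r 0 * opP k (r 1)) - opP k (opP k (r 0) * r 1) := by
  simp only [phi1, op_mono, mono_mul]
  rw [evalOPI_eq, map_sub, map_sub]
  simp only [linExt_single, one_smul]
  rfl

theorem evalOPI_phi2 (r : Fin 2 → R) : evalOPI r (phi2 k) =
    opD k (r 0) * r 1 + r 0 * opD k (r 1) - opD k (r 0 * r 1) := by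
  simp only [phi2, op_mono, mono_mul]
  rw [evalOPI_eq, map_sub, map_add]
  simp only [linExt_single, one_smul]
  rfl

theorem evalOPI_phi3 (r : Fin 2 → R) : evalOPI r (phi3 k) = opD k (opP k (r 0)) - r 0 := by
  simp only [phi3, op_mono]
  rw [evalOPI_eq, map_sub]
  simp only [linExt_single, one_smul]
  rfl

theorem evalOPI_phi4 (r : Fin 2 → R) : evalOPI r (phi4 k) =
    opP k (r 0) * opD k (r 1) - opD k (opP k (r 0) * r 1) + r 0 * r 1 := by
  simp only [phi4, op_mono, mono_mul]
  rw [evalOPI_eq, map_add, map_sub]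
  simp only [linExt_single, one_smul]
  rfl

/-- Only the fourth identity has no counterpart among the axioms; it is the Leibniz rule for
`D(P(x)y)` combined with `D(P(x)) = x`. -/
theorem satisfiesOPIs_iff : SatisfiesOPIs (OdRB k) R ↔ IsDiffRB k 0 R := by
  constructor
  · intro h
    refine ⟨fun a b => ?_, fun a b => ?_, fun a => ?_⟩
    · have := h _ (.inr (.inl rfl)) ![a, b]
      rw [evalOPI_phi2, sub_eq_zero] at this
      simpa using this.symm
    · have := h _ (.inl rfl) ![a, b]
      rw [evalOPI_phi1, sub_sub, sub_eq_zero] at this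
      simpa using this
    · have := h _ (.inr (.inr (.inl rfl))) ![a, a]
      rwa [evalOPI_phi3, sub_eq_zero] at this
  · rintro ⟨h1, h2, h3⟩ φ (rfl | rfl | rfl | rfl) r
    · rw [evalOPI_phi1, h2, zero_smul]; abel
    · rw [evalOPI_phi2, h1, zero_smul]; abel
    · rw [evalOPI_phi3, h3, sub_self]
    · rw [evalOPI_phi4, h1, h3, zero_smul]; abel

end Eval

open OpWord

variable (k) {Z : Type u}

/-- The value `P(u)P(v) - P(uP(v)) - P(P(u)v)` at words. -/
def rel1 (u v : OpWord Z) : FreeOmega k Z :=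
  mono k (br Op.P u * br Op.P v) - mono k (br Op.P (u * br Op.P v)) -
    mono k (br Op.P (br Op.P u * v))

/-- The value `D(u)v + uD(v) - D(uv)` at words. -/
def rel2 (u v : OpWord Z) : FreeOmega k Z :=
  mono k (br Op.D u * v) + mono k (u * br Op.D v) - mono k (br Op.D (u * v))

/-- The value `D(P(u)) - u` at words. -/
def rel3 (u : OpWord Z) : FreeOmega k Z :=
  mono k (br Op.D (br Op.P u)) - mono k u

/-- The value `P(u)D(v) - D(P(u)v) + uv` at words. -/
def rel4 (u v : OpWord Z) : FreeOmega k Z :=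
  mono k (br Op.P u * br Op.D v) - mono k (br Op.D (br Op.P u * v)) + mono k (u * v)

variable {k}

theorem evalOPI_word_phi1 (r : Fin 2 → OpWord Z) :
    evalOPI (fun i => mono k (r i)) (phi1 k) = rel1 k (r 0) (r 1) := by
  simp only [evalOPI_phi1, op_mono, mono_mul, rel1]

theorem evalOPI_word_phi2 (r : Fin 2 → OpWord Z) :
    evalOPI (fun i => mono k (r i)) (phi2 k) = rel2 k (r 0) (r 1) := by
  simp only [evalOPI_phi2, op_mono, mono_mul, rel2]

theorem evalOPI_word_phi3 (r : Fin 2 → OpWord Z) :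
    evalOPI (fun i => mono k (r i)) (phi3 k) = rel3 k (r 0) := by
  simp only [evalOPI_phi3, op_mono, rel3]

theorem evalOPI_word_phi4 (r : Fin 2 → OpWord Z) :
    evalOPI (fun i => mono k (r i)) (phi4 k) = rel4 k (r 0) (r 1) := by
  simp only [evalOPI_phi4, op_mono, mono_mul, rel4]

theorem mem_valuesOPIs {f : FreeOmega k Z} : f ∈ valuesOPIs (OdRB k) Z ↔
    ∃ a b : OpWord Z, f = rel1 k a b ∨ f = rel2 k a b ∨ f = rel3 k a ∨ f = rel4 k a b := by
  constructor
  · rintro ⟨φ, rfl | rfl | rfl | rfl, r, rfl⟩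
    · exact ⟨r 0, r 1, .inl (evalOPI_word_phi1 r)⟩
    · exact ⟨r 0, r 1, .inr (.inl (evalOPI_word_phi2 r))⟩
    · exact ⟨r 0, r 1, .inr (.inr (.inl (evalOPI_word_phi3 r)))⟩
    · exact ⟨r 0, r 1, .inr (.inr (.inr (evalOPI_word_phi4 r)))⟩
  · rintro ⟨a, b, rfl | rfl | rfl | rfl⟩
    · exact ⟨phi1 k, .inl rfl, ![a, b], (evalOPI_word_phi1 ![a, b]).symm⟩
    · exact ⟨phi2 k, .inr (.inl rfl), ![a, b], (evalOPI_word_phi2 ![a, b]).symm⟩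
    · exact ⟨phi3 k, .inr (.inr (.inl rfl)), ![a, b], (evalOPI_word_phi3 ![a, b]).symm⟩
    · exact ⟨phi4 k, .inr (.inr (.inr rfl)), ![a, b], (evalOPI_word_phi4 ![a, b]).symm⟩

/-! ### Leading monomials of the values -/

/-- All four identities are put in this common three-term shape. The lower words may coincide and
their coefficients may vanish, so the two-term identity fits after padding with a zero term. -/
theorem isLeading_of_rest {M : Type w} {lt : M → M → Prop} [Std.Irrefl lt] {m : M} {x y : M}
    (hx : lt x m) (hy : lt y m) (a b : k) :
    IsLeading lt (MonoidAlgebra.single m (1 : k) + a • MonoidAlgebra.single x 1 +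
      b • MonoidAlgebra.single y 1) m ∧
    (MonoidAlgebra.single m (1 : k) + a • MonoidAlgebra.single x 1 +
      b • MonoidAlgebra.single y 1).coeff m = 1 := by
  classical
  have h (z : M) : (MonoidAlgebra.single m (1 : k) + a • MonoidAlgebra.single x 1 +
      b • MonoidAlgebra.single y 1).coeff z =
      (if m = z then 1 else 0) + a * (if x = z then 1 else 0) + b * (if y = z then 1 else 0) := by
    simp [Finsupp.single_apply]
  have hxm : x ≠ m := fun e => irrefl_of lt m (e ▸ hx)
  have hym : y ≠ m := fun e => irrefl_of lt m (e ▸ hy)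
  have h1 := h m
  simp only [if_true, hxm, hym, if_false, mul_zero, add_zero] at h1
  refine ⟨⟨by rw [h1]; exact one_ne_zero, fun z hz hne => ?_⟩, h1⟩
  rw [h, if_neg (Ne.symm hne)] at hz
  by_cases e : x = z
  · exact e ▸ hx
  · by_cases e' : y = z
    · exact e' ▸ hy
    · simp [e, e'] at hz

theorem OpWord.breadth_br (ω : Op) (u : OpWord Z) : breadth (br ω u) = 1 := rfl

theorem rel1_eq (u v : OpWord Z) : rel1 k u v = mono k (br Op.P u * br Op.P v) +
    (-1 : k) • mono k (br Op.P (u * br Op.P v)) + (-1 : k) • mono k (br Op.P (br Op.P u * v)) := by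
  rw [rel1]; module

theorem rel2_eq (u v : OpWord Z) : rel2 k u v = mono k (br Op.D u * v) +
    (1 : k) • mono k (u * br Op.D v) + (-1 : k) • mono k (br Op.D (u * v)) := by
  rw [rel2]; module

theorem rel3_eq (u : OpWord Z) : rel3 k u = mono k (br Op.D (br Op.P u)) +
    (-1 : k) • mono k u + (0 : k) • mono k u := by
  rw [rel3]; module

theorem rel4_eq (u v : OpWord Z) : rel4 k u v = mono k (br Op.P u * br Op.D v) +
    (-1 : k) • mono k (br Op.D (br Op.P u * v)) + (1 : k) • mono k (u * v) := by
  rw [rel4]; module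

variable [LinearOrder Z]

/-- The comparisons among identities never reach the atom-by-atom stage, so they reduce to
arithmetic on degrees and breadths. -/
theorem OpWord.pdLT_of_degrees {u v : OpWord Z}
    (h : degD u < degD v ∨ (degD u = degD v ∧ (degP u < degP v ∨ (degP u = degP v ∧
      (degZ u < degZ v ∨ (degZ u = degZ v ∧ (degGD u < degGD v ∨ (degGD u = degGD v ∧
      (degGP u < degGP v ∨ (degGP u = degGP v ∧ breadth u < breadth v)))))))))) : PDLT u v := by
  unfold PDLT DlexLT
  tauto

attribute [local simp] degD_mul degP_mul degZ_mul degGD_mul degGP_mul breadth_mul degD_brD degD_brP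
  degP_brD degP_brP degZ_br degGD_br degGP_br OpWord.breadth_br

/-- The first four degrees tie. Moving `P(v)` inside the other bracket lowers the GP-degree by `degZ
v`, which is positive. -/
theorem lt_rel1_left (u v : OpWord Z) : PDLT (br Op.P (u * br Op.P v)) (br Op.P u * br Op.P v) := by
  have := degZ_pos v
  exact pdLT_of_degrees (by simp [mul_add]; omega)

theorem lt_rel1_right (u v : OpWord Z) :
    PDLT (br Op.P (br Op.P u * v)) (br Op.P u * br Op.P v) := by
  have := degZ_pos u
  exact pdLT_of_degrees (by simp [mul_add]; omega)

/-- The GD-degree decides: the bracket around `u` had the `degZ v` letters of `v` to its right,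
while the new bracket has none. -/
theorem lt_rel2_left (u v : OpWord Z) : PDLT (u * br Op.D v) (br Op.D u * v) := by
  have := degZ_pos v
  exact pdLT_of_degrees (by simp [mul_add]; omega)

theorem lt_rel2_right (u v : OpWord Z) : PDLT (br Op.D (u * v)) (br Op.D u * v) := by
  have := degZ_pos v
  exact pdLT_of_degrees (by simp [mul_add]; omega)

theorem lt_rel3 (u : OpWord Z) : PDLT u (br Op.D (br Op.P u)) :=
  pdLT_of_degrees (by simp)

/-- All five degrees tie; breadth one against two decides. -/
theorem lt_rel4_left (u v : OpWord Z) :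
    PDLT (br Op.D (br Op.P u * v)) (br Op.P u * br Op.D v) :=
  pdLT_of_degrees (by simp; omega)

theorem lt_rel4_right (u v : OpWord Z) : PDLT (u * v) (br Op.P u * br Op.D v) :=
  pdLT_of_degrees (by simp)

variable [WellFoundedLT Z]

theorem isLeading_rel1 (u v : OpWord Z) :
    IsLeading PDLT (rel1 k u v) (br Op.P u * br Op.P v) ∧
      (rel1 k u v).coeff (br Op.P u * br Op.P v) = 1 := by
  rw [rel1_eq]
  exact isLeading_of_rest (lt_rel1_left u v) (lt_rel1_right u v) _ _

theorem isLeading_rel2 (u v : OpWord Z) : IsLeading PDLT (rel2 k u v) (br Op.D u * v) ∧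
    (rel2 k u v).coeff (br Op.D u * v) = 1 := by
  rw [rel2_eq]
  exact isLeading_of_rest (lt_rel2_left u v) (lt_rel2_right u v) _ _

theorem isLeading_rel3 (u : OpWord Z) : IsLeading PDLT (rel3 k u) (br Op.D (br Op.P u)) ∧
    (rel3 k u).coeff (br Op.D (br Op.P u)) = 1 := by
  rw [rel3_eq]
  exact isLeading_of_rest (lt_rel3 u) (lt_rel3 u) _ _

theorem isLeading_rel4 (u v : OpWord Z) :
    IsLeading PDLT (rel4 k u v) (br Op.P u * br Op.D v) ∧
      (rel4 k u v).coeff (br Op.P u * br Op.D v) = 1 := by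
  rw [rel4_eq]
  exact isLeading_of_rest (lt_rel4_left u v) (lt_rel4_right u v) _ _

end Values

/-! ### Words without brackets -/

section Letters

open OpWord

variable {Z : Type u}

theorem inclWord_mk_nil (z : Z) : inclWord Z ⟨z, []⟩ = of z := rfl

theorem inclWord_mk_cons (z y : Z) (t : List Z) :
    inclWord Z ⟨z, y :: t⟩ = ofCons z (inclWord Z ⟨y, t⟩) := by
  rw [← of_mul]
  exact map_mul (inclWord Z) (FreeSemigroup.of z) ⟨y, t⟩

theorem letters_inclWord (a : FreeSemigroup Z) : letters (inclWord Z a) = a.head :: a.tail := by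
  obtain ⟨z, t⟩ := a
  induction t generalizing z with
  | nil => rfl
  | cons y t ih => rw [inclWord_mk_cons, letters, ih]

theorem inclWord_injective : Function.Injective (inclWord Z) := by
  intro a b h
  have := letters_inclWord a
  rw [h, letters_inclWord, List.cons.injEq] at this
  obtain ⟨x, s⟩ := a
  obtain ⟨y, t⟩ := b
  obtain ⟨rfl, rfl⟩ := this
  rfl

theorem breadth_inclWord (a : FreeSemigroup Z) : breadth (inclWord Z a) = a.length := by
  obtain ⟨z, t⟩ := a
  induction t generalizing z with
  | nil => rfl
  | cons y t ih => rw [inclWord_mk_cons, breadth, ih]; rfl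

theorem inclWord_ne_br (a : FreeSemigroup Z) (ω : Op) (u : OpWord Z) : inclWord Z a ≠ br ω u := by
  obtain ⟨z, _ | ⟨y, t⟩⟩ := a
  · simp [inclWord_mk_nil]
  · simp [inclWord_mk_cons]

theorem inclWord_mul_ne (a : FreeSemigroup Z) (v : WithOne (OpWord Z)) (ω : Op)
    (u : OpWord Z) (w : WithOne (OpWord Z)) :
    (inclWord Z a : WithOne (OpWord Z)) * v ≠ br ω u * w := by
  obtain ⟨z, _ | ⟨y, t⟩⟩ := a <;> cases v <;> cases w <;>
    simp [inclWord_mk_nil, inclWord_mk_cons, ← WithOne.coe_mul, of_mul, br_mul, ofCons_mul]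

/-- The number of brackets in a word. -/
def brackets (u : OpWord Z) : ℕ := degD u + degP u

theorem brackets_mul (u v : OpWord Z) : brackets (u * v) = brackets u + brackets v := by
  simp only [brackets, degD_mul, degP_mul]; omega

theorem brackets_br (ω : Op) (u : OpWord Z) : brackets (br ω u) = brackets u + 1 := by
  cases ω <;> simp only [brackets, degD, degP] <;> omega

theorem brackets_le_of_isContext {c : OpWord Z → OpWord Z} (hc : IsContext c) (u : OpWord Z) :
    brackets u ≤ brackets (c u) :=
  hc.induct (motive := fun c => brackets u ≤ brackets (c u)) le_rfl
    (fun c a ih => by rw [brackets_mul]; omega) (fun c b ih => by rw [brackets_mul]; omega)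
    fun c ω ih => by rw [brackets_br]; omega

theorem brackets_inclWord (a : FreeSemigroup Z) : brackets (inclWord Z a) = 0 := by
  obtain ⟨z, t⟩ := a
  induction t generalizing z with
  | nil => rfl
  | cons y t ih =>
    rw [inclWord_mk_cons, ← of_mul, brackets_mul, ih]
    rfl

theorem exists_inclWord {u : OpWord Z} (h : brackets u = 0) : ∃ a, u = inclWord Z a := by
  induction u with
  | of z => exact ⟨.of z, rfl⟩
  | br ω w => rw [brackets_br] at h; omega
  | ofCons z w ih =>
    rw [← of_mul, brackets_mul] at h
    obtain ⟨a, rfl⟩ := ih (by omega)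
    exact ⟨.of z * a, by rw [map_mul]; rfl⟩
  | brCons ω w w' => rw [← br_mul, brackets_mul, brackets_br] at h; omega

theorem degGD_eq_zero {u : OpWord Z} (h : brackets u = 0) : degGD u = 0 ∧ degGP u = 0 := by
  obtain ⟨⟨z, t⟩, rfl⟩ := exists_inclWord h
  clear h
  induction t generalizing z with
  | nil => exact ⟨rfl, rfl⟩
  | cons y t ih =>
    have hb := brackets_inclWord ⟨y, t⟩
    rw [inclWord_mk_cons, ← of_mul, degGD_mul, degGP_mul, (ih y).1, (ih y).2]
    simp only [brackets, add_eq_zero] at hb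
    rw [hb.2]
    simp [degGD, degGP, degGDAux, degGPAux, degD, degP]

variable {k : Type v} [Field k]

theorem incl_apply (f : MonoidAlgebra k (FreeSemigroup Z)) :
    incl k Z f = mapLin k (inclWord Z) f := rfl

theorem coeff_incl (f : MonoidAlgebra k (FreeSemigroup Z)) (m : FreeSemigroup Z) :
    (incl k Z f).coeff (inclWord Z m) = f.coeff m :=
  Finsupp.mapDomain_apply inclWord_injective _ _

variable [LinearOrder Z]

theorem lexLT_inclWord (a b : FreeSemigroup Z) (h : a.length = b.length) :
    LexLT (inclWord Z a) (inclWord Z b) ↔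
      List.Lex (· < ·) (a.head :: a.tail) (b.head :: b.tail) := by
  obtain ⟨x, s⟩ := a
  obtain ⟨y, t⟩ := b
  induction s generalizing x y t with
  | nil =>
    cases t with
    | nil => simp [inclWord_mk_nil, LexLT]
    | cons y t => simp [FreeSemigroup.length] at h
  | cons x' s ih =>
    cases t with
    | nil => simp [FreeSemigroup.length] at h
    | cons y' t =>
      have := ih x' y' t (by simpa [FreeSemigroup.length] using h)
      rw [inclWord_mk_cons, inclWord_mk_cons, LexLT, this]
      constructor
      · rintro (hlt | ⟨rfl, hlex⟩)
        · exact .rel hlt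
        · exact .cons hlex
      · intro hlex
        cases hlex with
        | cons h => exact .inr ⟨rfl, h⟩
        | rel h => exact .inl h

/-- Without brackets every bracket degree vanishes and the number of letters equals the breadth, so
only the degree-lexicographic part survives. -/
theorem pdLT_inclWord (a b : FreeSemigroup Z) :
    PDLT (inclWord Z a) (inclWord Z b) ↔ SemigroupDlexLT a b := by
  have ha := brackets_inclWord a
  have hb := brackets_inclWord b
  have hz (a : FreeSemigroup Z) : degZ (inclWord Z a) = a.length := by
    rw [degZ, letters_inclWord]; rfl
  have ha' := degGD_eq_zero ha
  have hb' := degGD_eq_zero hb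
  simp only [brackets, add_eq_zero] at ha hb
  simp only [PDLT, ha.1, ha.2, hb.1, hb.2, ha'.1, ha'.2, hb'.1, hb'.2, hz, DlexLT,
    breadth_inclWord, SemigroupDlexLT, lt_irrefl, true_and, false_or]
  have := lexLT_inclWord a b
  constructor
  · rintro (h | ⟨h, h' | ⟨-, h'⟩⟩)
    · exact .inl h
    · exact .inl h'
    · exact .inr ⟨h, (this h).1 h'⟩
  · rintro (h | ⟨h, h'⟩)
    · exact .inl h
    · exact .inr ⟨h, .inr ⟨h, (this h).2 h'⟩⟩

variable [WellFoundedLT Z]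

instance : IsWellOrder (FreeSemigroup Z) SemigroupDlexLT :=
  RelEmbedding.isWellOrder (s := PDLT)
    ⟨⟨inclWord Z, inclWord_injective⟩, fun {a b} => pdLT_inclWord a b⟩

theorem isLeading_incl {f : MonoidAlgebra k (FreeSemigroup Z)} {m : FreeSemigroup Z}
    (h : IsLeading SemigroupDlexLT f m) : IsLeading PDLT (incl k Z f) (inclWord Z m) :=
  h.mapDomain fun a b => (pdLT_inclWord a b).2

theorem exists_isLeading_of_incl {f : MonoidAlgebra k (FreeSemigroup Z)} {m : OpWord Z}
    (h : IsLeading PDLT (incl k Z f) m) :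
    ∃ m₀, m = inclWord Z m₀ ∧ IsLeading SemigroupDlexLT f m₀ := by
  have hf : f ≠ 0 := by
    rintro rfl
    exact h.ne_zero (map_zero _)
  obtain ⟨m₀, hm₀⟩ := exists_isLeading (lt := SemigroupDlexLT) hf
  exact ⟨m₀, h.unique (isLeading_incl hm₀), hm₀⟩

end Letters

end DRB

end

noncomputable section

namespace DRB

open OpWord

/-! ### Contexts in the free semigroup -/

section SemigroupContexts

variable {Z : Type u}

theorem head_cons_tail_mul (a b : FreeSemigroup Z) :
    (a * b).head :: (a * b).tail = (a.head :: a.tail) ++ (b.head :: b.tail) := rfl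

theorem id_mem_semigroupContexts : (fun x => x) ∈ semigroupContexts Z :=
  ⟨.of none, rfl, funext fun _ => by simp⟩

theorem count_map_some (a : FreeSemigroup Z) :
    ((FreeSemigroup.map some a).head :: (FreeSemigroup.map some a).tail).countP
      Option.isNone = 0 := by
  induction a using FreeSemigroup.recOnMul with
  | ih1 x => rfl
  | ih2 x y hx hy =>
    rw [map_mul, head_cons_tail_mul, List.countP_append, hx, zero_add]
    exact hy

theorem lift_map_some (a x : FreeSemigroup Z) :
    FreeSemigroup.lift (fun z : Option Z => z.elim x FreeSemigroup.of)
      (FreeSemigroup.map some a) = a := by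
  induction a using FreeSemigroup.recOnMul with
  | ih1 x => simp
  | ih2 x y hx hy => rw [map_mul, map_mul, hx, hy]

theorem mul_left_mem_semigroupContexts {c : FreeSemigroup Z → FreeSemigroup Z}
    (hc : c ∈ semigroupContexts Z) (a : FreeSemigroup Z) :
    (fun x => a * c x) ∈ semigroupContexts Z := by
  obtain ⟨q, hq, rfl⟩ := hc
  refine ⟨FreeSemigroup.map some a * q, ?_, funext fun x => ?_⟩
  · rw [head_cons_tail_mul, List.countP_append, count_map_some, hq]
  · rw [map_mul, lift_map_some]

theorem mul_right_mem_semigroupContexts {c : FreeSemigroup Z → FreeSemigroup Z}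
    (hc : c ∈ semigroupContexts Z) (a : FreeSemigroup Z) :
    (fun x => c x * a) ∈ semigroupContexts Z := by
  obtain ⟨q, hq, rfl⟩ := hc
  refine ⟨q * FreeSemigroup.map some a, ?_, funext fun x => ?_⟩
  · rw [head_cons_tail_mul, List.countP_append, count_map_some, hq]
  · rw [map_mul, lift_map_some]

/-- The same `⋆`-word serves, read as a bracketed word over `Z ∪ {⋆}`. -/
theorem exists_context_extending {c : FreeSemigroup Z → FreeSemigroup Z}
    (hc : c ∈ semigroupContexts Z) :
    ∃ c' ∈ contexts Z, ∀ x, c' (inclWord Z x) = inclWord Z (c x) := by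
  obtain ⟨q, hq, rfl⟩ := hc
  refine ⟨starSubst (inclWord (Option Z) q), ⟨_, by rwa [letters_inclWord], rfl⟩, fun x => ?_⟩
  clear hq
  induction q using FreeSemigroup.recOnMul with
  | ih1 z => cases z <;> rfl
  | ih2 p q hp hq => 
    rw [map_mul, starSubst_mul, hp, hq]
    simp only [map_mul]

/-- A context cannot remove brackets, so a bracket-free result forces bracket-free material on both
sides of the hole. -/
theorem exists_context_restricting {c : OpWord Z → OpWord Z} (hc : IsContext c)
    {m m' : FreeSemigroup Z} (h : inclWord Z m = c (inclWord Z m')) :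
    ∃ c' ∈ semigroupContexts Z, m = c' m' ∧ ∀ x, c (inclWord Z x) = inclWord Z (c' x) := by
  have hb := brackets_inclWord m
  suffices ∃ c' ∈ semigroupContexts Z, ∀ x, c (inclWord Z x) = inclWord Z (c' x) by
    obtain ⟨c', hc', hx⟩ := this
    exact ⟨c', hc', inclWord_injective (h.trans (hx m')), hx⟩
  cases hc with
  | nest a b ω he =>
    have h1 := brackets_le_of_isContext (.hole a b) (.br ω _) |>.trans_eq
      ((congrArg brackets h).symm.trans hb)
    rw [brackets_br] at h1
    omega
  | hole a b =>
    rw [h] at hb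
    cases a <;> cases b <;> simp only [sand, WithOne.recOneCoe_one, WithOne.recOneCoe_coe,
      brackets_mul] at hb ⊢
    · exact ⟨_, id_mem_semigroupContexts, fun _ => rfl⟩
    · rename_i b
      obtain ⟨b, rfl⟩ := exists_inclWord (u := b) (by omega)
      exact ⟨_, mul_right_mem_semigroupContexts id_mem_semigroupContexts b,
        fun _ => (map_mul ..).symm⟩
    · rename_i a
      obtain ⟨a, rfl⟩ := exists_inclWord (u := a) (by omega)
      exact ⟨_, mul_left_mem_semigroupContexts id_mem_semigroupContexts a,
        fun _ => (map_mul ..).symm⟩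
    · rename_i a b
      obtain ⟨a, rfl⟩ := exists_inclWord (u := a) (by omega)
      obtain ⟨b, rfl⟩ := exists_inclWord (u := b) (by omega)
      exact ⟨_, mul_right_mem_semigroupContexts
        (mul_left_mem_semigroupContexts id_mem_semigroupContexts a) b,
        fun _ => by simp only [map_mul]⟩

end SemigroupContexts

/-! ### Contexts around a subword of a product -/

section SubwordPositions

variable {Z : Type u}

theorem OpWord.IsContext.eq_atom {c : OpWord Z → OpWord Z} (hc : IsContext c) {x m : OpWord Z}
    (hx : breadth x = 1) (h : x = c m) : (m = x ∧ ∀ u, c u = u) ∨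
      ∃ ω c', IsContext c' ∧ x = .br ω (c' m) ∧ ∀ u, c u = .br ω (c' u) := by
  have key {a b : WithOne (OpWord Z)} {y : OpWord Z} (h : x = OpWord.sand a b y) :
      a = 1 ∧ b = 1 := by
    rw [← WithOne.coe_inj, coe_sand, mul_assoc] at h
    rcases atom_eq_mul hx h with ⟨h1, h2⟩ | ⟨-, h2⟩
    · rcases atom_eq_mul hx h2.symm with ⟨h3, -⟩ | ⟨-, h3⟩
      · exact (WithOne.coe_ne_one h3).elim
      · exact ⟨h1, h3⟩
    · exact (coe_mul_ne_one _ _ h2).elim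
  cases hc with
  | hole a b =>
    obtain ⟨rfl, rfl⟩ := key h
    exact .inl ⟨h.symm, fun _ => rfl⟩
  | nest a b ω he =>
    obtain ⟨rfl, rfl⟩ := key h
    exact .inr ⟨ω, _, he, h, fun _ => rfl⟩

/-- Three of the four identities have leading words of this form. The last alternative, a proper
prefix longer than the first atom, can arise only when `y` has several atoms, which among those
leading words happens only for `D(u)v`. -/
theorem OpWord.IsContext.eq_atom_mul {c : OpWord Z → OpWord Z} (hc : IsContext c)
    {x y m : OpWord Z} (hx : breadth x = 1) (h : x * y = c m) :
    (∃ c', IsContext c' ∧ x = c' m ∧ ∀ u, c u = c' u * y) ∨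
    (∃ c', IsContext c' ∧ y = c' m ∧ ∀ u, c u = x * c' u) ∨
    (m = x * y ∧ ∀ u, c u = u) ∨
    ∃ t b, m = x * t ∧ y = t * b ∧ ∀ u, c u = u * b := by
  have key {a b : WithOne (OpWord Z)} {e : OpWord Z → OpWord Z} (he : IsContext e)
      (h : x * y = OpWord.sand a b (e m)) : (∃ c', IsContext c' ∧ y = c' m ∧
        ∀ u, OpWord.sand a b (e u) = x * c' u) ∨
      a = 1 ∧ ∃ t : WithOne (OpWord Z), (e m : WithOne (OpWord Z)) = x * t ∧ y = t * b := by
    rw [← WithOne.coe_inj, coe_sand, mul_assoc, WithOne.coe_mul] at h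
    obtain ⟨t, ⟨h1, h2⟩ | ⟨rfl, h2⟩⟩ := levi h
    · rcases atom_eq_mul hx h1 with ⟨rfl, rfl⟩ | ⟨rfl, rfl⟩
      · right
        obtain ⟨s, ⟨h3, h4⟩ | ⟨h3, h4⟩⟩ := levi h2
        · exact ⟨rfl, s, h3, h4⟩
        · rcases atom_eq_mul hx h3 with ⟨h5, -⟩ | ⟨h5, rfl⟩
          · exact (WithOne.coe_ne_one h5).elim
          · exact ⟨rfl, 1, by rw [mul_one, ← h5], by rw [one_mul, h4, one_mul]⟩
      · exact .inl ⟨_, he.sand 1 b, WithOne.coe_inj.1 (by rw [coe_sand, one_mul, h2, one_mul]),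
          fun u => WithOne.coe_inj.1 (by simp [coe_sand, mul_assoc])⟩
    · exact .inl ⟨_, he.sand t b, WithOne.coe_inj.1 (by rw [coe_sand, h2, mul_assoc]),
        fun u => WithOne.coe_inj.1 (by simp [coe_sand, mul_assoc])⟩
  cases hc with
  | hole a b =>
    rcases key .id h with h | ⟨rfl, t, h1, h2⟩
    · exact .inr (.inl h)
    · cases t with
      | one =>
        rw [mul_one, WithOne.coe_inj] at h1
        rw [one_mul] at h2
        subst h2
        exact .inl ⟨_, .id, h1.symm, fun _ => rfl⟩
      | coe t =>
        rw [← WithOne.coe_mul, WithOne.coe_inj] at h1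
        cases b with
        | one =>
          rw [mul_one, WithOne.coe_inj] at h2
          exact .inr (.inr (.inl ⟨by rw [h1, h2], fun _ => rfl⟩))
        | coe b =>
          rw [← WithOne.coe_mul, WithOne.coe_inj] at h2
          exact .inr (.inr (.inr ⟨t, b, h1, h2, fun _ => rfl⟩))
  | nest a b ω he =>
    rcases key (he.br ω) h with h | ⟨rfl, t, h1, h2⟩
    · exact .inr (.inl h)
    · rcases atom_eq_mul rfl h1 with ⟨h3, -⟩ | ⟨h3, rfl⟩
      · exact (WithOne.coe_ne_one h3).elim
      · rw [one_mul] at h2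
        subst h2
        exact .inl ⟨_, he.br ω, WithOne.coe_inj.1 h3, fun _ => rfl⟩

/-- The breadth bound rules out adjacent or separated factors, leaving a nonempty common part `r`.
-/
theorem OpWord.exists_overlap {m₁ m₂ a b : OpWord Z} (h : m₁ * a = b * m₂)
    (hlt : breadth (m₁ * a) < breadth m₁ + breadth m₂) : ∃ r, m₁ = b * r ∧ m₂ = r * a := by
  rw [breadth_mul] at hlt
  rw [← WithOne.coe_inj, WithOne.coe_mul, WithOne.coe_mul] at h
  obtain ⟨t, ⟨h1, h2⟩ | ⟨h1, h2⟩⟩ := levi h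
  · cases t with
    | one =>
      rw [one_mul, WithOne.coe_inj] at h2
      rw [h2] at hlt
      omega
    | coe t =>
      exact ⟨t, WithOne.coe_inj.1 (by simpa using h1), WithOne.coe_inj.1 (by simpa using h2)⟩
  · cases t with
    | one =>
      rw [one_mul, WithOne.coe_inj] at h2
      rw [h2] at hlt
      omega
    | coe t =>
      rw [← WithOne.coe_mul, WithOne.coe_inj] at h2
      rw [h2, breadth_mul] at hlt
      omega

end SubwordPositions

/-! ### Compositions of the identities -/

section Compositions

variable {k : Type v} [Field k] {Z : Type u} {G : Set (FreeOmega k Z)}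

attribute [local simp] degD_mul degP_mul degZ_mul degGD_mul degGP_mul breadth_mul degD_brD degD_brP
  degP_brD degP_brP degZ_br degGD_br degGP_br OpWord.breadth_br

theorem mapLin_id (f : FreeOmega k Z) : mapLin k (fun x => x) f = f :=
  congrArg (· f) (linearMap_ext (L' := LinearMap.id) fun _ => mapLin_single ..)

theorem rel1_mem (hS : valuesOPIs (OdRB k) Z ⊆ G) (u v : OpWord Z) :
    rel1 k u v ∈ G :=
  hS (mem_valuesOPIs.2 ⟨u, v, .inl rfl⟩)

theorem rel2_mem (hS : valuesOPIs (OdRB k) Z ⊆ G) (u v : OpWord Z) : rel2 k u v ∈ G :=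
  hS (mem_valuesOPIs.2 ⟨u, v, .inr (.inl rfl)⟩)

theorem rel3_mem (hS : valuesOPIs (OdRB k) Z ⊆ G) (u : OpWord Z) : rel3 k u ∈ G :=
  hS (mem_valuesOPIs.2 ⟨u, u, .inr (.inr (.inl rfl))⟩)

theorem rel4_mem (hS : valuesOPIs (OdRB k) Z ⊆ G) (u v : OpWord Z) : rel4 k u v ∈ G :=
  hS (mem_valuesOPIs.2 ⟨u, v, .inr (.inr (.inr rfl))⟩)

variable [LinearOrder Z] [WellFoundedLT Z]

/-- Compositions inside the variable part of a family of elements of `G`. -/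
theorem family_sub_mem {F : OpWord Z → FreeOmega k Z} {L r₁ r₂ : OpWord Z → OpWord Z} {α β : k}
    (hF : ∀ x, F x = mono k (L x) + α • mono k (r₁ x) + β • mono k (r₂ x)) (hG : ∀ x, F x ∈ G)
    (hL : IsContext L) (h₁ : IsContext r₁) (h₂ : IsContext r₂) (l₁ : ∀ x, PDLT (r₁ x) (L x))
    (l₂ : ∀ x, PDLT (r₂ x) (L x)) {c : OpWord Z → OpWord Z} (hc : IsContext c)
    {g : FreeOmega k Z} (hg : g ∈ G) {m : OpWord Z} (hm : IsLeading PDLT g m) :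
    F (c m) - mapLin k (fun u => L (c u)) (monic g m) ∈
      trivialMod PDLT (contexts Z) G (L (c m)) := by
  have hM := isMonomialOrder_pdLT (Z := Z)
  -- Replacing `m` by a smaller monomial `x` of `g` gives another member of the family, with smaller
  -- leading word `L (c x)`.
  have key : linExt (fun x => F (c x)) (MonoidAlgebra.single m 1 - monic g m) ∈
      trivialMod PDLT (contexts Z) G (L (c m)) := by
    refine linExt_mem fun x hx => ?_
    have hl : IsLeading PDLT (F (c x)) (L (c x)) := by
      rw [hF]
      exact (isLeading_of_rest (l₁ _) (l₂ _) _ _).1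
    have := mapLin_mem_trivialMod (mem_contexts.2 .id) (hG (c x)) hl (hM.2 _
      (mem_contexts.2 (hL.comp hc)) _ _ (lt_of_coeff_sub_monic_ne_zero hm hx))
    rwa [mapLin_id] at this
  -- By linearity in the argument, the family evaluated at `g` is a sum of three substitutions of
  -- `g`; the two along `r₁` and `r₂` are trivial because these lie below `L`.
  have e : linExt (fun x => F (c x)) (monic g m) = mapLin k (fun u => L (c u)) (monic g m) +
      α • mapLin k (fun u => r₁ (c u)) (monic g m) +
      β • mapLin k (fun u => r₂ (c u)) (monic g m) :=
    linExt_eq (L := mapLin k (fun u => L (c u)) + α • mapLin k (fun u => r₁ (c u)) +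
      β • mapLin k (fun u => r₂ (c u))) (fun x => by
        simp only [LinearMap.add_apply, LinearMap.smul_apply, mapLin_single, hF]) _
  rw [map_sub, linExt_single, one_smul, e] at key
  have k₁ := Submodule.smul_mem _ α (mapLin_monic_mem_trivialMod (mem_contexts.2 (h₁.comp hc))
    hg hm (l₁ (c m)))
  have k₂ := Submodule.smul_mem _ β (mapLin_monic_mem_trivialMod (mem_contexts.2 (h₂.comp hc))
    hg hm (l₂ (c m)))
  have := add_mem (add_mem key k₁) k₂
  convert this using 1
  abel

variable (hS : valuesOPIs (OdRB k) Z ⊆ G)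

include hS

theorem context_rel1_mem {c : OpWord Z → OpWord Z} (hc : IsContext c) (u v : OpWord Z)
    {p : OpWord Z} (h : PDLT (c (br Op.P u * br Op.P v)) p) :
    mapLin k c (rel1 k u v) ∈ trivialMod PDLT (contexts Z) G p :=
  mapLin_mem_trivialMod (mem_contexts.2 hc) (rel1_mem hS u v) (isLeading_rel1 u v).1 h

theorem context_rel2_mem {c : OpWord Z → OpWord Z} (hc : IsContext c) (u v : OpWord Z)
    {p : OpWord Z} (h : PDLT (c (br Op.D u * v)) p) :
    mapLin k c (rel2 k u v) ∈ trivialMod PDLT (contexts Z) G p :=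
  mapLin_mem_trivialMod (mem_contexts.2 hc) (rel2_mem hS u v) (isLeading_rel2 u v).1 h

theorem context_rel3_mem {c : OpWord Z → OpWord Z} (hc : IsContext c) (u : OpWord Z)
    {p : OpWord Z} (h : PDLT (c (br Op.D (br Op.P u))) p) :
    mapLin k c (rel3 k u) ∈ trivialMod PDLT (contexts Z) G p :=
  mapLin_mem_trivialMod (mem_contexts.2 hc) (rel3_mem hS u) (isLeading_rel3 u).1 h

theorem context_rel4_mem {c : OpWord Z → OpWord Z} (hc : IsContext c) (u v : OpWord Z)
    {p : OpWord Z} (h : PDLT (c (br Op.P u * br Op.D v)) p) :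
    mapLin k c (rel4 k u v) ∈ trivialMod PDLT (contexts Z) G p :=
  mapLin_mem_trivialMod (mem_contexts.2 hc) (rel4_mem hS u v) (isLeading_rel4 u v).1 h

/-- Both bracketings of `P(u)P(v)P(w)` reduce to the same nested words. The six identities used all
have smaller top words, since merging two of the factors lowers the GP-degree. -/
theorem comp_rel1_rel1 (u v w : OpWord Z) :
    rel1 k u v * mono k (br Op.P w) - mono k (br Op.P u) * rel1 k v w ∈
      trivialMod PDLT (contexts Z) G (br Op.P u * br Op.P v * br Op.P w) := by
  have e : rel1 k u v * mono k (br Op.P w) - mono k (br Op.P u) * rel1 k v w =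
      mapLin k (fun x => x) (rel1 k u (v * br Op.P w)) +
      mapLin k (fun x => x) (rel1 k u (br Op.P v * w)) -
      mapLin k (fun x => x) (rel1 k (u * br Op.P v) w) -
      mapLin k (fun x => x) (rel1 k (br Op.P u * v) w) -
      mapLin k (fun x => br Op.P (u * x)) (rel1 k v w) +
      mapLin k (fun x => br Op.P (x * w)) (rel1 k u v) := by
    simp only [rel1, map_sub, mapLin_single, sub_mul, mul_sub, mono_mul, mul_assoc]
    abel
  rw [e]
  refine add_mem (sub_mem (sub_mem (sub_mem (add_mem ?_ ?_) ?_) ?_) ?_) ?_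
  · exact context_rel1_mem hS .id _ _ (pdLT_of_degrees (by simp [mul_add, add_mul]; omega))
  · exact context_rel1_mem hS .id _ _ (pdLT_of_degrees (by simp [mul_add, add_mul]; omega))
  · exact context_rel1_mem hS .id _ _ (pdLT_of_degrees (by simp [mul_add, add_mul]; omega))
  · exact context_rel1_mem hS .id _ _ (pdLT_of_degrees (by simp [mul_add, add_mul]; omega))
  · exact context_rel1_mem hS ((IsContext.id.mul_left u).br Op.P) _ _
      (pdLT_of_degrees (by simp [mul_add, add_mul]; omega))
  · exact context_rel1_mem hS ((IsContext.id.mul_right w).br Op.P) _ _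
      (pdLT_of_degrees (by simp [mul_add, add_mul]; omega))

theorem comp_rel1_rel4 (u v w : OpWord Z) :
    rel1 k u v * mono k (br Op.D w) - mono k (br Op.P u) * rel4 k v w ∈
      trivialMod PDLT (contexts Z) G (br Op.P u * br Op.P v * br Op.D w) := by
  have e : rel1 k u v * mono k (br Op.D w) - mono k (br Op.P u) * rel4 k v w =
      mapLin k (fun x => x) (rel4 k u (br Op.P v * w)) -
      mapLin k (fun x => x) (rel4 k (u * br Op.P v) w) -
      mapLin k (fun x => x) (rel4 k (br Op.P u * v) w) +
      mapLin k (fun x => br Op.D (x * w)) (rel1 k u v) := by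
    simp only [rel1, rel4, map_sub, map_add, mapLin_single, sub_mul, mul_sub, mul_add, mono_mul,
      mul_assoc]
    abel
  rw [e]
  refine add_mem (sub_mem (sub_mem ?_ ?_) ?_) ?_
  · exact context_rel4_mem hS .id _ _ (pdLT_of_degrees (by simp [mul_add, add_mul]; omega))
  · exact context_rel4_mem hS .id _ _ (pdLT_of_degrees (by simp [mul_add, add_mul]; omega))
  · exact context_rel4_mem hS .id _ _ (pdLT_of_degrees (by simp [mul_add, add_mul]; omega))
  · exact context_rel1_mem hS ((IsContext.id.mul_right w).br Op.D) _ _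
      (pdLT_of_degrees (by simp [mul_add, add_mul]; omega))

theorem comp_rel4_rel2 (u v w : OpWord Z) :
    rel4 k u v * mono k w - mono k (br Op.P u) * rel2 k v w ∈
      trivialMod PDLT (contexts Z) G (br Op.P u * br Op.D v * w) := by
  have hw := degZ_pos w
  have e : rel4 k u v * mono k w - mono k (br Op.P u) * rel2 k v w =
      mapLin k (fun x => x) (rel4 k u (v * w)) -
      mapLin k (fun x => x) (rel2 k (br Op.P u * v) w) := by
    simp only [rel2, rel4, map_sub, map_add, mapLin_single, sub_mul, add_mul, mul_sub, mul_add,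
      mono_mul, mul_assoc]
    abel
  rw [e]
  refine sub_mem ?_ ?_
  · exact context_rel4_mem hS .id _ _ (pdLT_of_degrees (by simp [mul_add, add_mul]; omega))
  · exact context_rel2_mem hS .id _ _ (pdLT_of_degrees (by simp [mul_add, add_mul]; omega))

/-- The second argument of the Leibniz rule is an arbitrary word, so the rule applies to `D(u)vw`
with argument `v` or `vw`. This compatibility also serves in every overlap across the right end of
`D(u)v`. -/
theorem comp_rel2_rel2 (u v w : OpWord Z) :
    rel2 k u v * mono k w - rel2 k u (v * w) ∈
      trivialMod PDLT (contexts Z) G (br Op.D u * v * w) := by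
  have hv := degZ_pos v
  have e : rel2 k u v * mono k w - rel2 k u (v * w) =
      mapLin k (fun x => u * x) (rel2 k v w) -
      mapLin k (fun x => x) (rel2 k (u * v) w) := by
    simp only [rel2, map_sub, map_add, mapLin_single, sub_mul, add_mul, mono_mul, mul_assoc]
    abel
  rw [e]
  refine sub_mem ?_ ?_
  · exact context_rel2_mem hS (IsContext.id.mul_left u) _ _
      (pdLT_of_degrees (by simp [mul_add, add_mul]; omega))
  · exact context_rel2_mem hS .id _ _ (pdLT_of_degrees (by simp [mul_add, add_mul]; omega))

/-- The composition is not resolved by the second and third identities: it equals a value of the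
fourth, which is why the fourth belongs to the system. -/
theorem comp_rel2_rel3 (u v : OpWord Z) :
    rel2 k (br Op.P u) v - mapLin k (fun x => x * v) (rel3 k u) ∈
      trivialMod PDLT (contexts Z) G (br Op.D (br Op.P u) * v) := by
  have e : rel2 k (br Op.P u) v - mapLin k (fun x => x * v) (rel3 k u) =
      mapLin k (fun x => x) (rel4 k u v) := by
    simp only [rel2, rel3, rel4, map_sub, map_add, mapLin_single]
    abel
  rw [e]
  have hv := degZ_pos v
  exact context_rel4_mem hS .id _ _ (pdLT_of_degrees (by simp [mul_add]; omega))

/-- Applying `D` to the Rota–Baxter relation and cancelling `D ∘ P` gives the required formula. -/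
theorem comp_rel4_rel3 (u v : OpWord Z) :
    rel4 k u (br Op.P v) - mapLin k (fun x => br Op.P u * x) (rel3 k v) ∈
      trivialMod PDLT (contexts Z) G (br Op.P u * br Op.D (br Op.P v)) := by
  have e : rel4 k u (br Op.P v) - mapLin k (fun x => br Op.P u * x) (rel3 k v) =
      -mapLin k (fun x => br Op.D x) (rel1 k u v) -
      mapLin k (fun x => x) (rel3 k (u * br Op.P v)) -
      mapLin k (fun x => x) (rel3 k (br Op.P u * v)) := by
    simp only [rel1, rel3, rel4, map_sub, mapLin_single]
    abel
  rw [e]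
  refine sub_mem (sub_mem (neg_mem ?_) ?_) ?_
  · exact context_rel1_mem hS (IsContext.id.br Op.D) _ _
      (pdLT_of_degrees (by simp [mul_add]; omega))
  · exact context_rel3_mem hS .id _ (pdLT_of_degrees (by simp [mul_add]; omega))
  · exact context_rel3_mem hS .id _ (pdLT_of_degrees (by simp [mul_add]; omega))

/-! ### Compositions inside an argument of an identity -/

section Families

variable {c : OpWord Z → OpWord Z} (hc : IsContext c) {g : FreeOmega k Z} (hg : g ∈ G)
  {m : OpWord Z} (hm : IsLeading PDLT g m)

include hc hg hm

theorem rel1_left_sub_mem (v : OpWord Z) : rel1 k (c m) v -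
    mapLin k (fun x => br Op.P (c x) * br Op.P v) (monic g m) ∈
      trivialMod PDLT (contexts Z) G (br Op.P (c m) * br Op.P v) :=
  family_sub_mem (F := fun u => rel1 k u v) (L := fun u => br Op.P u * br Op.P v)
    (r₁ := fun u => br Op.P (u * br Op.P v)) (r₂ := fun u => br Op.P (br Op.P u * v))
    (fun u => rel1_eq u v) (fun u => rel1_mem hS u v) ((IsContext.id.br _).mul_right _)
    ((IsContext.id.mul_right _).br _) (((IsContext.id.br _).mul_right _).br _)
    (fun u => lt_rel1_left u v) (fun u => lt_rel1_right u v) hc hg hm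

theorem rel1_right_sub_mem (u : OpWord Z) : rel1 k u (c m) -
    mapLin k (fun x => br Op.P u * br Op.P (c x)) (monic g m) ∈
      trivialMod PDLT (contexts Z) G (br Op.P u * br Op.P (c m)) :=
  family_sub_mem (F := fun v => rel1 k u v) (L := fun v => br Op.P u * br Op.P v)
    (r₁ := fun v => br Op.P (u * br Op.P v)) (r₂ := fun v => br Op.P (br Op.P u * v))
    (fun v => rel1_eq u v) (fun v => rel1_mem hS u v) ((IsContext.id.br _).mul_left _)
    (((IsContext.id.br _).mul_left _).br _) ((IsContext.id.mul_left _).br _)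
    (fun v => lt_rel1_left u v) (fun v => lt_rel1_right u v) hc hg hm

theorem rel2_left_sub_mem (v : OpWord Z) : rel2 k (c m) v -
    mapLin k (fun x => br Op.D (c x) * v) (monic g m) ∈
      trivialMod PDLT (contexts Z) G (br Op.D (c m) * v) :=
  family_sub_mem (F := fun u => rel2 k u v) (L := fun u => br Op.D u * v)
    (r₁ := fun u => u * br Op.D v) (r₂ := fun u => br Op.D (u * v))
    (fun u => rel2_eq u v) (fun u => rel2_mem hS u v) ((IsContext.id.br _).mul_right _)
    (IsContext.id.mul_right _) ((IsContext.id.mul_right _).br _)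
    (fun u => lt_rel2_left u v) (fun u => lt_rel2_right u v) hc hg hm

theorem rel2_right_sub_mem (u : OpWord Z) : rel2 k u (c m) -
    mapLin k (fun x => br Op.D u * c x) (monic g m) ∈
      trivialMod PDLT (contexts Z) G (br Op.D u * c m) :=
  family_sub_mem (F := fun v => rel2 k u v) (L := fun v => br Op.D u * v)
    (r₁ := fun v => u * br Op.D v) (r₂ := fun v => br Op.D (u * v))
    (fun v => rel2_eq u v) (fun v => rel2_mem hS u v) (IsContext.id.mul_left _)
    ((IsContext.id.br _).mul_left _) ((IsContext.id.mul_left _).br _)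
    (fun v => lt_rel2_left u v) (fun v => lt_rel2_right u v) hc hg hm

theorem rel3_sub_mem : rel3 k (c m) - mapLin k (fun x => br Op.D (br Op.P (c x))) (monic g m) ∈
    trivialMod PDLT (contexts Z) G (br Op.D (br Op.P (c m))) :=
  family_sub_mem (F := fun u => rel3 k u) (L := fun u => br Op.D (br Op.P u))
    (r₁ := fun u => u) (r₂ := fun u => u) (fun u => rel3_eq u) (fun u => rel3_mem hS u)
    ((IsContext.id.br _).br _) .id .id (fun u => lt_rel3 u) (fun u => lt_rel3 u) hc hg hm

theorem rel4_left_sub_mem (v : OpWord Z) : rel4 k (c m) v -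
    mapLin k (fun x => br Op.P (c x) * br Op.D v) (monic g m) ∈
      trivialMod PDLT (contexts Z) G (br Op.P (c m) * br Op.D v) :=
  family_sub_mem (F := fun u => rel4 k u v) (L := fun u => br Op.P u * br Op.D v)
    (r₁ := fun u => br Op.D (br Op.P u * v)) (r₂ := fun u => u * v)
    (fun u => rel4_eq u v) (fun u => rel4_mem hS u v) ((IsContext.id.br _).mul_right _)
    (((IsContext.id.br _).mul_right _).br _) (IsContext.id.mul_right _)
    (fun u => lt_rel4_left u v) (fun u => lt_rel4_right u v) hc hg hm

theorem rel4_right_sub_mem (u : OpWord Z) : rel4 k u (c m) -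
    mapLin k (fun x => br Op.P u * br Op.D (c x)) (monic g m) ∈
      trivialMod PDLT (contexts Z) G (br Op.P u * br Op.D (c m)) :=
  family_sub_mem (F := fun v => rel4 k u v) (L := fun v => br Op.P u * br Op.D v)
    (r₁ := fun v => br Op.D (br Op.P u * v)) (r₂ := fun v => u * v)
    (fun v => rel4_eq u v) (fun v => rel4_mem hS u v) ((IsContext.id.br _).mul_left _)
    ((IsContext.id.mul_left _).br _) (IsContext.id.mul_left _)
    (fun v => lt_rel4_left u v) (fun v => lt_rel4_right u v) hc hg hm

end Families

end Compositions

end DRB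

end

noncomputable section

namespace DRB

open OpWord

/-! ### The Gröbner–Shirshov basis -/

section GSBasis

variable {k : Type v} [Field k] {Z : Type u}

theorem monic_incl (f : MonoidAlgebra k (FreeSemigroup Z)) (m : FreeSemigroup Z) :
    monic (incl k Z f) (inclWord Z m) = incl k Z (monic f m) := by
  rw [monic, coeff_incl, map_smul]

variable [LinearOrder Z]
  {G : Set (MonoidAlgebra k (FreeSemigroup Z))}

/-- The elements of `S_OdRB(Z) ∪ G` together with their leading monomials. -/
inductive IsRule (G : Set (MonoidAlgebra k (FreeSemigroup Z))) : FreeOmega k Z → OpWord Z → Prop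
  | rel1 (u v : OpWord Z) : IsRule G (rel1 k u v) (br Op.P u * br Op.P v)
  | rel2 (u v : OpWord Z) : IsRule G (rel2 k u v) (br Op.D u * v)
  | rel3 (u : OpWord Z) : IsRule G (rel3 k u) (br Op.D (br Op.P u))
  | rel4 (u v : OpWord Z) : IsRule G (rel4 k u v) (br Op.P u * br Op.D v)
  | incl {f : MonoidAlgebra k (FreeSemigroup Z)} {m : FreeSemigroup Z} (hf : f ∈ G)
      (hm : IsLeading SemigroupDlexLT f m) : IsRule G (incl k Z f) (inclWord Z m)

variable (G) in
/-- The set `S_OdRB(Z) ∪ G`. -/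
abbrev relSet : Set (FreeOmega k Z) := valuesOPIs (OdRB k) Z ∪ incl k Z '' G

theorem IsRule.of_br {g : FreeOmega k Z} {ω : Op} {x : OpWord Z} (h : IsRule G g (br ω x)) :
    ω = Op.D ∧ ∃ u, x = br Op.P u ∧ g = DRB.rel3 k u := by
  generalize hm : br ω x = m at h
  cases h with
  | rel1 u v => simp [br_mul] at hm
  | rel2 u v => simp [br_mul] at hm
  | rel3 u =>
    rw [br.injEq] at hm
    exact ⟨hm.1, u, hm.2, rfl⟩
  | rel4 u v => simp [br_mul] at hm
  | @incl f m => exact (inclWord_ne_br m ω x hm.symm).elim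

theorem IsRule.of_D_mul {g : FreeOmega k Z} {u v : OpWord Z} (h : IsRule G g (br Op.D u * v)) :
    g = DRB.rel2 k u v := by
  generalize hm : br Op.D u * v = m at h
  cases h with
  | rel1 u v => simp [br_mul] at hm
  | rel2 u v =>
    simp only [br_mul, brCons.injEq, true_and] at hm
    rw [hm.1, hm.2]
  | rel3 u => simp [br_mul] at hm
  | rel4 u v => simp [br_mul] at hm
  | @incl f m =>
    exact (inclWord_mul_ne m 1 Op.D u v (by rw [mul_one, ← WithOne.coe_mul, hm])).elim

theorem IsRule.of_P_mul {g : FreeOmega k Z} {u w : OpWord Z} (h : IsRule G g (br Op.P u * w)) :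
    (∃ v, w = br Op.P v ∧ g = DRB.rel1 k u v) ∨ ∃ v, w = br Op.D v ∧ g = DRB.rel4 k u v := by
  generalize hm : br Op.P u * w = m at h
  cases h with
  | rel1 u v =>
    simp only [br_mul, brCons.injEq, true_and] at hm
    obtain ⟨rfl, rfl⟩ := hm
    exact .inl ⟨v, rfl, rfl⟩
  | rel2 u v => simp [br_mul] at hm
  | rel3 u => simp [br_mul] at hm
  | rel4 u v =>
    simp only [br_mul, brCons.injEq, true_and] at hm
    obtain ⟨rfl, rfl⟩ := hm
    exact .inr ⟨v, rfl, rfl⟩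
  | @incl f m =>
    exact (inclWord_mul_ne m 1 Op.P u w (by rw [mul_one, ← WithOne.coe_mul, hm])).elim

theorem IsRule.of_letters {g : FreeOmega k Z} {m : OpWord Z} (h : IsRule G g m)
    {r : FreeSemigroup Z} {a : WithOne (OpWord Z)}
    (hm : (m : WithOne (OpWord Z)) = inclWord Z r * a) : ∃ f ∈ G, ∃ m₀,
      g = DRB.incl k Z f ∧ m = inclWord Z m₀ ∧ IsLeading SemigroupDlexLT f m₀ := by
  cases h with
  | rel1 u v => exact (inclWord_mul_ne r a Op.P u (br Op.P v) (by rw [← hm, WithOne.coe_mul])).elim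
  | rel2 u v => exact (inclWord_mul_ne r a Op.D u v (by rw [← hm, WithOne.coe_mul])).elim
  | rel3 u => exact (inclWord_mul_ne r a Op.D (br Op.P u) 1 (by rw [← hm, mul_one])).elim
  | rel4 u v => exact (inclWord_mul_ne r a Op.P u (br Op.D v) (by rw [← hm, WithOne.coe_mul])).elim
  | @incl f m₀ hf hm₀ => exact ⟨f, hf, m₀, rfl, rfl, hm₀⟩

variable [WellFoundedLT Z]

theorem isRule_iff {f : FreeOmega k Z} {m : OpWord Z} :
    IsRule G f m ↔ f ∈ relSet G ∧ IsLeading PDLT f m := by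
  constructor
  · rintro (⟨u, v⟩ | ⟨u, v⟩ | u | ⟨u, v⟩ | ⟨hf, hm⟩)
    · exact ⟨rel1_mem Set.subset_union_left u v, (isLeading_rel1 u v).1⟩
    · exact ⟨rel2_mem Set.subset_union_left u v, (isLeading_rel2 u v).1⟩
    · exact ⟨rel3_mem Set.subset_union_left u, (isLeading_rel3 u).1⟩
    · exact ⟨rel4_mem Set.subset_union_left u v, (isLeading_rel4 u v).1⟩
    · exact ⟨.inr ⟨_, hf, rfl⟩, isLeading_incl hm⟩
  · rintro ⟨hf | ⟨f, hf, rfl⟩, hm⟩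
    · obtain ⟨u, v, rfl | rfl | rfl | rfl⟩ := mem_valuesOPIs.1 hf
      · rw [hm.unique (isLeading_rel1 u v).1]; exact .rel1 u v
      · rw [hm.unique (isLeading_rel2 u v).1]; exact .rel2 u v
      · rw [hm.unique (isLeading_rel3 u).1]; exact .rel3 u
      · rw [hm.unique (isLeading_rel4 u v).1]; exact .rel4 u v
    · obtain ⟨m₀, rfl, hm₀⟩ := exists_isLeading_of_incl hm
      exact .incl hf hm₀

theorem monic_rel1 (u v : OpWord Z) : monic (rel1 k u v) (br Op.P u * br Op.P v) = rel1 k u v := by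
  rw [monic, (isLeading_rel1 u v).2, inv_one, one_smul]

theorem monic_rel2 (u v : OpWord Z) : monic (rel2 k u v) (br Op.D u * v) = rel2 k u v := by
  rw [monic, (isLeading_rel2 u v).2, inv_one, one_smul]

theorem monic_rel3 (u : OpWord Z) : monic (rel3 k u) (br Op.D (br Op.P u)) = rel3 k u := by
  rw [monic, (isLeading_rel3 u).2, inv_one, one_smul]

theorem monic_rel4 (u v : OpWord Z) : monic (rel4 k u v) (br Op.P u * br Op.D v) = rel4 k u v := by
  rw [monic, (isLeading_rel4 u v).2, inv_one, one_smul]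

/-- Contexts extend to bracketed words and the two orders agree on letters, so a resolution found in
`k𝒮(Z)` remains valid in `k𝔖(Z)`. -/
theorem incl_mem_trivialMod {p : FreeSemigroup Z} {h : MonoidAlgebra k (FreeSemigroup Z)}
    (hh : h ∈ trivialMod SemigroupDlexLT (semigroupContexts Z) G p) :
    incl k Z h ∈ trivialMod PDLT (contexts Z) (relSet G) (inclWord Z p) := by
  refine map_mem_trivialMod (mapLin k (inclWord Z)) (fun c hc s hs m hm hp => ?_) hh
  obtain ⟨c', hc', hcc⟩ := exists_context_extending hc
  have e : mapLin k (inclWord Z) (mapLin k c s) = mapLin k c' (incl k Z s) := by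
    rw [incl_apply]
    exact congrArg (· s) (linearMap_ext (L := mapLin k (inclWord Z) ∘ₗ mapLin k c)
      (L' := mapLin k c' ∘ₗ mapLin k (inclWord Z)) fun m => by simp [mapLin_single, hcc])
  rw [e]
  exact mapLin_mem_trivialMod hc' (.inr ⟨s, hs, rfl⟩) (isLeading_incl hm)
    (by rw [hcc]; exact (pdLT_inclWord _ _).2 hp)

/-- The intersection compositions are trivial. -/
theorem intersection_mem (hG : IsGS SemigroupDlexLT (semigroupContexts Z) FreeSemigroup.length G)
    {f g : FreeOmega k Z} {mf mg a b : OpWord Z} (hf : IsRule G f mf) (hg : IsRule G g mg)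
    (h : mf * a = b * mg) (hlt : breadth (mf * a) < breadth mf + breadth mg) :
    monic f mf * mono k a - mono k b * monic g mg ∈
      trivialMod PDLT (contexts Z) (relSet G) (mf * a) := by
  have hS : valuesOPIs (OdRB k) Z ⊆ relSet G := Set.subset_union_left
  obtain ⟨r, hr, hr'⟩ := exists_overlap h hlt
  -- A leading word of two atoms can overlap only in its second atom.
  have atom {x y : OpWord Z} (hx : breadth x = 1) (hy : breadth y = 1) (h : x * y = b * r) :
      x = b ∧ y = r := by
    have hb := breadth_pos b
    have hr := breadth_pos r
    have h' := congrArg breadth h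
    rw [breadth_mul, breadth_mul, hx, hy] at h'
    rw [← WithOne.coe_inj, WithOne.coe_mul, WithOne.coe_mul] at h
    obtain ⟨h1, h2⟩ := atom_mul_cancel hx (by omega) h
    exact ⟨h1, WithOne.coe_inj.1 h2⟩
  cases hf with
  | rel1 u v =>
    obtain ⟨rfl, rfl⟩ := atom rfl rfl hr
    subst hr'
    rcases hg.of_P_mul with ⟨w, rfl, rfl⟩ | ⟨w, rfl, rfl⟩
    · rw [monic_rel1, monic_rel1]
      exact comp_rel1_rel1 hS u v w
    · rw [monic_rel1, monic_rel4]
      exact comp_rel1_rel4 hS u v w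
  | rel2 u m =>
    -- The overlap begins after the atom `D(u)`, so the other leading word is a suffix of `m a`.
    -- Enlarging the second argument from `m` to `m a` turns the overlap into a composition inside
    -- an argument.
    obtain ⟨c, hc, hm, hcb⟩ : ∃ c, IsContext c ∧ m * a = c mg ∧ ∀ x, br Op.D u * c x = b * x := by
      have hr2 := hr
      rw [← WithOne.coe_inj, WithOne.coe_mul, WithOne.coe_mul] at hr2
      obtain ⟨t, ⟨h1, h2⟩ | ⟨h1, h2⟩⟩ := levi hr2
      · rcases atom_eq_mul rfl h1 with ⟨h3, -⟩ | ⟨h3, rfl⟩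
        · exact (WithOne.coe_ne_one h3).elim
        · rw [WithOne.coe_inj] at h3
          rw [one_mul, WithOne.coe_inj] at h2
          exact ⟨_, .id, by rw [← h2, hr'], fun x => by rw [h3]⟩
      · cases t with
        | one =>
          rw [mul_one, WithOne.coe_inj] at h1
          rw [one_mul, WithOne.coe_inj] at h2
          exact ⟨_, .id, by rw [h2, hr'], fun x => by rw [h1]⟩
        | coe t =>
          rw [← WithOne.coe_mul, WithOne.coe_inj] at h1 h2
          exact ⟨_, IsContext.id.mul_left t, by rw [h2, hr', mul_assoc],
            fun x => by rw [h1, mul_assoc]⟩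
    have hgr := isRule_iff.1 hg
    have h1 := comp_rel2_rel2 hS u m a
    have h2 := rel2_right_sub_mem hS hc hgr.1 hgr.2 u
    rw [← hm, ← mul_assoc, funext hcb, mapLin_mul_left] at h2
    rw [monic_rel2]
    simpa using add_mem h1 h2
  | rel3 u =>
    exfalso
    have hb := breadth_pos b
    have hr2 := breadth_pos r
    have := congrArg breadth hr
    rw [breadth_mul, OpWord.breadth_br] at this
    omega
  | rel4 u v =>
    obtain ⟨rfl, rfl⟩ := atom rfl rfl hr
    subst hr'
    obtain rfl := hg.of_D_mul
    rw [monic_rel4, monic_rel2]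
    exact comp_rel4_rel2 hS u v a
  | @incl f m hfG hmf =>
    have hbr := brackets_inclWord m
    rw [hr, brackets_mul, add_eq_zero] at hbr
    obtain ⟨b, rfl⟩ := exists_inclWord hbr.1
    obtain ⟨r, rfl⟩ := exists_inclWord hbr.2
    -- The common part consists of letters, so the second leading word begins with a letter; only
    -- elements of `G` have such leading words.
    obtain ⟨g, hgG, m', rfl, rfl, hmg⟩ := hg.of_letters (by rw [hr', WithOne.coe_mul])
    have hbr' := brackets_inclWord m'
    rw [hr', brackets_mul, add_eq_zero] at hbr'
    obtain ⟨a, rfl⟩ := exists_inclWord hbr'.2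
    rw [← map_mul] at h hlt hr hr' ⊢
    rw [← map_mul] at h
    have hpos (x : FreeSemigroup Z) : 0 < x.length := Nat.succ_pos _
    have hb := hpos b
    have ha := hpos a
    have hrp := hpos r
    have hm1 := congrArg FreeSemigroup.length (inclWord_injective hr)
    have hm2 := congrArg FreeSemigroup.length (inclWord_injective hr')
    rw [FreeSemigroup.length_mul] at hm1 hm2
    have := incl_mem_trivialMod ((hG f hfG g hgG m m' hmf hmg).1 (m * a) a b rfl
      (inclWord_injective h) (by rw [FreeSemigroup.length_mul]; omega)
      (by rw [FreeSemigroup.length_mul]; omega))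
    have hs (x : FreeSemigroup Z) : incl k Z (MonoidAlgebra.single x 1) = mono k (inclWord Z x) :=
      mapLin_single ..
    rw [map_sub, map_mul (incl k Z), map_mul (incl k Z), hs, hs] at this
    rw [monic_incl, monic_incl]
    exact this

/-- The inclusion compositions are trivial. -/
theorem inclusion_mem (hG : IsGS SemigroupDlexLT (semigroupContexts Z) FreeSemigroup.length G)
    {f g : FreeOmega k Z} {mf mg : OpWord Z} (hf : IsRule G f mf) (hg : IsRule G g mg)
    {c : OpWord Z → OpWord Z} (hc : IsContext c) (h : mf = c mg) :
    monic f mf - mapLin k c (monic g mg) ∈ trivialMod PDLT (contexts Z) (relSet G) mf := by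
  have hS : valuesOPIs (OdRB k) Z ⊆ relSet G := Set.subset_union_left
  have hgr := isRule_iff.1 hg
  -- No rule has a single `P`-bracket as leading word, so an occurrence within `P(u)` lies within
  -- `u`.
  have P_ne {u : OpWord Z} {c' : OpWord Z → OpWord Z} (hc' : IsContext c') (h : br Op.P u = c' mg) :
      ∃ c'', IsContext c'' ∧ u = c'' mg ∧ c' = fun x => br Op.P (c'' x) := by
    rcases hc'.eq_atom rfl h with ⟨rfl, -⟩ | ⟨ω, c'', hc'', e, h'⟩
    · exact absurd hg.of_br.1 (by simp)
    · rw [br.injEq] at e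
      obtain ⟨rfl, rfl⟩ := e
      exact ⟨c'', hc'', rfl, funext h'⟩
  have no_split {x t b : OpWord Z} (hx : breadth x = 1) (h : x = t * b) : False := by
    have ht := breadth_pos t
    have hb := breadth_pos b
    rw [h, breadth_mul] at hx
    omega
  cases hf with
  | rel1 u v =>
    rw [monic_rel1]
    rcases hc.eq_atom_mul rfl h with ⟨c', hc', e, h'⟩ | ⟨c', hc', e, h'⟩ | ⟨rfl, h'⟩ |
      ⟨t, b, -, e, -⟩
    · obtain ⟨c₁, hc₁, rfl, rfl⟩ := P_ne hc' e
      rw [funext h']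
      exact rel1_left_sub_mem hS hc₁ hgr.1 hgr.2 v
    · obtain ⟨c₁, hc₁, rfl, rfl⟩ := P_ne hc' e
      rw [funext h']
      exact rel1_right_sub_mem hS hc₁ hgr.1 hgr.2 u
    · rcases hg.of_P_mul with ⟨w, e, rfl⟩ | ⟨w, e, rfl⟩
      · rw [br.injEq] at e
        obtain ⟨-, rfl⟩ := e
        rw [monic_rel1, funext h', mapLin_id, sub_self]
        exact zero_mem _
      · simp at e
    · exact (no_split rfl e).elim
  | rel2 u v =>
    rw [monic_rel2]
    rcases hc.eq_atom_mul rfl h with ⟨c', hc', e, h'⟩ | ⟨c', hc', e, h'⟩ | ⟨rfl, h'⟩ |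
      ⟨t, b, rfl, rfl, h'⟩
    · rcases hc'.eq_atom rfl e with ⟨rfl, h''⟩ | ⟨ω, c'', hc'', e, h''⟩
      · obtain ⟨-, w, rfl, rfl⟩ := hg.of_br
        obtain rfl : c = fun x => x * v := funext fun x => by rw [h', h'']
        rw [monic_rel3]
        exact comp_rel2_rel3 hS w v
      · rw [br.injEq] at e
        obtain ⟨rfl, rfl⟩ := e
        obtain rfl : c = fun x => br Op.D (c'' x) * v := funext fun x => by rw [h', h'']
        exact rel2_left_sub_mem hS hc'' hgr.1 hgr.2 v
    · subst e
      rw [funext h']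
      exact rel2_right_sub_mem hS hc' hgr.1 hgr.2 u
    · obtain rfl := hg.of_D_mul
      rw [monic_rel2, funext h', mapLin_id, sub_self]
      exact zero_mem _
    -- The remaining position is the prefix `D(u)t` of `D(u)tb`: two uses of the Leibniz rule with
    -- different second arguments.
    · obtain rfl := hg.of_D_mul
      rw [monic_rel2, funext h', mapLin_mul_right, ← neg_mem_iff, neg_sub, ← mul_assoc]
      exact comp_rel2_rel2 hS u t b
  | rel3 u =>
    rw [monic_rel3]
    rcases hc.eq_atom rfl h with ⟨rfl, h'⟩ | ⟨ω, c', hc', e, h'⟩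
    · obtain ⟨-, w, e, rfl⟩ := hg.of_br
      rw [br.injEq] at e
      obtain ⟨-, rfl⟩ := e
      rw [monic_rel3, funext h', mapLin_id, sub_self]
      exact zero_mem _
    · rw [br.injEq] at e
      obtain ⟨rfl, e⟩ := e
      obtain ⟨c₁, hc₁, rfl, rfl⟩ := P_ne hc' e
      rw [funext h']
      exact rel3_sub_mem hS hc₁ hgr.1 hgr.2
  | rel4 u v =>
    rw [monic_rel4]
    rcases hc.eq_atom_mul rfl h with ⟨c', hc', e, h'⟩ | ⟨c', hc', e, h'⟩ | ⟨rfl, h'⟩ |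
      ⟨t, b, -, e, -⟩
    · obtain ⟨c₁, hc₁, rfl, rfl⟩ := P_ne hc' e
      rw [funext h']
      exact rel4_left_sub_mem hS hc₁ hgr.1 hgr.2 v
    · rcases hc'.eq_atom rfl e with ⟨rfl, h''⟩ | ⟨ω, c'', hc'', e, h''⟩
      · obtain ⟨-, w, rfl, rfl⟩ := hg.of_br
        obtain rfl : c = fun x => br Op.P u * x := funext fun x => by rw [h', h'']
        rw [monic_rel3]
        exact comp_rel4_rel3 hS u w
      · rw [br.injEq] at e
        obtain ⟨rfl, rfl⟩ := e
        obtain rfl : c = fun x => br Op.P u * br Op.D (c'' x) := funext fun x => by rw [h', h'']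
        exact rel4_right_sub_mem hS hc'' hgr.1 hgr.2 u
    · rcases hg.of_P_mul with ⟨w, e, rfl⟩ | ⟨w, e, rfl⟩
      · simp at e
      · rw [br.injEq] at e
        obtain ⟨-, rfl⟩ := e
        rw [monic_rel4, funext h', mapLin_id, sub_self]
        exact zero_mem _
    · exact (no_split rfl e).elim
  | @incl f m hfG hmf =>
    have hbr := brackets_le_of_isContext hc mg
    rw [← h, brackets_inclWord, Nat.le_zero] at hbr
    obtain ⟨r, rfl⟩ := exists_inclWord hbr
    obtain ⟨g, hgG, m', rfl, hm', hmg⟩ := hg.of_letters (a := 1) (mul_one _).symm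
    obtain rfl := inclWord_injective hm'
    obtain ⟨c₀, hc₀, rfl, hcc⟩ := exists_context_restricting hc h
    have := incl_mem_trivialMod ((hG f hfG g hgG _ _ hmf hmg).2 c₀ hc₀ rfl)
    rw [map_sub] at this
    rw [monic_incl, monic_incl]
    convert this using 2
    rw [incl_apply, incl_apply]
    exact congrArg (· (monic g r)) (linearMap_ext (L := mapLin k c ∘ₗ mapLin k (inclWord Z))
      (L' := mapLin k (inclWord Z) ∘ₗ mapLin k c₀) fun m => by simp [mapLin_single, hcc])

theorem isGS_relSet (hG : IsGS SemigroupDlexLT (semigroupContexts Z) FreeSemigroup.length G) :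
    IsGS PDLT (contexts Z) breadth (relSet G) := by
  intro f hf g hg mf mg hmf hmg
  have hf' := isRule_iff.2 ⟨hf, hmf⟩
  have hg' := isRule_iff.2 ⟨hg, hmg⟩
  constructor
  · rintro p a b rfl h - hlt
    exact intersection_mem hG hf' hg' h hlt
  · intro c hc h
    exact inclusion_mem hG hf' hg' (mem_contexts.1 hc) h

theorem isGS_valuesOPIs : IsGS PDLT (contexts Z) breadth (valuesOPIs (OdRB k) Z) := by
  have := isGS_relSet (k := k) (Z := Z) (G := ∅) fun f hf => hf.elim
  rwa [relSet, Set.image_empty, Set.union_empty] at this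

theorem irr_relSet : Irr PDLT (contexts Z) (relSet G) =
    {x | ∃ c ∈ contexts Z,
      (∃ s ∈ G, ∃ m, IsLeading SemigroupDlexLT s m ∧ x = c (inclWord Z m)) ∨
      ∃ a b : OpWord Z,
        x = c (br Op.P a * br Op.P b) ∨ x = c (br Op.D a * b) ∨
        x = c (br Op.D (br Op.P a)) ∨ x = c (br Op.P a * br Op.D b)}ᶜ := by
  rw [Irr]
  congr 1
  ext x
  constructor
  · rintro ⟨c, hc, s, hs, m, hm, rfl⟩
    refine ⟨c, hc, ?_⟩
    cases isRule_iff.2 ⟨hs, hm⟩ with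
    | rel1 u v => exact .inr ⟨u, v, .inl rfl⟩
    | rel2 u v => exact .inr ⟨u, v, .inr (.inl rfl)⟩
    | rel3 u => exact .inr ⟨u, u, .inr (.inr (.inl rfl))⟩
    | rel4 u v => exact .inr ⟨u, v, .inr (.inr (.inr rfl))⟩
    | @incl f m₀ hf hm₀ => exact .inl ⟨f, hf, m₀, hm₀, rfl⟩
  · have key {f : FreeOmega k Z} {m : OpWord Z} (c : OpWord Z → OpWord Z) (hc : c ∈ contexts Z)
        (h : IsRule G f m) : ∃ c' ∈ contexts Z, ∃ s ∈ relSet G, ∃ m', IsLeading PDLT s m' ∧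
          c m = c' m' :=
      ⟨c, hc, f, (isRule_iff.1 h).1, m, (isRule_iff.1 h).2, rfl⟩
    rintro ⟨c, hc, ⟨s, hs, m, hm, rfl⟩ | ⟨a, b, rfl | rfl | rfl | rfl⟩⟩
    · exact key c hc (.incl hs hm)
    · exact key c hc (.rel1 a b)
    · exact key c hc (.rel2 a b)
    · exact key c hc (.rel3 a)
    · exact key c hc (.rel4 a b)

end GSBasis

end DRB

end

noncomputable section

namespace DRB

open OpWord

/-! ### Generated ideals -/

section Ideals

variable {k : Type v} [Field k]

section General

variable {A : Type w} [NonUnitalRing A] [Module k A]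

theorem subset_algIdealSpan (S : Set A) : S ⊆ algIdealSpan k S := fun _ hx =>
  (Submodule.mem_sInf).2 fun _ hI => hI.2 hx

theorem algIdealSpan_le {S : Set A} {I : Submodule k A} (hI : IsAlgIdeal k I) (h : S ⊆ I) :
    algIdealSpan k S ≤ I := sInf_le ⟨hI, h⟩

variable [OmegaAlgebra k A]

theorem OmegaIdeal.ext_toSubmodule {I J : OmegaIdeal k A} (h : I.toSubmodule = J.toSubmodule) :
    I = J := by
  cases I
  cases J
  cases h
  rfl

theorem subset_omegaSpan (S : Set A) : S ⊆ (omegaSpan k S).toSubmodule := by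
  intro x hx
  refine (Submodule.mem_sInf).2 ?_
  rintro _ ⟨J, rfl, hJ⟩
  exact hJ hx

theorem omegaSpan_le {S : Set A} {J : OmegaIdeal k A} (h : S ⊆ J.toSubmodule) :
    (omegaSpan k S).toSubmodule ≤ J.toSubmodule := sInf_le ⟨J, rfl, h⟩

theorem OmegaIdeal.toQuot_eq_zero (I : OmegaIdeal k A) {a : A} :
    I.toQuot a = 0 ↔ a ∈ I.toSubmodule := by
  rw [← map_zero I.toQuot, I.toQuot_eq_iff, sub_zero]

/-- The quotient map as a homomorphism of algebras. -/
def OmegaIdeal.toQuotHom (I : OmegaIdeal k A) : A →ₙₐ[k] I.Quot where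
  toFun := I.toQuot
  map_smul' := map_smul I.toQuot
  map_zero' := map_zero I.toQuot
  map_add' := map_add I.toQuot
  map_mul' := I.toQuot_mul

end General

variable {Z : Type u}

theorem mapLin_mem_contextSpan {S : Set (FreeOmega k Z)} {d : OpWord Z → OpWord Z}
    (hd : IsContext d) {f : FreeOmega k Z} (hf : f ∈ contextSpan (contexts Z) S) :
    mapLin k d f ∈ contextSpan (contexts Z) S := by
  have : contextSpan (contexts Z) S ≤ (contextSpan (contexts Z) S).comap (mapLin k d) := by
    refine Submodule.span_le.2 ?_
    rintro _ ⟨c, hc, s, hs, rfl⟩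
    exact Submodule.subset_span
      ⟨_, mem_contexts.2 (hd.comp (mem_contexts.1 hc)), s, hs, mapLin_mapLin ..⟩
  exact this hf

/-- The span of the elements `q|_s` with `s ∈ S` as an `Ω`-ideal. -/
def contextIdeal (S : Set (FreeOmega k Z)) : OmegaIdeal k (FreeOmega k Z) where
  toSubmodule := contextSpan (contexts Z) S
  isAlgIdeal a x hx := by
    induction a using MonoidAlgebra.induction_linear with
    | zero => simp
    | add f g hf hg =>
      rw [add_mul, mul_add]
      exact ⟨add_mem hf.1 hg.1, add_mem hf.2 hg.2⟩
    | single m r =>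
      have e : MonoidAlgebra.single m r = r • mono k m := by simp
      rw [e, smul_mul_assoc, mul_smul_comm, ← mapLin_mul_left, ← mapLin_mul_right]
      exact ⟨Submodule.smul_mem _ _ (mapLin_mem_contextSpan (IsContext.id.mul_left m) hx),
        Submodule.smul_mem _ _ (mapLin_mem_contextSpan (IsContext.id.mul_right m) hx)⟩
  op_mem ω x hx := mapLin_mem_contextSpan (IsContext.id.br ω) hx

/-- The span of the `q|_s` is itself an `Ω`-ideal, and conversely every context is a composite of
operations under which an `Ω`-ideal is stable. This connects the quotient with the diamond lemma. -/
theorem omegaSpan_toSubmodule (S : Set (FreeOmega k Z)) :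
    (omegaSpan k S).toSubmodule = contextSpan (contexts Z) S := by
  refine le_antisymm (omegaSpan_le (J := contextIdeal S) fun s hs =>
    Submodule.subset_span ⟨_, mem_contexts.2 .id, s, hs, (mapLin_id s).symm⟩)
    (Submodule.span_le.2 ?_)
  rintro _ ⟨c, hc, s, hs, rfl⟩
  refine IsContext.induct (motive := fun c => mapLin k c s ∈ (omegaSpan k S).toSubmodule)
    ?_ (fun c a ih => ?_) (fun c b ih => ?_) (fun c ω ih => ?_) (mem_contexts.1 hc)
  · rw [mapLin_id]
    exact subset_omegaSpan S hs
  · have := ((omegaSpan k S).isAlgIdeal (mono k a) _ ih).1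
    rwa [← mapLin_mul_left, mapLin_mapLin] at this
  · have := ((omegaSpan k S).isAlgIdeal (mono k b) _ ih).2
    rwa [← mapLin_mul_right, mapLin_mapLin] at this
  · have := (omegaSpan k S).op_mem ω _ ih
    rwa [op_apply, mapLin_mapLin] at this

variable {A : Type w} [NonUnitalRing A] [Module k A]
  (π : MonoidAlgebra k (FreeSemigroup Z) →ₙₐ[k] A)

theorem omegaSpan_relSet {G : Set (MonoidAlgebra k (FreeSemigroup Z))}
    (hG : ∀ f, f ∈ algIdealSpan k G ↔ π f = 0) : omegaSpan k (relSet G) = relIdeal π := by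
  refine OmegaIdeal.ext_toSubmodule (le_antisymm (omegaSpan_le ?_) (omegaSpan_le ?_))
  · refine Set.Subset.trans ?_ (subset_omegaSpan _)
    exact Set.union_subset_union_right _ (Set.image_mono fun f hf =>
      (hG f).1 (subset_algIdealSpan G hf))
  · refine Set.union_subset (Set.subset_union_left.trans (subset_omegaSpan _)) ?_
    rintro _ ⟨f, hf, rfl⟩
    have hle : algIdealSpan k G ≤
        (omegaSpan k (relSet G)).toSubmodule.comap (mapLin k (inclWord Z)) := by
      refine algIdealSpan_le (fun a x hx => ?_) fun g hg => ?_
      · have := (omegaSpan k (relSet G)).isAlgIdeal (incl k Z a) (incl k Z x) hx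
        rwa [← map_mul, ← map_mul] at this
      · exact subset_omegaSpan _ (.inr ⟨g, hg, rfl⟩)
    exact hle ((hG f).2 hf)

end Ideals

/-! ### The free differential Rota–Baxter algebra -/

section Free

variable {k : Type v} [Field k] {Z : Type u}

/-- The ideal is only assumed to contain values at words; multilinearity of the identities extends
the vanishing to all elements of the quotient. -/
theorem isDiffRB_quot {I : OmegaIdeal k (FreeOmega k Z)}
    (hI : valuesOPIs (OdRB k) Z ⊆ I.toSubmodule) : IsDiffRB k 0 I.Quot := by
  have rel {f : FreeOmega k Z} (hf : f ∈ valuesOPIs (OdRB k) Z) : I.toQuot f = 0 :=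
    I.toQuot_eq_zero.2 (hI hf)
  have hsingle (m : OpWord Z) (c : k) :
      I.toQuot (MonoidAlgebra.single m c) = c • I.toQuot (mono k m) := by
    rw [← map_smul]; simp
  -- Each two-variable identity becomes the vanishing of a bilinear map, which can be tested on
  -- classes of words.
  have bilin {T : I.Quot →ₗ[k] I.Quot →ₗ[k] I.Quot}
      (h : ∀ a b : OpWord Z, T (I.toQuot (mono k a)) (I.toQuot (mono k b)) = 0) : T = 0 := by
    refine LinearMap.ext₂ fun x y => ?_
    change T x y = 0
    obtain ⟨f, rfl⟩ := I.toQuot_surjective x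
    obtain ⟨g, rfl⟩ := I.toQuot_surjective y
    induction f using MonoidAlgebra.induction_linear with
    | zero => simp
    | add f f' hf hf' => rw [map_add, map_add, LinearMap.add_apply, hf, hf', add_zero]
    | single m c =>
      induction g using MonoidAlgebra.induction_linear with
      | zero => simp
      | add g g' hg hg' => rw [map_add, map_add, hg, hg', add_zero]
      | single m' c' =>
        rw [hsingle m, hsingle m', map_smul, map_smul, LinearMap.smul_apply, h,
          smul_zero, smul_zero]
  have hmul (a b : OpWord Z) :
      I.toQuot (mono k (a * b)) = I.toQuot (mono k a) * I.toQuot (mono k b) := by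
    rw [← mono_mul, I.toQuot_mul]
  have hbr (ω : Op) (a : OpWord Z) :
      I.toQuot (mono k (br ω a)) = OmegaAlgebra.op (k := k) ω (I.toQuot (mono k a)) := by
    rw [← op_mono, I.toQuot_op]
  let μ : I.Quot →ₗ[k] I.Quot →ₗ[k] I.Quot := LinearMap.mul k I.Quot
  refine ⟨fun a b => ?_, fun a b => ?_, fun a => ?_⟩
  · have := bilin (T := μ.compl₁₂ (opD k) LinearMap.id + μ.compl₁₂ LinearMap.id (opD k) -
      μ.compr₂ (opD k)) fun a b => by
        have := rel (mem_valuesOPIs.2 ⟨a, b, .inr (.inl rfl)⟩)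
        simp only [rel2, map_sub, map_add, hmul, hbr] at this
        exact this
    have := congr($this a b)
    rw [zero_smul, add_zero]
    exact (sub_eq_zero.1 this).symm
  · have := bilin (T := μ.compl₁₂ (opP k) (opP k) -
      (μ.compl₁₂ LinearMap.id (opP k)).compr₂ (opP k) -
      (μ.compl₁₂ (opP k) LinearMap.id).compr₂ (opP k)) fun a b => by
        have := rel (mem_valuesOPIs.2 ⟨a, b, .inl rfl⟩)
        simp only [rel1, map_sub, hmul, hbr] at this
        exact this
    have := congr($this a b)
    rw [zero_smul, add_zero]
    exact sub_eq_zero.1 ((sub_sub _ _ _).symm.trans this)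
  · obtain ⟨f, rfl⟩ := I.toQuot_surjective a
    induction f using MonoidAlgebra.induction_linear with
    | zero => simp
    | add f g hf hg => simp [hf, hg]
    | single m c =>
      have := rel (mem_valuesOPIs.2 ⟨m, m, .inr (.inr (.inl rfl))⟩)
      simp only [rel3, ← op_mono, map_sub, I.toQuot_op] at this
      rw [hsingle, map_smul, map_smul, sub_eq_zero.1 this]

/-- A homomorphism that vanishes on the kernel of a surjection factors through it. -/
theorem exists_factor {A : Type w} {B : Type w'} {C : Type u} [NonUnitalRing A] [Module k A]
    [NonUnitalRing B] [Module k B] [NonUnitalRing C] [Module k C] (p : A →ₙₐ[k] B)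
    (hp : Function.Surjective p) (f : A →ₙₐ[k] C) (h : ∀ a, p a = 0 → f a = 0) :
    ∃ g : B →ₙₐ[k] C, ∀ a, g (p a) = f a := by
  have key (a a' : A) (e : p a = p a') : f a = f a' := by
    rw [← sub_eq_zero, ← map_sub] at e ⊢
    exact h _ e
  let s := Function.surjInv hp
  have hs : ∀ b, p (s b) = b := Function.surjInv_eq hp
  refine ⟨{
    toFun := fun b => f (s b)
    map_smul' := fun c b => ?_
    map_zero' := ?_
    map_add' := fun b b' => ?_
    map_mul' := fun b b' => ?_ }, fun a => key _ _ (hs _)⟩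
  · exact (key _ (c • s b) (by rw [hs, map_smul, hs])).trans (map_smul f c _)
  · exact (key _ 0 (by rw [hs, map_zero])).trans (map_zero f)
  · exact (key _ (s b + s b') (by rw [hs, map_add, hs, hs])).trans (map_add f _ _)
  · exact (key _ (s b * s b') (by rw [hs, map_mul, hs, hs])).trans (map_mul f _ _)

/-! ### Evaluation as a homomorphism of `Ω`-algebras -/

section Eval

variable {R : Type w'} [NonUnitalRing R] [Module k R] [OmegaAlgebra k R]

theorem evalOPI_op (r : Z → R) (ω : Op) (f : FreeOmega k Z) :
    evalOPI r (OmegaAlgebra.op (k := k) ω f) = OmegaAlgebra.op (k := k) ω (evalOPI r f) :=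
  congrArg (· f) (linearMap_ext
    (L := linExt (lift (fun ω a => OmegaAlgebra.op (k := k) ω a) r) ∘ₗ mapLin k (br ω))
    (L' := OmegaAlgebra.op ω ∘ₗ linExt (lift (fun ω a => OmegaAlgebra.op (k := k) ω a) r))
    fun m => by simp [mapLin_single, linExt_single, lift])

variable [IsScalarTower k R R] [SMulCommClass k R R]

/-- The evaluation at `r` as a homomorphism of algebras. -/
def evalHom (r : Z → R) : FreeOmega k Z →ₙₐ[k] R where
  toFun := evalOPI r
  map_smul' := map_smul (linExt (lift (fun ω a => OmegaAlgebra.op (k := k) ω a) r))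
  map_zero' := map_zero (linExt (k := k) (lift (fun ω a => OmegaAlgebra.op (k := k) ω a) r))
  map_add' := map_add (linExt (lift (fun ω a => OmegaAlgebra.op (k := k) ω a) r))
  map_mul' f g := by
    simp only [evalOPI_eq]
    induction f using MonoidAlgebra.induction_linear with
    | zero => simp
    | add f f' hf hf' => simp [add_mul, hf, hf']
    | single m c =>
      induction g using MonoidAlgebra.induction_linear with
      | zero => simp
      | add g g' hg hg' => simp [mul_add, hg, hg']
      | single m' c' =>
        rw [MonoidAlgebra.single_mul_single, linExt_single, linExt_single, linExt_single, lift_mul,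
          smul_mul_smul_comm]

/-- The kernel of an evaluation. -/
def evalKer (r : Z → R) : OmegaIdeal k (FreeOmega k Z) where
  toSubmodule := LinearMap.ker (evalHom (k := k) r : FreeOmega k Z →ₗ[k] R)
  isAlgIdeal a x hx := by
    have hx' : evalHom (k := k) r x = 0 := hx
    constructor
    · change evalHom r (a * x) = 0
      rw [map_mul, hx', mul_zero]
    · change evalHom r (x * a) = 0
      rw [map_mul, hx', zero_mul]
  op_mem ω x hx := by
    have hx' : evalOPI (k := k) r x = 0 := hx
    change evalOPI r (OmegaAlgebra.op ω x) = 0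
    rw [evalOPI_op, hx', map_zero]

theorem evalOPI_values (hR : IsDiffRB k 0 R) (r : Z → R) {f : FreeOmega k Z}
    (hf : f ∈ valuesOPIs (OdRB k) Z) : evalHom r f = 0 := by
  have hm (w : OpWord Z) : evalHom (k := k) r (mono k w) =
      lift (fun ω a => OmegaAlgebra.op (k := k) ω a) r w := evalOPI_mono r w
  have h1 := hR.deriv
  have h2 := hR.rotaBaxter
  have h3 := hR.section_eq
  simp only [zero_smul, add_zero] at h1 h2
  obtain ⟨a, b, rfl | rfl | rfl | rfl⟩ := mem_valuesOPIs.1 hf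
  · simp only [rel1, map_sub, hm, lift, lift_mul, h2]
    abel
  · simp only [rel2, map_sub, map_add, hm, lift, lift_mul, h1]
    abel
  · simp only [rel3, map_sub, hm, lift, h3, sub_self]
  · simp only [rel4, map_sub, map_add, hm, lift, lift_mul, h1, h3]
    abel

/-- Both sides are algebra homomorphisms out of `k𝒮(Z)` that agree on letters. -/
theorem evalHom_incl {A : Type w} [NonUnitalRing A] [Module k A]
    (π : MonoidAlgebra k (FreeSemigroup Z) →ₙₐ[k] A) (f : A →ₙₐ[k] R)
    (x : MonoidAlgebra k (FreeSemigroup Z)) :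
    evalHom (fun z => f (π (MonoidAlgebra.single (.of z) 1))) (incl k Z x) = f (π x) := by
  set r := fun z => f (π (MonoidAlgebra.single (.of z) 1)) with hr
  have key (m : FreeSemigroup Z) : evalHom r (incl k Z (MonoidAlgebra.single m 1)) =
      f (π (MonoidAlgebra.single m 1)) := by
    induction m using FreeSemigroup.recOnMul with
    | ih1 z =>
      rw [incl_apply, mapLin_single]
      exact evalOPI_mono r (of z)
    | ih2 z m hz hm =>
      have e : (MonoidAlgebra.single (FreeSemigroup.of z * m) 1 :
          MonoidAlgebra k (FreeSemigroup Z)) =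
          MonoidAlgebra.single (FreeSemigroup.of z) 1 * MonoidAlgebra.single m 1 := by simp
      rw [e, map_mul, map_mul, map_mul, map_mul, hz, hm]
  exact congrArg (· x) (linearMap_ext
    (L := ((evalHom r).comp (incl k Z) : MonoidAlgebra k (FreeSemigroup Z) →ₗ[k] R))
    (L' := (f.comp π : MonoidAlgebra k (FreeSemigroup Z) →ₗ[k] R)) key)

end Eval

/-- A map from `A` prescribes the values of the letters. Evaluation at these values kills both kinds
of generators of the ideal, which gives existence; a compatible homomorphism is determined on words
by induction over their construction, which gives uniqueness. -/
theorem exists_isFreeDiffRBOver {A : Type w} [NonUnitalRing A] [Module k A]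
    (π : MonoidAlgebra k (FreeSemigroup Z) →ₙₐ[k] A) (hπ : Function.Surjective π) :
    ∃ ι : A →ₙₐ[k] (relIdeal π).Quot,
      (∀ f, ι (π f) = (relIdeal π).toQuot (incl k Z f)) ∧ IsFreeDiffRBOver.{w'} (0 : k) ι := by
  have hsub := subset_omegaSpan (k := k) (valuesOPIs (OdRB k) Z ∪ incl k Z '' {f | π f = 0})
  obtain ⟨ι, hι'⟩ := exists_factor π hπ ((relIdeal π).toQuotHom.comp (incl k Z)) fun f hf =>
    (relIdeal π).toQuot_eq_zero.2 (hsub (.inr ⟨f, hf, rfl⟩))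
  have hι (x) : ι (π x) = (relIdeal π).toQuot (incl k Z x) := hι' x
  refine ⟨ι, hι, isDiffRB_quot (Set.subset_union_left.trans hsub), ?_⟩
  intro R _ _ _ _ _ hR f
  set r := fun z => f (π (MonoidAlgebra.single (.of z) 1)) with hr
  have hle : (relIdeal π).toSubmodule ≤ (evalKer (k := k) r).toSubmodule := by
    refine omegaSpan_le (Set.union_subset (fun x hx => evalOPI_values hR r hx) ?_)
    rintro _ ⟨x, hx, rfl⟩
    have hx' : π x = 0 := hx
    exact (evalHom_incl π f x).trans (by rw [hx', map_zero])
  obtain ⟨F, hF⟩ := exists_factor (relIdeal π).toQuotHom (relIdeal π).toQuot_surjective (evalHom r)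
    fun x hx => hle ((relIdeal π).toQuot_eq_zero.1 hx)
  have hF' (x : FreeOmega k Z) : F ((relIdeal π).toQuot x) = evalHom r x := hF x
  refine ⟨F, ⟨fun ω b => ?_, fun a => ?_⟩, fun F' ⟨hop', hinc⟩ => ?_⟩
  · obtain ⟨x, rfl⟩ := (relIdeal π).toQuot_surjective b
    rw [← OmegaIdeal.toQuot_op, hF', hF']
    exact evalOPI_op r ω x
  · obtain ⟨x, rfl⟩ := hπ a
    rw [hι]
    exact (hF _).trans (evalHom_incl π f x)
  · have key (m : OpWord Z) : F' ((relIdeal π).toQuot (mono k m)) = evalHom r (mono k m) := by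
      have hop (ω : Op) (m : OpWord Z)
          (h : F' ((relIdeal π).toQuot (mono k m)) = evalHom r (mono k m)) :
          F' ((relIdeal π).toQuot (mono k (br ω m))) = evalHom r (mono k (br ω m)) := by
        rw [← op_mono, OmegaIdeal.toQuot_op, hop', h]
        exact (evalOPI_op r ω _).symm
      have hof (z : Z) :
          F' ((relIdeal π).toQuot (mono k (of z))) = evalHom r (mono k (of z)) := by
        have e : mono k (of z) = incl k Z (MonoidAlgebra.single (.of z) 1) := by
          rw [incl_apply, mapLin_single]
          rfl
        rw [e, ← hι, hinc, evalHom_incl]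
      induction m with
      | of z => exact hof z
      | br ω m ih => exact hop ω m ih
      | ofCons z m ih =>
        rw [← of_mul, ← mono_mul, OmegaIdeal.toQuot_mul, map_mul, map_mul, hof, ih]
      | brCons ω m m' ih ih' =>
        rw [← br_mul, ← mono_mul, OmegaIdeal.toQuot_mul, map_mul, map_mul, hop ω m ih, ih']
    ext b
    obtain ⟨x, rfl⟩ := (relIdeal π).toQuot_surjective b
    rw [hF']
    exact congrArg (· x) (linearMap_ext (k := k)
      (L := (F' : (relIdeal π).Quot →ₗ[k] R) ∘ₗ (relIdeal π).toQuot)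
      (L' := (evalHom (k := k) r : FreeOmega k Z →ₗ[k] R)) key)

end Free

end DRB

end

theorem theoremS1 {k : Type v} [Field k] {Z : Type u} [LinearOrder Z]
    [WellFoundedLT Z] :
    -- `≤_PD` is a monomial order on `𝔖(Z)`
    DRB.IsMonomialOrder (DRB.OpWord.PDLT (Z := Z)) (DRB.OpWord.contexts Z) ∧
    -- the leading monomials of the four identities
    (∀ a b : DRB.OpWord Z,
      DRB.IsLeading DRB.OpWord.PDLT (DRB.evalOPI (fun i => DRB.mono k (![a, b] i)) (DRB.phi1 k))
        (DRB.OpWord.br DRB.Op.P a * DRB.OpWord.br DRB.Op.P b) ∧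
      DRB.IsLeading DRB.OpWord.PDLT (DRB.evalOPI (fun i => DRB.mono k (![a, b] i)) (DRB.phi2 k))
        (DRB.OpWord.br DRB.Op.D a * b) ∧
      DRB.IsLeading DRB.OpWord.PDLT (DRB.evalOPI (fun i => DRB.mono k (![a, b] i)) (DRB.phi3 k))
        (DRB.OpWord.br DRB.Op.D (DRB.OpWord.br DRB.Op.P a)) ∧
      DRB.IsLeading DRB.OpWord.PDLT (DRB.evalOPI (fun i => DRB.mono k (![a, b] i)) (DRB.phi4 k))
        (DRB.OpWord.br DRB.Op.P a * DRB.OpWord.br DRB.Op.D b)) ∧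
    -- the system is `Ω`-GS
    DRB.IsGS DRB.OpWord.PDLT (DRB.OpWord.contexts Z) DRB.OpWord.breadth
      (DRB.valuesOPIs (DRB.OdRB k) Z) ∧
    -- the algebras satisfying the system are the differential Rota–Baxter algebras of weight `0`
    (∀ (R : Type w') [NonUnitalRing R] [Module k R] [IsScalarTower k R R] [SMulCommClass k R R]
      [DRB.OmegaAlgebra k R], DRB.SatisfiesOPIs (DRB.OdRB k) R ↔ DRB.IsDiffRB k 0 R) ∧
    -- for every algebra `A = k𝒮(Z)/I_A`
    ∀ (A : Type w) [NonUnitalRing A] [Module k A] [IsScalarTower k A A] [SMulCommClass k A A]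
      (π : MonoidAlgebra k (FreeSemigroup Z) →ₙₐ[k] A), Function.Surjective π →
      -- the quotient of `k𝔖(Z)` is the free differential Rota–Baxter algebra of weight `0` over `A`
      (∃ ι : A →ₙₐ[k] (DRB.relIdeal π).Quot,
        (∀ f, ι (π f) = (DRB.relIdeal π).toQuot (DRB.incl k Z f)) ∧
        DRB.IsFreeDiffRBOver.{w'} (0 : k) ι) ∧
      -- for every GS basis `G` of `I_A` with respect to `≤_dlex`
      ∀ G : Set (MonoidAlgebra k (FreeSemigroup Z)),
        DRB.IsGS DRB.SemigroupDlexLT (DRB.semigroupContexts Z) FreeSemigroup.length G →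
        (∀ f, f ∈ DRB.algIdealSpan k G ↔ π f = 0) →
        -- `S_OdRB(Z) ∪ G` is a GS basis of `⟨S_OdRB(Z) ∪ I_A⟩`
        DRB.omegaSpan k (DRB.valuesOPIs (DRB.OdRB k) Z ∪ DRB.incl k Z '' G) = DRB.relIdeal π ∧
        DRB.IsGS DRB.OpWord.PDLT (DRB.OpWord.contexts Z) DRB.OpWord.breadth
          (DRB.valuesOPIs (DRB.OdRB k) Z ∪ DRB.incl k Z '' G) ∧
        -- the irreducible words are those avoiding the listed patterns
        DRB.Irr DRB.OpWord.PDLT (DRB.OpWord.contexts Z)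
            (DRB.valuesOPIs (DRB.OdRB k) Z ∪ DRB.incl k Z '' G) =
          {x | ∃ c ∈ DRB.OpWord.contexts Z,
            (∃ s ∈ G, ∃ m, DRB.IsLeading DRB.SemigroupDlexLT s m ∧ x = c (DRB.inclWord Z m)) ∨
            ∃ a b : DRB.OpWord Z,
              x = c (DRB.OpWord.br DRB.Op.P a * DRB.OpWord.br DRB.Op.P b) ∨
              x = c (DRB.OpWord.br DRB.Op.D a * b) ∨
              x = c (DRB.OpWord.br DRB.Op.D (DRB.OpWord.br DRB.Op.P a)) ∨
              x = c (DRB.OpWord.br DRB.Op.P a * DRB.OpWord.br DRB.Op.D b)}ᶜ ∧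
        -- and they form a linear basis of the quotient
        ∃ b : Module.Basis
            (DRB.Irr DRB.OpWord.PDLT (DRB.OpWord.contexts Z)
              (DRB.valuesOPIs (DRB.OdRB k) Z ∪ DRB.incl k Z '' G)) k (DRB.relIdeal π).Quot,
          ∀ x, b x = (DRB.relIdeal π).toQuot (DRB.mono k x.1) := by
  refine ⟨DRB.OpWord.isMonomialOrder_pdLT, fun a b => ⟨?_, ?_, ?_, ?_⟩, DRB.isGS_valuesOPIs,
    fun R => DRB.satisfiesOPIs_iff, fun A _ _ _ _ π hπ =>
    ⟨DRB.exists_isFreeDiffRBOver π hπ, fun G hG hker => ?_⟩⟩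
  · rw [DRB.evalOPI_word_phi1]
    exact (DRB.isLeading_rel1 a b).1
  · rw [DRB.evalOPI_word_phi2]
    exact (DRB.isLeading_rel2 a b).1
  · rw [DRB.evalOPI_word_phi3]
    exact (DRB.isLeading_rel3 a).1
  · rw [DRB.evalOPI_word_phi4]
    exact (DRB.isLeading_rel4 a b).1
  · have hspan := DRB.omegaSpan_relSet π hker
    have hGS := DRB.isGS_relSet hG
    refine ⟨hspan, hGS, DRB.irr_relSet, DRB.exists_basis_irr DRB.OpWord.isMonomialOrder_pdLT
      (DRB.OpWord.locallyConfluent_of_isGS hGS) (DRB.relIdeal π).toQuot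
      (DRB.relIdeal π).toQuot_surjective fun f => ?_⟩
    -- The kernel of the quotient map is generated by `S_OdRB(Z) ∪ G`, hence equals the span of
    -- contexts required by the basis criterion.
    rw [DRB.OmegaIdeal.toQuot_eq_zero, ← hspan, DRB.omegaSpan_toSubmodule]
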